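/- Let $G=\mathrm{SL}_3(\mathbb R)$, $\Gamma=\mathrm{SL}_3(\mathbb Z)$, and $g_t=\mathrm{diag}(e^t,e^t,e^{-2t})$ for $t\in\mathbb R$, acting on $G/\Gamma$ by left multiplication. A path $(w_t)_{t\ge 0}$ in $G/\Gamma$ is called divergent if for every compact set $K\subset G/\Gamma$ there is a time $T$ such that $w_t\notin K$ for all $t>T$ (with $t\ge 0$). Let $D\subset G/\Gamma$ be the set of points that lie on divergent trajectories of the flow, i.e. the points $x=g_sy$ with $s\ge 0$ and $y\in G/\Gamma$ such that $(g_ty)_{t\ge 0}$ is divergent. Then the Hausdorff dimension of $D$ is $7\tfrac13=\tfrac{22}{3}$. Here the Hausdorff dimension is taken with respect to any metric on $G/\Gamma$ that induces the quotient topology and for which the projection $G\to G/\Gamma$ is locally bi-Lipschitz, distances in $G$ being measured by the maximal difference of matrix entries (for instance the distance of any Riemannian metric on $G/\Gamma$); the value does not depend on this choice. -/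

import Mathlib

open Topology

namespace DivergentTrajectories

/-- The group `G = SL₃(ℝ)`, with the topology it inherits from the space of real matrices. -/
abbrev G : Type := Matrix.SpecialLinearGroup (Fin 3) ℝ

/-- The subgroup `Γ = SL₃(ℤ)` of `G`. -/
abbrev Γ : Subgroup G :=
  (Matrix.SpecialLinearGroup.map (n := Fin 3) (Int.castRingHom ℝ)).range

/-- The space `G/Γ` of left cosets `gΓ`, with the quotient topology and the action of `G` by left
multiplication. -/
abbrev X : Type := G ⧸ Γ

/-- The projection `g ↦ gΓ`. -/
abbrev proj (g : G) : X := (g : G ⧸ Γ)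

/-- The one-parameter subgroup `g_t = diag(e^t, e^t, e^{-2t})`. -/
noncomputable def flow (t : ℝ) : G :=
  ⟨Matrix.diagonal ![Real.exp t, Real.exp t, Real.exp (-2 * t)], by
    rw [Matrix.det_diagonal, Fin.prod_univ_three]
    simp only [Matrix.cons_val_zero, Matrix.cons_val_one, Matrix.cons_val_two, Matrix.head_cons,
      Matrix.tail_cons]
    rw [← Real.exp_add, ← Real.exp_add, ← Real.exp_zero]
    congr 1
    ring⟩

/-- A path `(w t)`, `t ≥ 0`, in `G/Γ` is divergent if it eventually leaves every compact set. -/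
def IsDivergent (w : ℝ → X) : Prop :=
  ∀ K : Set X, IsCompact K → ∃ T : ℝ, ∀ t : ℝ, 0 ≤ t → T < t → w t ∉ K

/-- The set of points of `G/Γ` that lie on a divergent trajectory `(g_t y)`, `t ≥ 0`, of the flow
induced by `(g_t)`. -/
def D : Set X :=
  {x | ∃ y : X, IsDivergent (fun t => flow t • y) ∧ ∃ s : ℝ, 0 ≤ s ∧ x = flow s • y}

/-- The array of the nine entries of `g`. -/
def entries (g : G) : Fin 3 → Fin 3 → ℝ := fun i j => g i j

/-- A metric on `G/Γ` is admissible if it induces the quotient topology and the covering map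
`G → G/Γ` is locally bi-Lipschitz, where distances in `G` are measured by the matrix entries
(the sup metric on `3 × 3` arrays). The distance of any Riemannian metric on the manifold `G/Γ`
is of this kind, and any two admissible metrics are locally bi-Lipschitz equivalent, so they all
give the same Hausdorff dimension. -/
structure IsAdmissible (m : MetricSpace X) : Prop where
  topology_eq : m.toPseudoMetricSpace.toUniformSpace.toTopologicalSpace =
    (inferInstance : TopologicalSpace X)
  locally_biLipschitz : ∀ g : G, ∃ U ∈ 𝓝 g, ∃ C : ℝ, 0 < C ∧ ∀ a ∈ U, ∀ b ∈ U,
    m.dist (proj a) (proj b) ≤ C * dist (entries a) (entries b) ∧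
    dist (entries a) (entries b) ≤ C * m.dist (proj a) (proj b)

/-- The Hausdorff dimension of a subset of `G/Γ` with respect to the metric `m`. -/
noncomputable def hausdorffDim (m : MetricSpace X) (S : Set X) : ENNReal :=
  @dimH X m.toEMetricSpace S

section Existence

/-- The sum of the absolute values of the entries of a matrix. -/
def absSum (A : Matrix (Fin 3) (Fin 3) ℝ) : ℝ := ∑ i, ∑ j, |A i j|

lemma absSum_nonneg (A) : 0 ≤ absSum A :=
  Finset.sum_nonneg fun _ _ => Finset.sum_nonneg fun _ _ => abs_nonneg _

lemma abs_le_absSum (A) (i j) : |A i j| ≤ absSum A :=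
  (Finset.single_le_sum (f := fun j => |A i j|) (fun _ _ => abs_nonneg _)
    (Finset.mem_univ j)).trans
  (Finset.single_le_sum (f := fun i => ∑ j, |A i j|)
    (fun _ _ => Finset.sum_nonneg fun _ _ => abs_nonneg _) (Finset.mem_univ i))

lemma absSum_add (A B) : absSum (A + B) ≤ absSum A + absSum B := by
  unfold absSum
  rw [← Finset.sum_add_distrib]
  refine Finset.sum_le_sum fun i _ => ?_
  rw [← Finset.sum_add_distrib]
  exact Finset.sum_le_sum fun j _ => abs_add_le _ _

lemma absSum_mul (A B) : absSum (A * B) ≤ absSum A * absSum B := by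
  have h1 : ∀ i j, |(A * B) i j| ≤ ∑ k, |A i k| * |B k j| := fun i j => by
    rw [Matrix.mul_apply]
    refine (Finset.abs_sum_le_sum_abs _ _).trans (Finset.sum_le_sum fun k _ => ?_)
    rw [abs_mul]
  have h2 : ∀ k, ∑ j, |B k j| ≤ absSum B := fun k =>
    Finset.single_le_sum (f := fun i => ∑ j, |B i j|)
      (fun _ _ => Finset.sum_nonneg fun _ _ => abs_nonneg _) (Finset.mem_univ k)
  calc absSum (A * B) ≤ ∑ i, ∑ j, ∑ k, |A i k| * |B k j| :=
        Finset.sum_le_sum fun i _ => Finset.sum_le_sum fun j _ => h1 i j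
    _ = ∑ i, ∑ k, |A i k| * ∑ j, |B k j| := by
        refine Finset.sum_congr rfl fun i _ => ?_
        rw [Finset.sum_comm]
        exact Finset.sum_congr rfl fun k _ => (Finset.mul_sum _ _ _).symm
    _ ≤ ∑ i, ∑ k, |A i k| * absSum B :=
        Finset.sum_le_sum fun i _ => Finset.sum_le_sum fun k _ =>
          mul_le_mul_of_nonneg_left (h2 k) (abs_nonneg _)
    _ = absSum A * absSum B := by
        simp only [absSum, Finset.sum_mul]

lemma absSum_neg_sub (A B) : absSum (A - B) = absSum (B - A) := by
  unfold absSum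
  simp only [Matrix.sub_apply, abs_sub_comm]

lemma continuous_absSum : Continuous absSum := by
  unfold absSum
  fun_prop

lemma absSum_one : absSum 1 = 3 := by
  simp [absSum, Fin.sum_univ_three, Matrix.one_apply]
  norm_num

lemma dist_entries_le (a b : G) :
    dist (entries a) (entries b) ≤ absSum (b.1 - a.1) := by
  refine (dist_pi_le_iff (absSum_nonneg _)).2 fun i => (dist_pi_le_iff (absSum_nonneg _)).2
    fun j => ?_
  rw [dist_comm, Real.dist_eq]
  exact abs_le_absSum (b.1 - a.1) i j

lemma absSum_le_dist (a b : G) :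
    absSum (b.1 - a.1) ≤ 9 * dist (entries a) (entries b) := by
  have h : ∀ i j, |(b.1 - a.1) i j| ≤ dist (entries a) (entries b) := fun i j => by
    have h1 := (dist_le_pi_dist (entries a i) (entries b i) j).trans
      (dist_le_pi_dist (entries a) (entries b) i)
    rwa [dist_comm, Real.dist_eq] at h1
  calc absSum (b.1 - a.1) ≤ ∑ _i : Fin 3, ∑ _j : Fin 3, dist (entries a) (entries b) :=
        Finset.sum_le_sum fun i _ => Finset.sum_le_sum fun j _ => h i j
    _ = 9 * dist (entries a) (entries b) := by simp; ring

/-- One half of the gauge below. -/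
noncomputable def half (c : G) : ℝ := Real.log (1 + absSum (c.1 - 1))

lemma half_nonneg (c : G) : 0 ≤ half c :=
  Real.log_nonneg (by linarith [absSum_nonneg (c.1 - 1)])

lemma half_mul (c d : G) : half (c * d) ≤ half c + half d := by
  unfold half
  have hc := absSum_nonneg (c.1 - 1)
  have hd := absSum_nonneg (d.1 - 1)
  rw [← Real.log_mul (by linarith) (by linarith)]
  refine Real.log_le_log (by linarith [absSum_nonneg ((c * d : G).1 - 1)]) ?_
  have e : (c * d : G).1 - 1 = (c.1 - 1) * (d.1 - 1) + ((c.1 - 1) + (d.1 - 1)) := by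
    rw [show (c * d : G).1 = c.1 * d.1 from rfl]
    noncomm_ring
  rw [e]
  have := absSum_add ((c.1 - 1) * (d.1 - 1)) ((c.1 - 1) + (d.1 - 1))
  have := absSum_add (c.1 - 1) (d.1 - 1)
  have := absSum_mul (c.1 - 1) (d.1 - 1)
  nlinarith

/-- A symmetric subadditive gauge on `G` which vanishes only at `1`. -/
noncomputable def gauge (c : G) : ℝ := half c + half c⁻¹

lemma gauge_nonneg (c : G) : 0 ≤ gauge c := add_nonneg (half_nonneg _) (half_nonneg _)

lemma gauge_inv (c : G) : gauge c⁻¹ = gauge c := by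
  unfold gauge
  rw [inv_inv, add_comm]

lemma gauge_mul (c d : G) : gauge (c * d) ≤ gauge c + gauge d := by
  unfold gauge
  rw [mul_inv_rev]
  linarith [half_mul c d, half_mul d⁻¹ c⁻¹]

lemma gauge_one : gauge 1 = 0 := by
  simp [gauge, half, absSum]

lemma continuous_gauge : Continuous gauge := by
  have h : Continuous half := by
    refine Continuous.log ?_ fun c => by linarith [absSum_nonneg (c.1 - 1)]
    exact continuous_const.add
      (continuous_absSum.comp (continuous_subtype_val.sub continuous_const))
  exact h.add (h.comp continuous_inv)

lemma exists_gauge_lt {U : Set G} (hU : U ∈ 𝓝 (1 : G)) :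
    ∃ δ > 0, ∀ c, gauge c < δ → c ∈ U := by
  have hi : IsInducing entries := IsInducing.subtypeVal
  rw [hi.nhds_eq_comap, (Metric.nhds_basis_ball.comap entries).mem_iff] at hU
  obtain ⟨ε, hε, hsub⟩ := hU
  refine ⟨Real.log (1 + ε), Real.log_pos (by linarith), fun c hc => hsub ?_⟩
  have h1 : half c < Real.log (1 + ε) := by
    have := half_nonneg c⁻¹
    unfold gauge at hc
    linarith
  have h2 := (Real.log_lt_log_iff (by linarith [absSum_nonneg (c.1 - 1)]) (by linarith)).1 h1
  have h3 := dist_entries_le 1 c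
  rw [Set.mem_preimage, Metric.mem_ball, dist_comm]
  have e : c.1 - (1 : G).1 = c.1 - 1 := rfl
  rw [e] at h3
  linarith

lemma smul_proj (c a : G) : c • proj a = proj (c * a) := rfl

/-- The quotient of the right-invariant metric `(a, b) ↦ gauge (b * a⁻¹)`. -/
noncomputable def qdist (x y : X) : ℝ := sInf (gauge '' {c : G | c • x = y})

lemma qdist_le {x y : X} {c : G} (h : c • x = y) : qdist x y ≤ gauge c :=
  csInf_le ⟨0, by rintro _ ⟨c, -, rfl⟩; exact gauge_nonneg c⟩ ⟨c, h, rfl⟩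

lemma exists_gauge_lt_of_qdist_lt {x y : X} {r : ℝ} (h : qdist x y < r) :
    ∃ c : G, c • x = y ∧ gauge c < r := by
  have hne : (gauge '' {c : G | c • x = y}).Nonempty :=
    Set.Nonempty.image _ (MulAction.exists_smul_eq G x y)
  obtain ⟨_, ⟨c, hc, rfl⟩, hlt⟩ := exists_lt_of_csInf_lt hne h
  exact ⟨c, hc, hlt⟩

lemma qdist_nonneg (x y : X) : 0 ≤ qdist x y :=
  Real.sInf_nonneg (by rintro _ ⟨c, -, rfl⟩; exact gauge_nonneg c)

lemma qdist_self (x : X) : qdist x x = 0 :=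
  le_antisymm (gauge_one ▸ qdist_le (one_smul G x)) (qdist_nonneg _ _)

lemma qdist_comm_le (x y : X) : qdist x y ≤ qdist y x := by
  refine le_of_forall_gt fun r hr => ?_
  obtain ⟨c, hc, hlt⟩ := exists_gauge_lt_of_qdist_lt hr
  have : c⁻¹ • x = y := by rw [← hc, inv_smul_smul]
  exact (qdist_le this).trans_lt (by rwa [gauge_inv])

lemma qdist_triangle (x y z : X) : qdist x z ≤ qdist x y + qdist y z := by
  refine le_of_forall_pos_lt_add fun ε hε => ?_
  obtain ⟨c, hc, h1⟩ := exists_gauge_lt_of_qdist_lt (lt_add_of_pos_right (qdist x y) (half_pos hε))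
  obtain ⟨d, hd, h2⟩ := exists_gauge_lt_of_qdist_lt (lt_add_of_pos_right (qdist y z) (half_pos hε))
  have h3 := gauge_mul d c
  have h4 : qdist x z ≤ gauge (d * c) := qdist_le (by rw [mul_smul, hc, hd])
  linarith

/-- Near `g` only the obvious element of small gauge carries `aΓ` to `bΓ`. -/
lemma exists_unique_small (g : G) : ∃ U ∈ 𝓝 g, ∃ δ > 0, ∀ a ∈ U, ∀ b ∈ U, ∀ c : G,
    gauge c < δ → c • proj a = proj b → c = b * a⁻¹ := by
  obtain ⟨V, hV, hVΓ⟩ : ∃ V ∈ 𝓝 (1 : G), ∀ v ∈ V, v ∈ Γ → v = 1 := by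
    obtain ⟨V, hV, h⟩ := (mem_nhds_induced ((↑) : Γ → G) 1 {1}).1
      ((isOpen_discrete ({1} : Set Γ)).mem_nhds rfl)
    exact ⟨V, hV, fun v hv hΓ => congrArg Subtype.val (h (show (⟨v, hΓ⟩ : Γ) ∈ _ from hv))⟩
  have hF : Continuous fun p : G × G × G => p.2.1⁻¹ * p.2.2 * p.1 := by fun_prop
  have hmem : (fun p : G × G × G => p.2.1⁻¹ * p.2.2 * p.1) ⁻¹' V ∈ 𝓝 (g, g, (1 : G)) :=
    hF.continuousAt.preimage_mem_nhds (by simpa using hV)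
  obtain ⟨U₁, hU₁, W, hW, h1⟩ := mem_nhds_prod_iff.1 hmem
  obtain ⟨U₂, hU₂, U₃, hU₃, h2⟩ := mem_nhds_prod_iff.1 hW
  obtain ⟨δ, hδ, hδU⟩ := exists_gauge_lt hU₃
  refine ⟨U₁ ∩ U₂, Filter.inter_mem hU₁ hU₂, δ, hδ, fun a ha b hb c hc hab => ?_⟩
  have hmemV : b⁻¹ * c * a ∈ V :=
    h1 (a := (a, b, c)) ⟨ha.1, h2 (a := (b, c)) ⟨hb.2, hδU c hc⟩⟩
  have hmemΓ : b⁻¹ * c * a ∈ Γ := by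
    rw [mul_assoc]
    exact QuotientGroup.eq.1 hab.symm
  have h3 := hVΓ _ hmemV hmemΓ
  rw [mul_assoc, inv_mul_eq_one] at h3
  rw [h3, mul_inv_cancel_right]

lemma eq_of_qdist_eq_zero {x y : X} (h : qdist x y = 0) : x = y := by
  obtain ⟨g, rfl⟩ := QuotientGroup.mk_surjective x
  obtain ⟨U, hU, δ, hδ, key⟩ := exists_unique_small g
  have hU' : (fun c : G => c * g) ⁻¹' U ∈ 𝓝 (1 : G) :=
    (continuous_mul_const g).continuousAt.preimage_mem_nhds (by simpa using hU)
  obtain ⟨η, hη, hηU⟩ := exists_gauge_lt hU'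
  obtain ⟨c, hc, hlt⟩ := exists_gauge_lt_of_qdist_lt (h ▸ lt_min hδ hη)
  have hcU : c * g ∈ U := hηU c (hlt.trans_le (min_le_right _ _))
  have hgU : g ∈ U := mem_of_mem_nhds hU
  by_contra hne
  have hc1 : c ≠ 1 := by
    rintro rfl
    exact hne (by rw [← hc, one_smul])
  have hpos : 0 < gauge c := by
    refine (gauge_nonneg c).lt_of_ne' fun h0 => hc1 ?_
    have : c ∈ ({1} : Set G) := by
      by_contra hcon
      obtain ⟨r, hr, hrU⟩ := exists_gauge_lt (isOpen_compl_singleton.mem_nhds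
        (show (1 : G) ∈ ({c} : Set G)ᶜ from fun e => hcon e.symm))
      exact hrU c (h0 ▸ hr) rfl
    exact this
  obtain ⟨d, hd, hdlt⟩ := exists_gauge_lt_of_qdist_lt (h ▸ hpos)
  have h1 := key g hgU (c * g) hcU d
    (hdlt.trans (hlt.trans_le (min_le_left _ _))) (hd.trans hc.symm)
  rw [mul_inv_cancel_right] at h1
  rw [h1] at hdlt
  exact lt_irrefl _ hdlt

/-- The metric `qdist` on `G/Γ`. -/
@[reducible] noncomputable def qmetric : MetricSpace X where
  dist := qdist
  dist_self := qdist_self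
  dist_comm x y := le_antisymm (qdist_comm_le x y) (qdist_comm_le y x)
  dist_triangle := qdist_triangle
  eq_of_dist_eq_zero := eq_of_qdist_eq_zero

lemma qmetric_topology :
    qmetric.toPseudoMetricSpace.toUniformSpace.toTopologicalSpace =
      (inferInstance : TopologicalSpace X) := by
  refine TopologicalSpace.ext_nhds fun x => ?_
  obtain ⟨g, rfl⟩ := QuotientGroup.mk_surjective x
  have hb := @Metric.nhds_basis_ball X qmetric.toPseudoMetricSpace (g : X)
  refine (Filter.HasBasis.ext hb (QuotientGroup.nhds_eq Γ g ▸ ((𝓝 g).basis_sets.map _)) ?_ ?_)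
  · intro r hr
    refine ⟨(fun b => gauge (b * g⁻¹)) ⁻¹' Set.Iio r, ?_, ?_⟩
    · have : Continuous fun b : G => gauge (b * g⁻¹) :=
        continuous_gauge.comp (continuous_mul_const _)
      exact this.continuousAt.preimage_mem_nhds (Iio_mem_nhds (by simpa [gauge_one] using hr))
    · rintro _ ⟨b, hb, rfl⟩
      refine lt_of_le_of_lt ?_ (show gauge (b * g⁻¹) < r from hb)
      refine (qdist_comm_le _ _).trans (qdist_le ?_)
      change (b * g⁻¹) • proj g = proj b
      rw [smul_proj, inv_mul_cancel_right]
  · intro U hU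
    have hU' : (fun c : G => c * g) ⁻¹' U ∈ 𝓝 (1 : G) :=
      (continuous_mul_const g).continuousAt.preimage_mem_nhds (by simpa using hU)
    obtain ⟨η, hη, hηU⟩ := exists_gauge_lt hU'
    refine ⟨η, hη, fun y hy => ?_⟩
    obtain ⟨c, hc, hlt⟩ := exists_gauge_lt_of_qdist_lt ((qdist_comm_le _ _).trans_lt hy)
    exact ⟨c * g, hηU c hlt, hc⟩

lemma gauge_bounds {M : ℝ} (hM : 1 ≤ M) {a b : G} (ha : absSum a.1 ≤ M)
    (ha' : absSum a⁻¹.1 ≤ M) (hb : absSum b.1 ≤ M) (hb' : absSum b⁻¹.1 ≤ M) :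
    gauge (b * a⁻¹) ≤ (18 * M ^ 3 + 18) * dist (entries a) (entries b) ∧
    dist (entries a) (entries b) ≤ (18 * M ^ 3 + 18) * gauge (b * a⁻¹) := by
  have hlog : ∀ c : G, half c ≤ absSum (c.1 - 1) := fun c =>
    (Real.log_le_sub_one_of_pos (by linarith [absSum_nonneg (c.1 - 1)])).trans (by linarith)
  have hval : ∀ p q : G, (p * q⁻¹ : G).1 - 1 = (p.1 - q.1) * (q⁻¹ : G).1 := fun p q => by
    have : q.1 * (q⁻¹ : G).1 = 1 := congrArg Subtype.val (mul_inv_cancel q)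
    rw [sub_mul, this]
    rfl
  have hval' : b.1 - a.1 = ((b * a⁻¹ : G).1 - 1) * a.1 := by
    have : (a⁻¹ : G).1 * a.1 = 1 := congrArg Subtype.val (inv_mul_cancel a)
    rw [hval, mul_assoc, this, mul_one]
  set s := absSum (b.1 - a.1) with hs
  set d := dist (entries a) (entries b) with hd
  have hs0 : 0 ≤ s := absSum_nonneg _
  have hd0 : 0 ≤ d := dist_nonneg
  have hM3 : M ≤ M ^ 3 := le_self_pow₀ hM (by norm_num)
  have hM2 : M ^ 2 ≤ M ^ 3 := pow_le_pow_right₀ hM (by norm_num)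
  constructor
  · have h1 : half (b * a⁻¹) ≤ s * M := by
      refine (hlog _).trans ?_
      rw [hval]
      exact (absSum_mul _ _).trans (mul_le_mul_of_nonneg_left ha' hs0)
    have h2 : half (b * a⁻¹)⁻¹ ≤ s * M := by
      refine (hlog _).trans ?_
      rw [mul_inv_rev, inv_inv, hval]
      refine (absSum_mul _ _).trans ?_
      rw [absSum_neg_sub a.1 b.1]
      exact mul_le_mul_of_nonneg_left hb' hs0
    have h3 : s ≤ 9 * d := absSum_le_dist a b
    have h4 : s * M ≤ 9 * d * M ^ 3 := mul_le_mul h3 hM3 (by linarith) (by linarith)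
    unfold gauge
    nlinarith
  · set x := absSum ((b * a⁻¹ : G).1 - 1) with hx
    have hx0 : 0 ≤ x := absSum_nonneg _
    have h1 : d ≤ s := dist_entries_le a b
    have h2 : s ≤ x * M := by
      rw [hs, hval']
      exact (absSum_mul _ _).trans (mul_le_mul_of_nonneg_left ha hx0)
    have h3 : x ≤ M ^ 2 + 3 := by
      have e1 := absSum_add ((b * a⁻¹ : G).1) (-1)
      have e2 : absSum ((b * a⁻¹ : G).1) ≤ absSum b.1 * absSum (a⁻¹ : G).1 := absSum_mul _ _
      have e3 : absSum b.1 * absSum (a⁻¹ : G).1 ≤ M * M :=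
        mul_le_mul hb ha' (absSum_nonneg _) (by linarith)
      have e4 : absSum (-1) = 3 := by
        rw [← zero_sub, absSum_neg_sub, sub_zero, absSum_one]
      rw [← sub_eq_add_neg, e4] at e1
      nlinarith
    have h4 : x ≤ (1 + x) * half (b * a⁻¹) := by
      have h5 := Real.one_sub_inv_le_log_of_pos (show 0 < 1 + x by linarith)
      have h6 := mul_le_mul_of_nonneg_left h5 (show 0 ≤ 1 + x by linarith)
      have h7 : (1 + x) * (1 - (1 + x)⁻¹) = x := by field_simp; ring
      rw [h7] at h6
      exact h6
    have hg : half (b * a⁻¹) ≤ gauge (b * a⁻¹) := le_add_of_nonneg_right (half_nonneg _)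
    have h8 : x ≤ (4 + M ^ 2) * gauge (b * a⁻¹) :=
      h4.trans (mul_le_mul (by linarith) hg (half_nonneg _) (by positivity))
    have h9 : x * M ≤ (4 + M ^ 2) * gauge (b * a⁻¹) * M :=
      mul_le_mul_of_nonneg_right h8 (by linarith)
    have h10 : (4 + M ^ 2) * M ≤ 18 * M ^ 3 + 18 := by nlinarith
    have h11 := mul_le_mul_of_nonneg_right h10 (gauge_nonneg (b * a⁻¹))
    nlinarith

/-- Admissible metrics exist: the quotient of a right-invariant metric on `G` is one. -/
theorem exists_isAdmissible : ∃ m : MetricSpace X, IsAdmissible m := by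
  refine ⟨qmetric, qmetric_topology, fun g => ?_⟩
  obtain ⟨U, hU, δ, hδ, key⟩ := exists_unique_small g
  set M : ℝ := absSum g.1 + absSum g⁻¹.1 + 1 with hM
  have h0 := absSum_nonneg g.1
  have h0' := absSum_nonneg g⁻¹.1
  have hc1 : Continuous fun a : G => absSum a.1 := continuous_absSum.comp continuous_subtype_val
  have hc2 : Continuous fun a : G => absSum a⁻¹.1 := hc1.comp continuous_inv
  have hU1 : {a : G | absSum a.1 < M} ∈ 𝓝 g :=
    hc1.continuousAt.preimage_mem_nhds (Iio_mem_nhds (show absSum g.1 < M by linarith))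
  have hU2 : {a : G | absSum a⁻¹.1 < M} ∈ 𝓝 g :=
    hc2.continuousAt.preimage_mem_nhds (Iio_mem_nhds (show absSum g⁻¹.1 < M by linarith))
  have hU3 : {p : G × G | gauge (p.2 * p.1⁻¹) < δ} ∈ 𝓝 (g, g) := by
    have : Continuous fun p : G × G => gauge (p.2 * p.1⁻¹) :=
      continuous_gauge.comp (by fun_prop)
    exact this.continuousAt.preimage_mem_nhds (Iio_mem_nhds (by simpa [gauge_one] using hδ))
  obtain ⟨W₁, hW₁, W₂, hW₂, hW⟩ := mem_nhds_prod_iff.1 hU3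
  refine ⟨U ∩ {a : G | absSum a.1 < M} ∩ {a : G | absSum a⁻¹.1 < M} ∩ (W₁ ∩ W₂),
    Filter.inter_mem (Filter.inter_mem (Filter.inter_mem hU hU1) hU2)
      (Filter.inter_mem hW₁ hW₂), 18 * M ^ 3 + 18, by positivity, ?_⟩
  rintro a ⟨⟨⟨ha, ha1⟩, ha2⟩, haW⟩ b ⟨⟨⟨hb, hb1⟩, hb2⟩, hbW⟩
  have hsmall : gauge (b * a⁻¹) < δ := hW (a := (a, b)) ⟨haW.1, hbW.2⟩
  have hab : (b * a⁻¹) • proj a = proj b := by rw [smul_proj, inv_mul_cancel_right]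
  have hq : qmetric.dist (proj a) (proj b) = gauge (b * a⁻¹) := by
    refine le_antisymm (qdist_le hab) (le_of_not_gt fun hlt => ?_)
    obtain ⟨c, hc, hclt⟩ := exists_gauge_lt_of_qdist_lt hlt
    rw [key a ha b hb c (hclt.trans hsmall) hc] at hclt
    exact lt_irrefl _ hclt
  rw [hq]
  exact gauge_bounds (by linarith) ha1.le ha2.le hb1.le hb2.le

end Existence

end DivergentTrajectories

/-! By Mahler's criterion a trajectory diverges exactly when the shortest vectors of the lattices
`flow t * g` ℤ³ tend to zero (`isDivergent_iff`). So `D` lifts to `Dlift`, and countable stability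
lets the dimension be computed in `G` (`hausdorffDim_D_eq`). Locally g = p · `unip x` · g₀ with p
preserving the contracted line. Conjugation by the flow keeps p bounded, so divergence depends only
on x in the plane. The six parameters of p contribute 6, and the point is that the relevant x have
dimension 4/3.

Upper bound: `step k` magnifies x by k³, so the unit square is cut into k⁶ cells. The function
`height` combines systole⁻² with a large multiple of the reciprocal systole of the dual lattice.
High in the cusp its sum over the cells is at most about k⁴ log² k times its value, not k⁶ times
(`exists_contraction`). Hence the x that stay high for n steps are covered by about k⁴ⁿ squares of
side k⁻³ⁿ (`exists_cover`), which gives dimension 4/3 as k → ∞.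

Lower bound: a tree of rational points is built (`IsNode.exists_children`). A point of denominator q
at scale T has about T^(4m+2) children with denominators about T^(2m+2) q, at mutual distances at
least about T^(-3m-4) q^(-3/2). Since q^(3/2) grows by about T^(3m+3) per level, the mass
distribution principle (`PointTree.le_dimH_prod`) yields any exponent below (4m+2)/(3m+3), here
(4m+1)/(3m+3), which tends to 4/3. The scale T tends to infinity along the branches, and the integer
vectors of consecutive nodes take turns being short, which forces divergence (`unip_mem_Dlift`). -/

namespace DivergentTrajectories

/-! ### Systoles of lattices, dual lattices and cross products -/

/-- An integer vector, seen as a real vector. -/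
def vec (v : Fin 3 → ℤ) : Fin 3 → ℝ := fun i => (v i : ℝ)

lemma one_le_norm_vec {v : Fin 3 → ℤ} (hv : v ≠ 0) : 1 ≤ ‖vec v‖ := by
  obtain ⟨i, hi⟩ := Function.ne_iff.1 hv
  refine le_trans ?_ (norm_le_pi_norm (vec v) i)
  have : (1 : ℤ) ≤ |v i| := Int.one_le_abs hi
  rw [Real.norm_eq_abs, vec]
  exact_mod_cast this

lemma norm_mulVec_le (A : Matrix (Fin 3) (Fin 3) ℝ) (x : Fin 3 → ℝ) :
    ‖A.mulVec x‖ ≤ absSum A * ‖x‖ := by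
  refine (pi_norm_le_iff_of_nonneg (mul_nonneg (absSum_nonneg _) (norm_nonneg _))).2 fun i => ?_
  rw [Matrix.mulVec, dotProduct, Real.norm_eq_abs]
  calc |∑ j, A i j * x j| ≤ ∑ j, |A i j| * ‖x‖ := by
        refine (Finset.abs_sum_le_sum_abs _ _).trans (Finset.sum_le_sum fun j _ => ?_)
        rw [abs_mul]
        exact mul_le_mul_of_nonneg_left (norm_le_pi_norm x j) (abs_nonneg _)
    _ = (∑ j, |A i j|) * ‖x‖ := (Finset.sum_mul _ _ _).symm
    _ ≤ absSum A * ‖x‖ := mul_le_mul_of_nonneg_right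
        (Finset.single_le_sum (f := fun i => ∑ j, |A i j|)
          (fun _ _ => Finset.sum_nonneg fun _ _ => abs_nonneg _) (Finset.mem_univ i))
        (norm_nonneg _)

lemma mulVec_inv_mulVec (g : G) (x : Fin 3 → ℝ) : (g⁻¹ : G).1.mulVec (g.1.mulVec x) = x := by
  rw [Matrix.mulVec_mulVec, show (g⁻¹ : G).1 * g.1 = 1 from congrArg Subtype.val (inv_mul_cancel g),
    Matrix.one_mulVec]

lemma norm_le_mulVec (g : G) (x : Fin 3 → ℝ) :
    ‖x‖ ≤ absSum (g⁻¹ : G).1 * ‖g.1.mulVec x‖ := by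
  conv_lhs => rw [← mulVec_inv_mulVec g x]
  exact norm_mulVec_le _ _

lemma absSum_pos (g : G) : 0 < absSum g.1 := by
  have h := norm_mulVec_le g.1 ((g⁻¹ : G).1.mulVec (vec fun _ => 1))
  have h1 := mulVec_inv_mulVec g⁻¹ (vec fun _ => 1)
  rw [inv_inv] at h1
  rw [h1] at h
  have h2 : 1 ≤ ‖vec fun _ => 1‖ := one_le_norm_vec fun h => one_ne_zero (congrFun h 0)
  refine (absSum_nonneg _).lt_of_ne fun h0 => ?_
  rw [← h0, zero_mul] at h
  linarith

/-- The length, in the sup norm, of the shortest nonzero vectors of the lattice `g ℤ³`. -/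
noncomputable def systole (g : G) : ℝ :=
  sInf ((fun v => ‖g.1.mulVec (vec v)‖) '' {v : Fin 3 → ℤ | v ≠ 0})

lemma finite_norm_vec_le (R : ℝ) : {v : Fin 3 → ℤ | ‖vec v‖ ≤ R}.Finite := by
  refine (Set.Finite.pi' (t := fun _ : Fin 3 => Set.Icc (-⌈R⌉) ⌈R⌉)
    fun _ => Set.finite_Icc _ _).subset fun v hv i => ?_
  have h1 : |(v i : ℝ)| ≤ R := (norm_le_pi_norm (vec v) i).trans hv
  have h2 : |(v i : ℝ)| ≤ (⌈R⌉ : ℝ) := h1.trans (Int.le_ceil R)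
  have h3 : |v i| ≤ ⌈R⌉ := by exact_mod_cast h2
  exact abs_le.1 h3

lemma systole_le (g : G) {v : Fin 3 → ℤ} (hv : v ≠ 0) : systole g ≤ ‖g.1.mulVec (vec v)‖ :=
  csInf_le ⟨0, by rintro _ ⟨v, -, rfl⟩; exact norm_nonneg _⟩ ⟨v, hv, rfl⟩

/-- Discreteness: ‖v‖ is bounded by a multiple of ‖g v‖, so only finitely many integer vectors
compete with a given one and the infimum is attained. -/
lemma exists_systole_eq (g : G) : ∃ v : Fin 3 → ℤ, v ≠ 0 ∧ systole g = ‖g.1.mulVec (vec v)‖ := by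
  set e : Fin 3 → ℤ := fun _ => 1
  have he : e ≠ 0 := fun h => one_ne_zero (congrFun h 0)
  set S := {v : Fin 3 → ℤ | v ≠ 0 ∧ ‖g.1.mulVec (vec v)‖ ≤ ‖g.1.mulVec (vec e)‖}
  have hS : S.Finite := by
    refine (finite_norm_vec_le (absSum (g⁻¹ : G).1 * ‖g.1.mulVec (vec e)‖)).subset ?_
    intro v hv
    exact (norm_le_mulVec g _).trans (mul_le_mul_of_nonneg_left hv.2 (absSum_nonneg _))
  obtain ⟨v, hv, hmin⟩ := Set.exists_min_image S (fun v => ‖g.1.mulVec (vec v)‖) hS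
    ⟨e, he, le_rfl⟩
  refine ⟨v, hv.1, le_antisymm (systole_le g hv.1) (le_csInf ⟨_, e, he, rfl⟩ ?_)⟩
  rintro _ ⟨w, hw, rfl⟩
  by_cases h : ‖g.1.mulVec (vec w)‖ ≤ ‖g.1.mulVec (vec e)‖
  · exact hmin w ⟨hw, h⟩
  · exact hv.2.trans (le_of_not_ge h)

lemma systole_pos (g : G) : 0 < systole g := by
  obtain ⟨v, hv, h⟩ := exists_systole_eq g
  rw [h]
  refine norm_pos_iff.2 fun h0 => ?_
  have := norm_le_mulVec g (vec v)
  rw [h0, norm_zero, mul_zero] at this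
  linarith [one_le_norm_vec hv]

lemma mul_mulVec (h g : G) (x : Fin 3 → ℝ) :
    (h * g : G).1.mulVec x = h.1.mulVec (g.1.mulVec x) := by
  rw [Matrix.mulVec_mulVec]
  rfl

lemma systole_le_mul (h g : G) : systole (h * g) ≤ absSum h.1 * systole g := by
  obtain ⟨v, hv, e⟩ := exists_systole_eq g
  rw [e]
  refine (systole_le _ hv).trans ?_
  rw [mul_mulVec]
  exact norm_mulVec_le _ _

lemma le_systole_mul (h g : G) : systole g ≤ absSum (h⁻¹ : G).1 * systole (h * g) := by
  have := systole_le_mul h⁻¹ (h * g)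
  rwa [inv_mul_cancel_left] at this

lemma inv_absSum_le_systole (g : G) : (absSum (g⁻¹ : G).1)⁻¹ ≤ systole g := by
  obtain ⟨v, hv, e⟩ := exists_systole_eq g
  have h1 := norm_le_mulVec g (vec v)
  have h2 := one_le_norm_vec hv
  rw [← e] at h1
  rw [inv_le_iff_one_le_mul₀ (absSum_pos _)]
  linarith

/-- The action of `Γ` does not change the lattice. -/
lemma systole_mul_mem (g : G) {γ : G} (hγ : γ ∈ Γ) : systole (g * γ) = systole g := by
  have key : ∀ g γ : G, γ ∈ Γ → systole g ≤ systole (g * γ) := by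
    rintro g _ ⟨γ, rfl⟩
    obtain ⟨v, hv, e⟩ := exists_systole_eq (g * Matrix.SpecialLinearGroup.map (Int.castRingHom ℝ) γ)
    have h1 : (Matrix.SpecialLinearGroup.map (Int.castRingHom ℝ) γ : G).1.mulVec (vec v) =
        vec (γ.1.mulVec v) := by
      funext i
      simp [vec, Matrix.mulVec, dotProduct]
    have h2 : γ.1.mulVec v ≠ 0 := fun h0 => hv (by
      have := congrArg ((γ⁻¹ : Matrix.SpecialLinearGroup (Fin 3) ℤ).1.mulVec) h0
      rwa [Matrix.mulVec_mulVec, Matrix.mulVec_zero,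
        show (γ⁻¹ : Matrix.SpecialLinearGroup (Fin 3) ℤ).1 * γ.1 = 1 from
          congrArg Subtype.val (inv_mul_cancel γ), Matrix.one_mulVec] at this)
    rw [e, mul_mulVec, h1]
    exact systole_le g h2
  refine le_antisymm ?_ (key g γ hγ)
  have := key (g * γ) γ⁻¹ (inv_mem hγ)
  rwa [mul_inv_cancel_right] at this

/-- The inverse transpose, whose lattice is dual to that of `g`. -/
noncomputable def dual (g : G) : G := (g⁻¹).transpose

lemma dual_mul (h g : G) : dual (h * g) = dual h * dual g := by
  apply Subtype.ext
  simp only [dual, mul_inv_rev]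
  exact Matrix.transpose_mul _ _

lemma dual_dual (g : G) : dual (dual g) = g := by
  have h : (dual g)⁻¹ = g.transpose := by
    rw [inv_eq_iff_mul_eq_one]
    apply Subtype.ext
    change (g⁻¹ : G).1.transpose * g.1.transpose = 1
    rw [← Matrix.transpose_mul, show g.1 * (g⁻¹ : G).1 = 1 from
      congrArg Subtype.val (mul_inv_cancel g), Matrix.transpose_one]
  apply Subtype.ext
  change ((dual g)⁻¹ : G).1.transpose = g.1
  rw [h]
  exact Matrix.transpose_transpose _

/-- The cofactor identity gᵀ(gx × gy) = det g · (x × y). It turns a plane spanned by two lattice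
vectors into a vector of the dual lattice whose length is controlled by theirs. -/
lemma dual_mulVec_cross (g : G) (x y : Fin 3 → ℝ) :
    (dual g).1.mulVec (crossProduct x y) = crossProduct (g.1.mulVec x) (g.1.mulVec y) := by
  have h1 : g.1.transpose.mulVec (crossProduct (g.1.mulVec x) (g.1.mulVec y)) =
      crossProduct x y := by
    have hd : g.1.det = 1 := g.2
    rw [Matrix.det_fin_three] at hd
    have : g.1.transpose.mulVec (crossProduct (g.1.mulVec x) (g.1.mulVec y)) =
        g.1.det • crossProduct x y := by
      rw [Matrix.det_fin_three]
      ext i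
      fin_cases i <;>
      simp [Matrix.mulVec, dotProduct, Fin.sum_univ_three, cross_apply] <;> ring
    rw [this, g.2, one_smul]
  rw [← h1, Matrix.mulVec_mulVec]
  have : (dual g).1 * g.1.transpose = 1 := by
    change (g⁻¹ : G).1.transpose * g.1.transpose = 1
    rw [← Matrix.transpose_mul, show g.1 * (g⁻¹ : G).1 = 1 from
      congrArg Subtype.val (mul_inv_cancel g), Matrix.transpose_one]
  rw [this, Matrix.one_mulVec]

lemma norm_cross_le (x y : Fin 3 → ℝ) : ‖crossProduct x y‖ ≤ 2 * (‖x‖ * ‖y‖) := by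
  have h : ∀ i j k l, ‖x i * y j - x k * y l‖ ≤ 2 * (‖x‖ * ‖y‖) := fun i j k l => by
    have a : ∀ i j, ‖x i * y j‖ ≤ ‖x‖ * ‖y‖ := fun i j => by
      rw [norm_mul]
      exact mul_le_mul (norm_le_pi_norm x i) (norm_le_pi_norm y j) (norm_nonneg _) (norm_nonneg _)
    linarith [norm_sub_le (x i * y j) (x k * y l), a i j, a k l]
  refine (pi_norm_le_iff_of_nonneg (by positivity)).2 fun i => ?_
  rw [cross_apply]
  fin_cases i
  · exact h 1 2 2 1
  · exact h 2 0 0 2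
  · exact h 0 1 1 0

/-- The cross product of integer vectors. -/
def icross (v w : Fin 3 → ℤ) : Fin 3 → ℤ := crossProduct v w

lemma vec_icross (v w : Fin 3 → ℤ) : vec (icross v w) = crossProduct (vec v) (vec w) := by
  funext i
  fin_cases i <;> simp [vec, icross, cross_apply]

lemma exists_smul_of_icross_eq_zero {v w : Fin 3 → ℤ} (hv : v ≠ 0) (h : icross v w = 0) :
    ∃ r : ℝ, vec w = r • vec v := by
  obtain ⟨i, hi⟩ := Function.ne_iff.1 hv
  have h0 := congrFun (congrArg vec h) 0
  have h1 := congrFun (congrArg vec h) 1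
  have h2 := congrFun (congrArg vec h) 2
  rw [vec_icross, cross_apply] at h0 h1 h2
  simp [vec] at h0 h1 h2
  have hi' : (v i : ℝ) ≠ 0 := by simpa using hi
  refine ⟨w i / v i, ?_⟩
  funext j
  simp only [vec, Pi.smul_apply, smul_eq_mul]
  rw [div_mul_eq_mul_div, eq_div_iff hi']
  fin_cases i <;> fin_cases j <;> simp <;> linarith

/-- How the shortest vector of a lattice can change under `h`: either the old one stays relevant,
or the dual lattice has a short vector. -/
lemma systole_step (h g : G) {v : Fin 3 → ℤ} (hv : v ≠ 0)
    (hmin : systole g = ‖g.1.mulVec (vec v)‖) :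
    ‖(h * g : G).1.mulVec (vec v)‖ ≤ systole (h * g) ∨
      systole (dual g) ≤ 2 * (absSum (h⁻¹ : G).1 * systole (h * g)) ^ 2 := by
  obtain ⟨w, hw, e⟩ := exists_systole_eq (h * g)
  -- If the new shortest vector w is parallel to v it is at least as long a multiple of it.
  -- Otherwise v × w is a nonzero dual vector of length at most 2 ‖gv‖ ‖gw‖ ≤ 2 ‖gw‖².
  by_cases hc : icross v w = 0
  · left
    obtain ⟨r, hr⟩ := exists_smul_of_icross_eq_zero hv hc
    have h1 := systole_le g hw
    rw [hmin, hr, Matrix.mulVec_smul, norm_smul] at h1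
    have h2 : 0 < ‖g.1.mulVec (vec v)‖ := hmin ▸ systole_pos g
    have h3 : 1 ≤ ‖r‖ := by nlinarith
    rw [e, hr, Matrix.mulVec_smul, norm_smul]
    nlinarith [norm_nonneg ((h * g : G).1.mulVec (vec v))]
  · right
    have h1 := systole_le (dual g) hc
    rw [vec_icross, dual_mulVec_cross] at h1
    have h2 := norm_cross_le (g.1.mulVec (vec v)) (g.1.mulVec (vec w))
    have h3 := systole_le g hw
    rw [hmin] at h3
    have h4 : ‖g.1.mulVec (vec w)‖ ≤ absSum (h⁻¹ : G).1 * systole (h * g) := by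
      rw [e, mul_mulVec]
      exact norm_le_mulVec h _
    have h5 := norm_nonneg (g.1.mulVec (vec v))
    nlinarith

/-! ### Reduction theory and Mahler's criterion -/

/-- The arguments are inner products of basis vectors u, v, w of a unimodular lattice, u being the
longest. Reducing u modulo v and w leaves a component in their plane of square length at most 3/4 of
`uu`, so the squared height of u over that plane is at least `uu / 4`. Its product with the squared
area d of (v, w) is 1, and d ≥ (3/4) ε⁴. -/
lemma gram_bound {uu vv ww uv uw vw ε : ℝ} (hε : 0 < ε)
    (hgram : uu * (vv * ww - vw ^ 2) - uv * (uv * ww - uw * vw) + uw * (uv * vw - uw * vv) = 1)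
    (hu : ∀ n m : ℤ, uu ≤ uu + n ^ 2 * vv + m ^ 2 * ww + 2 * n * uv + 2 * m * uw + 2 * n * m * vw)
    (hv : 2 * |vw| ≤ vv) (hw : 2 * |vw| ≤ ww) (hvu : vv ≤ uu) (hwu : ww ≤ uu)
    (hεv : ε ^ 2 ≤ vv) (hεw : ε ^ 2 ≤ ww) : 3 * ε ^ 4 * uu ≤ 16 := by
  have hv0 : 0 < vv := by nlinarith
  have hw0 : 0 < ww := by nlinarith
  have hvw := abs_nonneg vw
  have hD : 3 / 4 * (vv * ww) ≤ vv * ww - vw ^ 2 := by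
    have : (2 * |vw|) * (2 * |vw|) ≤ vv * ww := mul_le_mul hv hw (by positivity) hv0.le
    nlinarith [sq_abs vw]
  set d := vv * ww - vw ^ 2 with hd
  have hd0 : 0 < d := by nlinarith [mul_pos hv0 hw0]
  set α := (uv * ww - uw * vw) / d with hα
  set β := (uw * vv - uv * vw) / d with hβ
  have e1 : α * d = uv * ww - uw * vw := div_mul_cancel₀ _ hd0.ne'
  have e2 : β * d = uw * vv - uv * vw := div_mul_cancel₀ _ hd0.ne'
  have e3 : α * vv + β * vw = uv := by
    apply mul_right_cancel₀ hd0.ne'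
    calc (α * vv + β * vw) * d = (α * d) * vv + (β * d) * vw := by ring
      _ = uv * d := by rw [e1, e2, hd]; ring
  have e4 : α * vw + β * ww = uw := by
    apply mul_right_cancel₀ hd0.ne'
    calc (α * vw + β * ww) * d = (α * d) * vw + (β * d) * ww := by ring
      _ = uw * d := by rw [e1, e2, hd]; ring
  have e5 : d * (uu - α * uv - β * uw) = 1 := by
    calc d * (uu - α * uv - β * uw) = uu * d - (α * d) * uv - (β * d) * uw := by ring
      _ = 1 := by rw [e1, e2]; linarith
  -- α and β are the coordinates of the projection of u to the plane of v and w; rounding leaves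
  -- remainders of size at most 1/2.
  have h1 := hu (-round α) (-round β)
  push_cast at h1
  set a := α - round α with ha
  set b := β - round β with hb
  have ha1 : |a| ≤ 1 / 2 := abs_sub_round α
  have hb1 : |b| ≤ 1 / 2 := abs_sub_round β
  have h2 : uu ≤ (uu - α * uv - β * uw) + (a ^ 2 * vv + 2 * (a * b) * vw + b ^ 2 * ww) := by
    have hra : (round α : ℝ) = α - a := by rw [ha]; ring
    have hrb : (round β : ℝ) = β - b := by rw [hb]; ring
    rw [hra, hrb] at h1
    refine h1.trans (le_of_eq ?_)
    rw [← e3, ← e4]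
    ring
  have h3 : a ^ 2 ≤ 1 / 4 := by rw [← sq_abs]; nlinarith [abs_nonneg a]
  have h4 : b ^ 2 ≤ 1 / 4 := by rw [← sq_abs]; nlinarith [abs_nonneg b]
  have h5 : a * b * vw ≤ 1 / 4 * |vw| := by
    refine (le_abs_self _).trans ?_
    rw [abs_mul, abs_mul]
    refine mul_le_mul_of_nonneg_right ?_ hvw
    calc |a| * |b| ≤ 1 / 2 * (1 / 2) := mul_le_mul ha1 hb1 (abs_nonneg _) (by norm_num)
      _ = 1 / 4 := by norm_num
  have h6 : uu / 4 ≤ uu - α * uv - β * uw := by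
    have h10 := mul_le_mul_of_nonneg_right h3 hv0.le
    have h11 := mul_le_mul_of_nonneg_right h4 hw0.le
    linarith
  have h7 : ε ^ 4 ≤ vv * ww := by
    calc ε ^ 4 = ε ^ 2 * ε ^ 2 := by ring
      _ ≤ vv * ww := mul_le_mul hεv hεw (by positivity) hv0.le
  have h8 : d * (uu / 4) ≤ 1 := e5 ▸ mul_le_mul_of_nonneg_left h6 hd0.le
  have h9 : 3 / 4 * ε ^ 4 * (uu / 4) ≤ d * (uu / 4) :=
    mul_le_mul_of_nonneg_right (by linarith) (by linarith)
  linarith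

/-- The inner product of two columns of a matrix. -/
def colDot (A : Matrix (Fin 3) (Fin 3) ℝ) (i j : Fin 3) : ℝ := ∑ a, A a i * A a j

lemma colDot_gram (A : Matrix (Fin 3) (Fin 3) ℝ) {i j k : Fin 3} (hij : i ≠ j) (hik : i ≠ k)
    (hjk : j ≠ k) :
    colDot A i i * (colDot A j j * colDot A k k - colDot A j k ^ 2)
      - colDot A i j * (colDot A i j * colDot A k k - colDot A i k * colDot A j k)
      + colDot A i k * (colDot A i j * colDot A j k - colDot A i k * colDot A j j)
      = A.det ^ 2 := by
  rw [Matrix.det_fin_three]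
  simp only [colDot, Fin.sum_univ_three]
  fin_cases i <;> fin_cases j <;> fin_cases k <;>
    first | (exfalso; simp at hij hik hjk; done) | skip
  all_goals simp only [Fin.zero_eta, Fin.mk_one, Fin.reduceFinMk]; ring

/-- An element of `gΓ` whose columns cannot be shortened. -/
lemma exists_reduced (g : G) : ∃ γ ∈ Γ, ∀ δ ∈ Γ,
    ∑ i, colDot (g * γ : G).1 i i ≤ ∑ i, colDot (g * γ * δ : G).1 i i := by
  set F : Matrix.SpecialLinearGroup (Fin 3) ℤ → ℝ := fun γ =>
    ∑ i, colDot (g * Matrix.SpecialLinearGroup.map (Int.castRingHom ℝ) γ : G).1 i i with hF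
  set S := {γ : Matrix.SpecialLinearGroup (Fin 3) ℤ | F γ ≤ F 1}
  -- A bound on the squared column lengths of gγ bounds the columns of γ, which are integral.
  have hS : S.Finite := by
    set R := absSum (g⁻¹ : G).1 * √(F 1)
    have : ((fun γ : Matrix.SpecialLinearGroup (Fin 3) ℤ => fun i j => γ.1 j i) ⁻¹'
        {f | ∀ i, f i ∈ {v : Fin 3 → ℤ | ‖vec v‖ ≤ R}}).Finite := by
      refine Set.Finite.preimage ?_ (Set.Finite.pi' fun _ => finite_norm_vec_le R)
      intro γ _ δ _ h
      apply Subtype.ext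
      ext i j
      exact congrFun (congrFun h j) i
    refine this.subset fun γ hγ => ?_
    intro i
    refine (norm_le_mulVec g _).trans (mul_le_mul_of_nonneg_left ?_ (absSum_nonneg _))
    refine (pi_norm_le_iff_of_nonneg (Real.sqrt_nonneg _)).2 fun a => ?_
    rw [Real.norm_eq_abs]
    apply Real.abs_le_sqrt
    have e : (g.1.mulVec (vec fun j => γ.1 j i)) a =
        (g * Matrix.SpecialLinearGroup.map (Int.castRingHom ℝ) γ : G).1 a i := by
      change _ = (g.1 * (γ.1.map (Int.castRingHom ℝ))) a i
      simp [Matrix.mulVec, dotProduct, Matrix.mul_apply, vec]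
    rw [e]
    refine le_trans ?_ hγ
    set A := (g * Matrix.SpecialLinearGroup.map (Int.castRingHom ℝ) γ : G).1
    have h0 : ∀ i, 0 ≤ colDot A i i := fun i =>
      Finset.sum_nonneg fun b _ => mul_self_nonneg _
    calc A a i ^ 2 = A a i * A a i := sq _
      _ ≤ colDot A i i := Finset.single_le_sum (f := fun b => A b i * A b i)
          (fun b _ => mul_self_nonneg _) (Finset.mem_univ a)
      _ ≤ ∑ i, colDot A i i := Finset.single_le_sum (f := fun i => colDot A i i)
          (fun b _ => h0 b) (Finset.mem_univ i)
  obtain ⟨γ, hγ, hmin⟩ := Set.exists_min_image S F hS ⟨1, le_refl (F 1)⟩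
  refine ⟨_, ⟨γ, rfl⟩, ?_⟩
  rintro _ ⟨δ, rfl⟩
  rw [mul_assoc, ← map_mul]
  by_cases h : F (γ * δ) ≤ F 1
  · exact hmin _ h
  · exact (show F γ ≤ F 1 from hγ).trans (le_of_not_ge h)

/-- Adding an integer multiple of a column to another one, as an element of `Γ`. -/
def shear {i j : Fin 3} (h : i ≠ j) (n : ℤ) : Matrix.SpecialLinearGroup (Fin 3) ℤ :=
  ⟨Matrix.transvection i j n, Matrix.det_transvection_of_ne i j h n⟩

lemma mul_shear_same (g : G) {i j : Fin 3} (h : i ≠ j) (n : ℤ) (a : Fin 3) :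
    (g * Matrix.SpecialLinearGroup.map (Int.castRingHom ℝ) (shear h n) : G).1 a j =
      g.1 a j + n * g.1 a i := by
  have e : (Matrix.SpecialLinearGroup.map (Int.castRingHom ℝ) (shear h n) : G).1 =
      Matrix.transvection i j (n : ℝ) := by
    ext a b
    change ((Matrix.transvection i j n a b : ℤ) : ℝ) = _
    simp [Matrix.transvection, Matrix.one_apply, Matrix.single_apply]
  rw [Matrix.SpecialLinearGroup.coe_mul, e, Matrix.mul_transvection_apply_same]

lemma mul_shear_of_ne (g : G) {i j k : Fin 3} (h : i ≠ j) (hk : k ≠ j) (n : ℤ) (a : Fin 3) :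
    (g * Matrix.SpecialLinearGroup.map (Int.castRingHom ℝ) (shear h n) : G).1 a k = g.1 a k := by
  have e : (Matrix.SpecialLinearGroup.map (Int.castRingHom ℝ) (shear h n) : G).1 =
      Matrix.transvection i j (n : ℝ) := by
    ext a b
    change ((Matrix.transvection i j n a b : ℤ) : ℝ) = _
    simp [Matrix.transvection, Matrix.one_apply, Matrix.single_apply]
  rw [Matrix.SpecialLinearGroup.coe_mul, e, Matrix.mul_transvection_apply_of_ne _ _ _ _ hk]

lemma sum_eq_of_ne {i j k : Fin 3} (hij : i ≠ j) (hik : i ≠ k) (hjk : j ≠ k) (f : Fin 3 → ℝ) :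
    ∑ l, f l = f i + f j + f k := by
  rw [Fin.sum_univ_three]
  fin_cases i <;> fin_cases j <;> fin_cases k <;> simp at hij hik hjk ⊢ <;> ring

/-- Two shears change only column i, by integer multiples of the other columns; in the minimised sum
all other terms cancel. -/
lemma reduced_ineq {g : G} (hg : ∀ δ ∈ Γ, ∑ i, colDot g.1 i i ≤ ∑ i, colDot (g * δ : G).1 i i)
    {i j k : Fin 3} (hij : i ≠ j) (hik : i ≠ k) (hjk : j ≠ k) (n m : ℤ) :
    colDot g.1 i i ≤ colDot g.1 i i + n ^ 2 * colDot g.1 j j + m ^ 2 * colDot g.1 k k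
      + 2 * n * colDot g.1 i j + 2 * m * colDot g.1 i k + 2 * n * m * colDot g.1 j k := by
  have h := hg _ (mul_mem (⟨shear hij.symm n, rfl⟩ : _ ∈ Γ) ⟨shear hik.symm m, rfl⟩)
  rw [sum_eq_of_ne hij hik hjk, sum_eq_of_ne hij hik hjk, ← mul_assoc] at h
  have e1 : ∀ l, l ≠ i → ∀ a, (g * Matrix.SpecialLinearGroup.map (Int.castRingHom ℝ)
      (shear hij.symm n) * Matrix.SpecialLinearGroup.map (Int.castRingHom ℝ)
      (shear hik.symm m) : G).1 a l = g.1 a l := fun l hl a => by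
    rw [mul_shear_of_ne _ _ hl, mul_shear_of_ne _ _ hl]
  have e2 : ∀ a, (g * Matrix.SpecialLinearGroup.map (Int.castRingHom ℝ)
      (shear hij.symm n) * Matrix.SpecialLinearGroup.map (Int.castRingHom ℝ)
      (shear hik.symm m) : G).1 a i = g.1 a i + n * g.1 a j + m * g.1 a k := fun a => by
    rw [mul_shear_same, mul_shear_same, mul_shear_of_ne _ _ hik.symm]
  have e3 : ∀ l, l ≠ i → colDot (g * Matrix.SpecialLinearGroup.map (Int.castRingHom ℝ)
      (shear hij.symm n) * Matrix.SpecialLinearGroup.map (Int.castRingHom ℝ)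
      (shear hik.symm m) : G).1 l l = colDot g.1 l l := fun l hl => by
    simp only [colDot, e1 l hl]
  rw [e3 j hij.symm, e3 k hik.symm] at h
  have h' := sub_nonneg.2 h
  simp only [colDot, e2, Fin.sum_univ_three] at h' ⊢
  linarith

/-- Mahler's criterion: lattices with large systole have bounded bases. -/
theorem exists_bounded_of_le_systole {ε : ℝ} (hε : 0 < ε) {g : G} (hg : ε ≤ systole g) :
    ∃ γ ∈ Γ, ∀ i j, (g * γ : G).1 i j ^ 2 ≤ 16 / (3 * ε ^ 4) := by
  obtain ⟨γ, hγ, hred⟩ := exists_reduced g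
  refine ⟨γ, hγ, ?_⟩
  rw [← systole_mul_mem g hγ] at hg
  set h := g * γ
  have hcol : ∀ i, ε ^ 2 ≤ colDot h.1 i i := fun i => by
    have h1 := systole_le h (v := Pi.single i 1) (by simp)
    have h2 : ‖h.1.mulVec (vec (Pi.single i 1))‖ ≤ √(colDot h.1 i i) := by
      refine (pi_norm_le_iff_of_nonneg (Real.sqrt_nonneg _)).2 fun a => ?_
      rw [Real.norm_eq_abs]
      apply Real.abs_le_sqrt
      have e : h.1.mulVec (vec (Pi.single i 1)) a = h.1 a i := by
        rw [show vec (Pi.single i 1) = Pi.single i 1 from ?_]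
        · simp
        · funext j
          by_cases hj : j = i
          · subst hj; simp [vec]
          · simp [vec, hj]
      rw [e, sq]
      exact Finset.single_le_sum (f := fun b => h.1 b i * h.1 b i)
          (fun b _ => mul_self_nonneg _) (Finset.mem_univ a)
    have h3 := hg.trans (h1.trans h2)
    have h0 : 0 ≤ colDot h.1 i i := Finset.sum_nonneg fun b _ => mul_self_nonneg _
    calc ε ^ 2 ≤ √(colDot h.1 i i) ^ 2 := pow_le_pow_left₀ hε.le h3 2
      _ = _ := Real.sq_sqrt h0
  have habs : ∀ i j k : Fin 3, i ≠ j → i ≠ k → j ≠ k →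
      2 * |colDot h.1 i j| ≤ colDot h.1 j j := fun i j k hij hik hjk => by
    have h1 := reduced_ineq hred hij hik hjk 1 0
    have h2 := reduced_ineq hred hij hik hjk (-1) 0
    push_cast at h1 h2
    have : |colDot h.1 i j| ≤ colDot h.1 j j / 2 := abs_le.2 ⟨by linarith, by linarith⟩
    linarith
  have hcomm : ∀ i j, colDot h.1 i j = colDot h.1 j i := fun i j => by
    simp only [colDot, mul_comm]
  have hmax : ∀ i j k : Fin 3, i ≠ j → i ≠ k → j ≠ k → colDot h.1 j j ≤ colDot h.1 i i →
      colDot h.1 k k ≤ colDot h.1 i i → colDot h.1 i i ≤ 16 / (3 * ε ^ 4) :=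
    fun i j k hij hik hjk hj hk => by
      rw [le_div_iff₀ (by positivity)]
      have := gram_bound hε ((colDot_gram h.1 hij hik hjk).trans (by rw [h.2, one_pow])) (reduced_ineq hred hij hik hjk)
        (by rw [hcomm]; exact habs k j i hjk.symm hik.symm hij.symm)
        (habs j k i hjk hij.symm hik.symm) hj hk (hcol j) (hcol k)
      linarith
  obtain ⟨i, -, hi⟩ := Finset.exists_max_image Finset.univ (fun i => colDot h.1 i i)
    (Finset.univ_nonempty (α := Fin 3))
  have hi' : colDot h.1 i i ≤ 16 / (3 * ε ^ 4) := by
    refine hmax i (i + 1) (i + 2) ?_ ?_ ?_ (hi _ (Finset.mem_univ _)) (hi _ (Finset.mem_univ _))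
      <;> fin_cases i <;> decide
  intro a b
  refine le_trans ?_ ((hi b (Finset.mem_univ _)).trans hi')
  rw [sq]
  exact Finset.single_le_sum (f := fun c => h.1 c b * h.1 c b)
    (fun b _ => mul_self_nonneg _) (Finset.mem_univ a)

/-! ### Divergence expressed by systoles -/

/-- The elements of `G` over the points with divergent trajectories, described by systoles. -/
def Dlift : Set G := {g | ∀ ε : ℝ, 0 < ε → ∃ T : ℝ, ∀ t : ℝ, T < t → systole (flow t * g) < ε}

lemma isCompact_bounded (R : ℝ) : IsCompact {g : G | ∀ i j, g.1 i j ^ 2 ≤ R} := by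
  have hemb : IsClosedEmbedding (Subtype.val : G → Matrix (Fin 3) (Fin 3) ℝ) := by
    refine IsClosed.isClosedEmbedding_subtypeVal ?_
    exact isClosed_eq (Continuous.matrix_det continuous_id) continuous_const
  have hK : IsCompact (Set.pi Set.univ fun _ : Fin 3 => Set.pi Set.univ fun _ : Fin 3 =>
      Set.Icc (-√R) (√R)) :=
    isCompact_univ_pi fun _ => isCompact_univ_pi fun _ => isCompact_Icc
  refine (hemb.isCompact_preimage hK).of_isClosed_subset ?_ fun g hg i _ j _ => ?_
  · have : {g : G | ∀ i j, g.1 i j ^ 2 ≤ R} = ⋂ i, ⋂ j, {g : G | g.1 i j ^ 2 ≤ R} := by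
      ext; simp
    rw [this]
    refine isClosed_iInter fun i => isClosed_iInter fun j => isClosed_le ?_ continuous_const
    exact ((continuous_id.matrix_elem i j).comp
      (continuous_subtype_val : Continuous (Subtype.val : G → Matrix (Fin 3) (Fin 3) ℝ))).pow 2
  · exact abs_le.1 (Real.abs_le_sqrt (hg i j))

/-- The easy half of Mahler's criterion: finitely many of the increasing open images of {absSum g⁻¹
< n + 1} cover K, and the systole is at least 1 / absSum g⁻¹. -/
lemma exists_le_systole_of_isCompact {K : Set X} (hK : IsCompact K) :
    ∃ ε : ℝ, 0 < ε ∧ ∀ g : G, proj g ∈ K → ε ≤ systole g := by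
  set U : ℕ → Set X := fun n => proj '' {g : G | absSum (g⁻¹ : G).1 < n + 1}
  have hopen : ∀ n, IsOpen (U n) := fun n => by
    refine QuotientGroup.isOpenMap_coe _ ?_
    exact isOpen_lt ((continuous_absSum.comp continuous_subtype_val).comp continuous_inv)
      continuous_const
  have hcov : K ⊆ ⋃ n, U n := fun x _ => by
    obtain ⟨g, rfl⟩ := QuotientGroup.mk_surjective x
    obtain ⟨n, hn⟩ := exists_nat_gt (absSum (g⁻¹ : G).1)
    exact Set.mem_iUnion.2 ⟨n, g, by change absSum (g⁻¹ : G).1 < n + 1; linarith, rfl⟩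
  obtain ⟨n, hn⟩ := hK.elim_directed_cover U hopen hcov (directed_of_isDirected_le fun a b hab =>
    Set.image_mono fun g (hg : absSum (g⁻¹ : G).1 < a + 1) => hg.trans_le (by gcongr))
  refine ⟨((n : ℝ) + 1)⁻¹, by positivity, fun g hg => ?_⟩
  obtain ⟨h, hh, e⟩ := hn hg
  have hmem : h⁻¹ * g ∈ Γ := QuotientGroup.eq.1 e
  have := systole_mul_mem h hmem
  rw [mul_inv_cancel_left] at this
  rw [this]
  refine le_trans ?_ (inv_absSum_le_systole h)
  exact inv_anti₀ (absSum_pos _) (le_of_lt hh)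

lemma flow_add (s t : ℝ) : flow (s + t) = flow s * flow t := by
  apply Subtype.ext
  change Matrix.diagonal _ = Matrix.diagonal _ * Matrix.diagonal _
  rw [Matrix.diagonal_mul_diagonal]
  congr 1
  funext i
  fin_cases i <;> simp [mul_add, Real.exp_add]

lemma isDivergent_iff (g : G) : IsDivergent (fun t => flow t • proj g) ↔ g ∈ Dlift := by
  constructor
  · intro h ε hε
    obtain ⟨T, hT⟩ := h _ ((isCompact_bounded (16 / (3 * ε ^ 4))).image
      (QuotientGroup.continuous_mk (N := Γ)))
    refine ⟨max T 0, fun t ht => ?_⟩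
    by_contra! hcon
    obtain ⟨γ, hγ, hb⟩ := exists_bounded_of_le_systole hε hcon
    refine hT t ((le_max_right _ _).trans ht.le) ((le_max_left _ _).trans_lt ht)
      ⟨_, hb, ?_⟩
    change proj (flow t * g * γ) = proj (flow t * g)
    exact (QuotientGroup.eq.2 (by simpa [mul_assoc] using inv_mem hγ))
  · intro h K hK
    obtain ⟨ε, hε, hle⟩ := exists_le_systole_of_isCompact hK
    obtain ⟨T, hT⟩ := h ε hε
    exact ⟨T, fun t _ ht hmem => (hT t ht).not_ge (hle (flow t * g) hmem)⟩

/-- Divergence concerns only large times, so moving the starting point along the orbit has no effect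
and s = 0 suffices. -/
lemma proj_mem_D_iff (g : G) : proj g ∈ D ↔ g ∈ Dlift := by
  constructor
  · rintro ⟨y, hy, s, -, e⟩
    obtain ⟨h, rfl⟩ := QuotientGroup.mk_surjective y
    rw [← isDivergent_iff, e]
    intro K hK
    obtain ⟨T, hT⟩ := hy K hK
    refine ⟨max T 0 + |s|, fun t ht hlt => ?_⟩
    have h1 := neg_abs_le s
    have h2 := le_max_left T 0
    have h3 := le_max_right T 0
    change flow t • (flow s • proj h) ∉ K
    rw [smul_smul, ← flow_add]
    exact hT (t + s) (by linarith) (by linarith)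
  · intro h
    refine ⟨proj g, (isDivergent_iff g).2 h, 0, le_rfl, ?_⟩
    have : flow 0 = 1 := by
      apply Subtype.ext
      change Matrix.diagonal _ = 1
      rw [← Matrix.diagonal_one]
      congr 1
      funext i
      fin_cases i <;> simp
    rw [this, one_smul]

/-! ### Averaging a vector over a magnified grid -/

/-- Of K + 1 consecutive points, one of the two end points is at distance at least K/2 from 0, so
its term is at most 3/(K + 1). Removing it leaves K consecutive points, and induction compares the
sum with the harmonic series. -/
lemma sum_inv_max_le (K : ℕ) (c : ℝ) :
    ∑ i ∈ Finset.range K, (max 1 |c + i|)⁻¹ ≤ 3 * (1 + Real.log K) := by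
  have key : ∀ (K : ℕ) (c : ℝ),
      ∑ i ∈ Finset.range K, (max 1 |c + i|)⁻¹ ≤ 3 * (harmonic K : ℝ) := by
    intro K
    induction K with
    | zero => simp
    | succ K ih =>
      intro c
      rw [harmonic_succ]
      push_cast
      have hterm : ∀ y : ℝ, (K : ℝ) ≤ 2 * |y| → (max 1 |y|)⁻¹ ≤ 3 * ((K : ℝ) + 1)⁻¹ := by
        intro y hy
        rw [← div_eq_mul_inv, inv_le_comm₀ (by positivity) (by positivity), inv_div,
          div_le_iff₀ (by norm_num)]
        have h1 := le_max_left 1 |y|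
        have h2 := le_max_right 1 |y|
        linarith
      rcases le_total ((K : ℝ)) (2 * |c|) with h | h
      · rw [Finset.sum_range_succ']
        have h1 := ih (c + 1)
        have h2 := hterm c h
        have h3 : ∑ i ∈ Finset.range K, (max 1 |c + ((i + 1 : ℕ) : ℝ)|)⁻¹ =
            ∑ i ∈ Finset.range K, (max 1 |c + 1 + i|)⁻¹ := by
          refine Finset.sum_congr rfl fun i _ => ?_
          push_cast
          ring_nf
        rw [h3]
        push_cast
        rw [add_zero]
        linarith
      · rw [Finset.sum_range_succ]
        have h1 := ih c
        have h2 := hterm (c + K) (by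
          have := neg_abs_le c
          have := le_abs_self (c + K)
          linarith)
        linarith
  have h := harmonic_le_one_add_log K
  linarith [key K c]

/-- The unipotent element with `x` in the last column. -/
def unip (x : Fin 2 → ℝ) : G :=
  ⟨!![1, 0, x 0; 0, 1, x 1; 0, 0, 1], by simp [Matrix.det_fin_three]⟩

lemma unip_add (x y : Fin 2 → ℝ) : unip (x + y) = unip x * unip y := by
  apply Subtype.ext
  rw [Matrix.SpecialLinearGroup.coe_mul]
  ext i j
  fin_cases i <;> fin_cases j <;> simp [unip, Matrix.mul_apply, Fin.sum_univ_three, add_comm]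

lemma unip_zero : unip 0 = 1 := by
  apply Subtype.ext
  rw [Matrix.SpecialLinearGroup.coe_one]
  ext i j
  fin_cases i <;> fin_cases j <;> simp [unip]

lemma unip_inv (x : Fin 2 → ℝ) : (unip x)⁻¹ = unip (-x) := by
  rw [inv_eq_iff_mul_eq_one, ← unip_add, add_neg_cancel, unip_zero]

lemma unip_mulVec (x : Fin 2 → ℝ) (v : Fin 3 → ℝ) :
    (unip x).1.mulVec v = ![v 0 + x 0 * v 2, v 1 + x 1 * v 2, v 2] := by
  funext i
  fin_cases i <;> simp [unip, Matrix.mulVec, dotProduct, Fin.sum_univ_three]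

lemma dual_unip_mulVec (x : Fin 2 → ℝ) (v : Fin 3 → ℝ) :
    (dual (unip x)).1.mulVec v = ![v 0, v 1, v 2 - x 0 * v 0 - x 1 * v 1] := by
  have : (dual (unip x)).1 = (unip (-x)).1.transpose := by
    rw [← unip_inv]; rfl
  rw [this]
  funext i
  fin_cases i <;> simp [unip, Matrix.mulVec, dotProduct, Fin.sum_univ_three]
  ring

/-- The element `diag(k, k, k⁻²)` of the flow. -/
noncomputable def step (k : ℕ) : G := flow (Real.log k)

lemma flow_mulVec (t : ℝ) (v : Fin 3 → ℝ) :
    (flow t).1.mulVec v = ![Real.exp t * v 0, Real.exp t * v 1, Real.exp (-2 * t) * v 2] := by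
  funext i
  rw [flow, Matrix.mulVec_diagonal]
  fin_cases i <;> simp

lemma flow_neg (t : ℝ) : flow (-t) = (flow t)⁻¹ := by
  rw [eq_comm, inv_eq_iff_mul_eq_one, ← flow_add, add_neg_cancel]
  apply Subtype.ext
  change Matrix.diagonal _ = 1
  rw [← Matrix.diagonal_one]
  congr 1
  funext i
  fin_cases i <;> simp

lemma dual_flow (t : ℝ) : dual (flow t) = flow (-t) := by
  rw [flow_neg]
  apply Subtype.ext
  change ((flow t)⁻¹ : G).1.transpose = _
  rw [← flow_neg]
  exact Matrix.diagonal_transpose _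

lemma step_mulVec {k : ℕ} (hk : 0 < k) (v : Fin 3 → ℝ) :
    (step k).1.mulVec v = ![k * v 0, k * v 1, ((k : ℝ) ^ 2)⁻¹ * v 2] := by
  have hk' : (0 : ℝ) < k := by exact_mod_cast hk
  rw [step, flow_mulVec, Real.exp_log hk', show -2 * Real.log k = -(2 * Real.log k) by ring,
    Real.exp_neg, two_mul, Real.exp_add, Real.exp_log hk', sq]

lemma dual_step_mulVec {k : ℕ} (hk : 0 < k) (v : Fin 3 → ℝ) :
    (dual (step k)).1.mulVec v = ![(k : ℝ)⁻¹ * v 0, (k : ℝ)⁻¹ * v 1, (k : ℝ) ^ 2 * v 2] := by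
  have hk' : (0 : ℝ) < k := by exact_mod_cast hk
  rw [step, dual_flow, flow_mulVec, Real.exp_neg, Real.exp_log hk',
    show -2 * -Real.log k = 2 * Real.log k by ring, two_mul, Real.exp_add, Real.exp_log hk', sq]

/-- Points of the grid of mesh `1 / k³`. -/
noncomputable def gridPt (k : ℕ) (j : ℕ × ℕ) : Fin 2 → ℝ :=
  ![j.1 / (k : ℝ) ^ 3, j.2 / (k : ℝ) ^ 3]

/-- The element by which a lattice is multiplied to zoom in at the grid point with index `j`. -/
noncomputable def zoom (k : ℕ) (j : ℕ × ℕ) : G := step k * unip (gridPt k j)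

/-- The indices of the grid points of the unit square. -/
def gridIdx (k : ℕ) : Finset (ℕ × ℕ) := Finset.range (k ^ 3) ×ˢ Finset.range (k ^ 3)

lemma zoom_mulVec {k : ℕ} (hk : 0 < k) (j : ℕ × ℕ) (v : Fin 3 → ℝ) :
    (zoom k j).1.mulVec v = ((k : ℝ) ^ 2)⁻¹ •
      ![(k : ℝ) ^ 3 * v 0 + j.1 * v 2, (k : ℝ) ^ 3 * v 1 + j.2 * v 2, v 2] := by
  have hk' : (k : ℝ) ≠ 0 := by exact_mod_cast hk.ne'
  rw [zoom, mul_mulVec, unip_mulVec, step_mulVec hk]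
  funext i
  fin_cases i <;> simp [gridPt] <;> field_simp

lemma dual_zoom_mulVec {k : ℕ} (hk : 0 < k) (j : ℕ × ℕ) (v : Fin 3 → ℝ) :
    (dual (zoom k j)).1.mulVec v = (k : ℝ)⁻¹ •
      ![v 0, v 1, (k : ℝ) ^ 3 * v 2 - j.1 * v 0 - j.2 * v 1] := by
  have hk' : (k : ℝ) ≠ 0 := by exact_mod_cast hk.ne'
  rw [zoom, dual_mul, mul_mulVec, dual_unip_mulVec, dual_step_mulVec hk]
  funext i
  fin_cases i <;> simp [gridPt] <;> field_simp

lemma one_le_one_add_log (k : ℕ) : 1 ≤ 1 + Real.log ((k ^ 3 : ℕ) : ℝ) := by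
  have : 0 ≤ Real.log ((k ^ 3 : ℕ) : ℝ) := Real.log_natCast_nonneg _
  linarith

/-- If the last coordinate dominates, the two horizontal coordinates run through progressions of
step |v 2|. Bounding ‖u j‖² below by a product splits the sum into two harmonic sums, hence log².
Otherwise every image is at least of size k³‖v‖/2 and counting suffices. The square is the critical
power, at which only logarithms are lost. -/
lemma sum_zoom_le {k : ℕ} (hk : 0 < k) {v : Fin 3 → ℝ} (hv : v ≠ 0) :
    ∑ j ∈ gridIdx k, (‖(zoom k j).1.mulVec v‖ ^ 2)⁻¹ ≤
      36 * (1 + Real.log ((k ^ 3 : ℕ) : ℝ)) ^ 2 * (k : ℝ) ^ 4 * (‖v‖ ^ 2)⁻¹ := by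
  have hk' : (0 : ℝ) < k := by exact_mod_cast hk
  set L := 1 + Real.log ((k ^ 3 : ℕ) : ℝ) with hL
  have hL1 : 1 ≤ L := one_le_one_add_log k
  have hn : 0 < ‖v‖ := norm_pos_iff.2 hv
  set u : ℕ × ℕ → Fin 3 → ℝ := fun j =>
    ![(k : ℝ) ^ 3 * v 0 + j.1 * v 2, (k : ℝ) ^ 3 * v 1 + j.2 * v 2, v 2] with hu
  suffices h : ∑ j ∈ gridIdx k, (‖u j‖ ^ 2)⁻¹ ≤ 36 * L ^ 2 * (‖v‖ ^ 2)⁻¹ by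
    have e : ∀ j, (‖(zoom k j).1.mulVec v‖ ^ 2)⁻¹ = (k : ℝ) ^ 4 * (‖u j‖ ^ 2)⁻¹ := fun j => by
      rw [zoom_mulVec hk, norm_smul, mul_pow, mul_inv, Real.norm_of_nonneg (by positivity)]
      congr 1
      field_simp
    simp only [e]
    rw [← Finset.mul_sum]
    calc _ ≤ (k : ℝ) ^ 4 * (36 * L ^ 2 * (‖v‖ ^ 2)⁻¹) :=
          mul_le_mul_of_nonneg_left h (by positivity)
      _ = _ := by ring
  rcases le_or_gt ‖v‖ (2 * |v 2|) with hb | hb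
  · have hb0 : 0 < |v 2| := by linarith
    have hb1 : v 2 ≠ 0 := abs_pos.1 hb0
    have hterm : ∀ j : ℕ × ℕ, (‖u j‖ ^ 2)⁻¹ ≤ (|v 2| ^ 2)⁻¹ *
        ((max 1 |(k : ℝ) ^ 3 * v 0 / v 2 + j.1|)⁻¹ * (max 1 |(k : ℝ) ^ 3 * v 1 / v 2 + j.2|)⁻¹) := by
      intro j
      rw [← mul_inv, ← mul_inv]
      refine inv_anti₀ (by positivity) ?_
      have h2 : |v 2| ≤ ‖u j‖ := norm_le_pi_norm (u j) 2
      have h3 : |v 2| * max 1 |(k : ℝ) ^ 3 * v 0 / v 2 + j.1| ≤ ‖u j‖ := by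
        rw [mul_max_of_nonneg _ _ hb0.le, mul_one, ← abs_mul]
        refine max_le h2 (le_trans (le_of_eq ?_) (norm_le_pi_norm (u j) 0))
        rw [Real.norm_eq_abs]
        congr 1
        change _ = (k : ℝ) ^ 3 * v 0 + j.1 * v 2
        field_simp
      have h4 : |v 2| * max 1 |(k : ℝ) ^ 3 * v 1 / v 2 + j.2| ≤ ‖u j‖ := by
        rw [mul_max_of_nonneg _ _ hb0.le, mul_one, ← abs_mul]
        refine max_le h2 (le_trans (le_of_eq ?_) (norm_le_pi_norm (u j) 1))
        rw [Real.norm_eq_abs]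
        congr 1
        change _ = (k : ℝ) ^ 3 * v 1 + j.2 * v 2
        field_simp
      calc _ = (|v 2| * max 1 |(k : ℝ) ^ 3 * v 0 / v 2 + j.1|) *
            (|v 2| * max 1 |(k : ℝ) ^ 3 * v 1 / v 2 + j.2|) := by ring
        _ ≤ ‖u j‖ * ‖u j‖ := mul_le_mul h3 h4 (by positivity) (norm_nonneg _)
        _ = _ := (sq _).symm
    refine (Finset.sum_le_sum fun j _ => hterm j).trans ?_
    rw [← Finset.mul_sum, gridIdx, Finset.sum_product]
    simp only [← Finset.mul_sum, ← Finset.sum_mul]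
    have s1 := sum_inv_max_le (k ^ 3) ((k : ℝ) ^ 3 * v 0 / v 2)
    have s2 := sum_inv_max_le (k ^ 3) ((k : ℝ) ^ 3 * v 1 / v 2)
    calc _ ≤ (|v 2| ^ 2)⁻¹ * ((3 * L) * (3 * L)) := by
          refine mul_le_mul_of_nonneg_left (mul_le_mul s1 s2 ?_ (by positivity)) (by positivity)
          exact Finset.sum_nonneg fun i _ => by positivity
      _ = 9 * L ^ 2 * (|v 2| ^ 2)⁻¹ := by ring
      _ ≤ 9 * L ^ 2 * (4 * (‖v‖ ^ 2)⁻¹) := by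
          refine mul_le_mul_of_nonneg_left ?_ (by positivity)
          rw [← div_eq_mul_inv, inv_le_comm₀ (by positivity) (by positivity), inv_div,
            div_le_iff₀ (by norm_num)]
          nlinarith
      _ = _ := by ring
  · have hterm : ∀ j ∈ gridIdx k, (‖u j‖ ^ 2)⁻¹ ≤ 4 * (((k : ℝ) ^ 3) ^ 2)⁻¹ * (‖v‖ ^ 2)⁻¹ := by
      intro j hj
      rw [gridIdx, Finset.mem_product, Finset.mem_range, Finset.mem_range] at hj
      have hj1 : (j.1 : ℝ) ≤ (k : ℝ) ^ 3 := by exact_mod_cast hj.1.le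
      have hj2 : (j.2 : ℝ) ≤ (k : ℝ) ^ 3 := by exact_mod_cast hj.2.le
      have hbig : (k : ℝ) ^ 3 * ‖v‖ / 2 ≤ ‖u j‖ := by
        have hgen : ∀ (x : ℝ) (i : ℕ), |x| = ‖v‖ → (i : ℝ) ≤ (k : ℝ) ^ 3 →
            (k : ℝ) ^ 3 * ‖v‖ / 2 ≤ |(k : ℝ) ^ 3 * x + i * v 2| := by
          intro x i hx hi
          have h1 := abs_sub_abs_le_abs_sub ((k : ℝ) ^ 3 * x) (-(i * v 2))
          rw [sub_neg_eq_add, abs_neg, abs_mul, abs_mul, hx, abs_of_nonneg (by positivity),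
            Nat.abs_cast] at h1
          have h2 : (i : ℝ) * |v 2| ≤ (k : ℝ) ^ 3 * (‖v‖ / 2) :=
            mul_le_mul hi (by linarith) (abs_nonneg _) (by positivity)
          linarith
        obtain ⟨i, hi⟩ : ∃ i, ‖v i‖ = ‖v‖ := by
          obtain ⟨i, -, hi⟩ := Finset.exists_max_image Finset.univ (fun i => ‖v i‖)
            Finset.univ_nonempty
          exact ⟨i, le_antisymm (norm_le_pi_norm v i)
            ((pi_norm_le_iff_of_nonneg (norm_nonneg _)).2 fun l => hi l (Finset.mem_univ l))⟩
        fin_cases i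
        · exact (hgen (v 0) j.1 hi hj1).trans (norm_le_pi_norm (u j) 0)
        · exact (hgen (v 1) j.2 hi hj2).trans (norm_le_pi_norm (u j) 1)
        · have : |v 2| = ‖v‖ := hi
          linarith
      have h4 : ((k : ℝ) ^ 3 * ‖v‖ / 2) ^ 2 ≤ ‖u j‖ ^ 2 :=
        pow_le_pow_left₀ (by positivity) hbig 2
      refine (inv_anti₀ (by positivity) h4).trans (le_of_eq ?_)
      field_simp
      norm_num
    refine (Finset.sum_le_sum hterm).trans ?_
    rw [Finset.sum_const, nsmul_eq_mul, gridIdx, Finset.card_product, Finset.card_range]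
    have : ((k ^ 3 * k ^ 3 : ℕ) : ℝ) * (4 * (((k : ℝ) ^ 3) ^ 2)⁻¹ * (‖v‖ ^ 2)⁻¹) =
        4 * (‖v‖ ^ 2)⁻¹ := by
      push_cast
      field_simp
    rw [this]
    refine mul_le_mul_of_nonneg_right ?_ (by positivity)
    nlinarith

/-- On the dual side only the last coordinate varies. If one of the first two coordinates of v is
large, the corresponding index gives a harmonic sum and the other index a factor k³. The critical
power is now the first, with the same factor k⁴. -/
lemma sum_dual_zoom_le {k : ℕ} (hk : 0 < k) {v : Fin 3 → ℝ} (hv : v ≠ 0) :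
    ∑ j ∈ gridIdx k, ‖(dual (zoom k j)).1.mulVec v‖⁻¹ ≤
      12 * (1 + Real.log ((k ^ 3 : ℕ) : ℝ)) * (k : ℝ) ^ 4 * ‖v‖⁻¹ := by
  have hk' : (0 : ℝ) < k := by exact_mod_cast hk
  set L := 1 + Real.log ((k ^ 3 : ℕ) : ℝ) with hL
  have hL1 : 1 ≤ L := one_le_one_add_log k
  have hn : 0 < ‖v‖ := norm_pos_iff.2 hv
  set u : ℕ × ℕ → Fin 3 → ℝ := fun j =>
    ![v 0, v 1, (k : ℝ) ^ 3 * v 2 - j.1 * v 0 - j.2 * v 1] with hu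
  suffices h : ∑ j ∈ gridIdx k, ‖u j‖⁻¹ ≤ 12 * L * (k : ℝ) ^ 3 * ‖v‖⁻¹ by
    have e : ∀ j, ‖(dual (zoom k j)).1.mulVec v‖⁻¹ = (k : ℝ) * ‖u j‖⁻¹ := fun j => by
      rw [dual_zoom_mulVec hk, norm_smul, mul_inv, Real.norm_of_nonneg (by positivity), inv_inv]
    simp only [e]
    rw [← Finset.mul_sum]
    calc _ ≤ (k : ℝ) * (12 * L * (k : ℝ) ^ 3 * ‖v‖⁻¹) := mul_le_mul_of_nonneg_left h hk'.le
      _ = _ := by ring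
  have hinv : ∀ x : ℝ, ‖v‖ ≤ 4 * |x| → |x|⁻¹ ≤ 4 * ‖v‖⁻¹ := fun x hx => by
    have : 0 < |x| := by linarith
    rw [← div_eq_mul_inv, inv_le_comm₀ (by positivity) (by positivity), inv_div,
      div_le_iff₀ (by norm_num)]
    linarith
  have hfin : ∀ x : ℝ, ‖v‖ ≤ 4 * |x| →
      |x|⁻¹ * ((k : ℝ) ^ 3 * (3 * L)) ≤ 12 * L * (k : ℝ) ^ 3 * ‖v‖⁻¹ := fun x hx =>
    (mul_le_mul_of_nonneg_right (hinv x hx) (by positivity)).trans (le_of_eq (by ring))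
  by_cases h0 : ‖v‖ ≤ 4 * |v 0|
  · have hb0 : 0 < |v 0| := by linarith
    have hb1 : v 0 ≠ 0 := abs_pos.1 hb0
    have hterm : ∀ j : ℕ × ℕ, ‖u j‖⁻¹ ≤
        |v 0|⁻¹ * (max 1 |-((k : ℝ) ^ 3 * v 2 - j.2 * v 1) / v 0 + j.1|)⁻¹ := by
      intro j
      rw [← mul_inv]
      refine inv_anti₀ (by positivity) ?_
      rw [mul_max_of_nonneg _ _ hb0.le, mul_one, ← abs_mul]
      refine max_le (norm_le_pi_norm (u j) 0) (le_trans (le_of_eq ?_) (norm_le_pi_norm (u j) 2))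
      rw [Real.norm_eq_abs, ← abs_neg]
      congr 1
      change _ = (k : ℝ) ^ 3 * v 2 - j.1 * v 0 - j.2 * v 1
      field_simp
      ring
    refine (Finset.sum_le_sum fun j _ => hterm j).trans ?_
    rw [← Finset.mul_sum, gridIdx, Finset.sum_product_right]
    have hs : ∀ j ∈ Finset.range (k ^ 3), ∑ i ∈ Finset.range (k ^ 3),
        (max 1 |-((k : ℝ) ^ 3 * v 2 - (j : ℝ) * v 1) / v 0 + (i : ℝ)|)⁻¹ ≤ 3 * L :=
      fun j _ => sum_inv_max_le (k ^ 3) _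
    have hs' := Finset.sum_le_sum hs
    rw [Finset.sum_const, Finset.card_range, nsmul_eq_mul, Nat.cast_pow] at hs'
    exact (mul_le_mul_of_nonneg_left hs' (by positivity)).trans (hfin _ h0)
  by_cases h1 : ‖v‖ ≤ 4 * |v 1|
  · have hb0 : 0 < |v 1| := by linarith
    have hb1 : v 1 ≠ 0 := abs_pos.1 hb0
    have hterm : ∀ j : ℕ × ℕ, ‖u j‖⁻¹ ≤
        |v 1|⁻¹ * (max 1 |-((k : ℝ) ^ 3 * v 2 - j.1 * v 0) / v 1 + j.2|)⁻¹ := by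
      intro j
      rw [← mul_inv]
      refine inv_anti₀ (by positivity) ?_
      rw [mul_max_of_nonneg _ _ hb0.le, mul_one, ← abs_mul]
      refine max_le (norm_le_pi_norm (u j) 1) (le_trans (le_of_eq ?_) (norm_le_pi_norm (u j) 2))
      rw [Real.norm_eq_abs, ← abs_neg]
      congr 1
      change _ = (k : ℝ) ^ 3 * v 2 - j.1 * v 0 - j.2 * v 1
      field_simp
      ring
    refine (Finset.sum_le_sum fun j _ => hterm j).trans ?_
    rw [← Finset.mul_sum, gridIdx, Finset.sum_product]
    have hs : ∀ j ∈ Finset.range (k ^ 3), ∑ i ∈ Finset.range (k ^ 3),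
        (max 1 |-((k : ℝ) ^ 3 * v 2 - (j : ℝ) * v 0) / v 1 + (i : ℝ)|)⁻¹ ≤ 3 * L :=
      fun j _ => sum_inv_max_le (k ^ 3) _
    have hs' := Finset.sum_le_sum hs
    rw [Finset.sum_const, Finset.card_range, nsmul_eq_mul, Nat.cast_pow] at hs'
    exact (mul_le_mul_of_nonneg_left hs' (by positivity)).trans (hfin _ h1)
  · push Not at h0 h1
    have hterm : ∀ j ∈ gridIdx k, ‖u j‖⁻¹ ≤ 2 * ((k : ℝ) ^ 3)⁻¹ * ‖v‖⁻¹ := by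
      intro j hj
      rw [gridIdx, Finset.mem_product, Finset.mem_range, Finset.mem_range] at hj
      have hj1 : (j.1 : ℝ) ≤ (k : ℝ) ^ 3 := by exact_mod_cast hj.1.le
      have hj2 : (j.2 : ℝ) ≤ (k : ℝ) ^ 3 := by exact_mod_cast hj.2.le
      have h2 : |v 2| = ‖v‖ := by
        refine le_antisymm (norm_le_pi_norm v 2)
          ((pi_norm_le_iff_of_nonneg (abs_nonneg _)).2 fun l => ?_)
        by_contra! hcon
        have hlt : ∀ l, ‖v l‖ < ‖v‖ := fun l => by
          fin_cases l
          · change |v 0| < _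
            linarith [abs_nonneg (v 0)]
          · change |v 1| < _
            linarith [abs_nonneg (v 1)]
          · exact hcon.trans_le (norm_le_pi_norm v l)
        exact lt_irrefl _ ((pi_norm_lt_iff hn).2 hlt)
      have hbig : (k : ℝ) ^ 3 * ‖v‖ / 2 ≤ ‖u j‖ := by
        refine le_trans ?_ (norm_le_pi_norm (u j) 2)
        change _ ≤ |(k : ℝ) ^ 3 * v 2 - j.1 * v 0 - j.2 * v 1|
        have e1 := abs_sub_abs_le_abs_sub ((k : ℝ) ^ 3 * v 2 - j.1 * v 0) (j.2 * v 1)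
        have e2 := abs_sub_abs_le_abs_sub ((k : ℝ) ^ 3 * v 2) (j.1 * v 0)
        rw [abs_mul, abs_mul, h2, abs_of_nonneg (show (0 : ℝ) ≤ (k : ℝ) ^ 3 by positivity),
          Nat.abs_cast] at e2
        rw [abs_mul, Nat.abs_cast] at e1
        have e3 : (j.1 : ℝ) * |v 0| ≤ (k : ℝ) ^ 3 * (‖v‖ / 4) :=
          mul_le_mul hj1 (by linarith) (abs_nonneg _) (by positivity)
        have e4 : (j.2 : ℝ) * |v 1| ≤ (k : ℝ) ^ 3 * (‖v‖ / 4) :=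
          mul_le_mul hj2 (by linarith) (abs_nonneg _) (by positivity)
        linarith
      refine (inv_anti₀ (by positivity) hbig).trans (le_of_eq ?_)
      field_simp
    refine (Finset.sum_le_sum hterm).trans ?_
    rw [Finset.sum_const, nsmul_eq_mul, gridIdx, Finset.card_product, Finset.card_range]
    have : ((k ^ 3 * k ^ 3 : ℕ) : ℝ) * (2 * ((k : ℝ) ^ 3)⁻¹ * ‖v‖⁻¹) =
        2 * ((k : ℝ) ^ 3 * ‖v‖⁻¹) := by
      push_cast
      field_simp
    rw [this, mul_assoc]
    refine mul_le_mul_of_nonneg_right ?_ (by positivity)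
    nlinarith

/-! ### The height function and its contraction -/

/-- A height function on lattices. -/
noncomputable def height (A : ℝ) (g : G) : ℝ := (systole g ^ 2)⁻¹ + A * (systole (dual g))⁻¹

lemma height_nonneg {A : ℝ} (hA : 0 ≤ A) (g : G) : 0 ≤ height A g := by
  have := systole_pos g
  have := systole_pos (dual g)
  unfold height
  positivity

lemma height_mul_le {A C : ℝ} (hA : 0 ≤ A) (hC : 1 ≤ C) {h : G} (h1 : absSum (h⁻¹ : G).1 ≤ C)
    (h2 : absSum ((dual h)⁻¹ : G).1 ≤ C) (g : G) : height A (h * g) ≤ C ^ 2 * height A g := by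
  have key : ∀ h g : G, absSum (h⁻¹ : G).1 ≤ C → (systole (h * g))⁻¹ ≤ C * (systole g)⁻¹ := by
    intro h g h1
    have p1 := systole_pos g
    have p2 := systole_pos (h * g)
    have := (le_systole_mul h g).trans (mul_le_mul_of_nonneg_right h1 p2.le)
    rw [← div_eq_mul_inv, inv_le_comm₀ p2 (by positivity), inv_div, div_le_iff₀ (by positivity)]
    linarith
  have p1 := systole_pos g
  have p2 := systole_pos (h * g)
  have p3 := systole_pos (dual g)
  have k1 := key h g h1
  have k2 := key (dual h) (dual g) h2
  rw [← dual_mul] at k2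
  have k3 := pow_le_pow_left₀ (by positivity) k1 2
  rw [mul_pow, inv_pow, inv_pow] at k3
  have k4 := mul_le_mul_of_nonneg_left k2 hA
  have k5 : A * (C * (systole (dual g))⁻¹) ≤ C ^ 2 * (A * (systole (dual g))⁻¹) := by
    have : C ≤ C ^ 2 := by nlinarith
    calc _ = C * (A * (systole (dual g))⁻¹) := by ring
      _ ≤ _ := mul_le_mul_of_nonneg_right this (by positivity)
  unfold height
  linarith

/-- The second alternative of `systole_step` costs a term linear in the dual part of the height; a
large weight A will absorb it. -/
lemma inv_systole_sq_step {C : ℝ} {h g : G} (h1 : absSum (h⁻¹ : G).1 ≤ C)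
    {v : Fin 3 → ℤ} (hv : v ≠ 0) (hmin : systole g = ‖g.1.mulVec (vec v)‖) :
    (systole (h * g) ^ 2)⁻¹ ≤ (‖(h * g : G).1.mulVec (vec v)‖ ^ 2)⁻¹
      + 2 * C ^ 2 * (systole (dual g))⁻¹ := by
  have p2 := systole_pos (h * g)
  have p3 := systole_pos (dual g)
  have p4 : 0 < ‖(h * g : G).1.mulVec (vec v)‖ := p2.trans_le (systole_le _ hv)
  rcases systole_step h g hv hmin with hs | hs
  · have : (systole (h * g) ^ 2)⁻¹ ≤ (‖(h * g : G).1.mulVec (vec v)‖ ^ 2)⁻¹ :=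
      inv_anti₀ (by positivity) (pow_le_pow_left₀ (by positivity) hs 2)
    have : 0 ≤ 2 * C ^ 2 * (systole (dual g))⁻¹ := by positivity
    linarith
  · have hs' : systole (dual g) ≤ 2 * C ^ 2 * systole (h * g) ^ 2 := by
      refine hs.trans ?_
      rw [mul_pow, mul_assoc]
      have := pow_le_pow_left₀ (absSum_nonneg _) h1 2
      exact mul_le_mul_of_nonneg_left (mul_le_mul_of_nonneg_right this (by positivity)) (by norm_num)
    have : (systole (h * g) ^ 2)⁻¹ ≤ 2 * C ^ 2 * (systole (dual g))⁻¹ := by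
      rw [← div_eq_mul_inv, le_div_iff₀ p3, inv_mul_le_iff₀ (by positivity)]
      linarith
    have : 0 ≤ (‖(h * g : G).1.mulVec (vec v)‖ ^ 2)⁻¹ := by positivity
    linarith

/-- The same dichotomy for the first power, to be used with primal and dual lattices exchanged. The
error is a square root, hence of lower order than the height. -/
lemma inv_systole_step {C : ℝ} (hC : 0 ≤ C) {h g : G} (h1 : absSum (h⁻¹ : G).1 ≤ C)
    {v : Fin 3 → ℤ} (hv : v ≠ 0) (hmin : systole g = ‖g.1.mulVec (vec v)‖) :
    (systole (h * g))⁻¹ ≤ ‖(h * g : G).1.mulVec (vec v)‖⁻¹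
      + 2 * C * √((systole (dual g))⁻¹) := by
  have p2 := systole_pos (h * g)
  have p3 := systole_pos (dual g)
  have p4 : 0 < ‖(h * g : G).1.mulVec (vec v)‖ := p2.trans_le (systole_le _ hv)
  rcases systole_step h g hv hmin with hs | hs
  · have : (systole (h * g))⁻¹ ≤ ‖(h * g : G).1.mulVec (vec v)‖⁻¹ := inv_anti₀ p4 hs
    have : 0 ≤ 2 * C * √((systole (dual g))⁻¹) := by positivity
    linarith
  · have hs' : systole (dual g) ≤ 4 * C ^ 2 * systole (h * g) ^ 2 := by
      refine hs.trans ?_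
      rw [mul_pow]
      have := pow_le_pow_left₀ (absSum_nonneg _) h1 2
      have := mul_le_mul_of_nonneg_right this (sq_nonneg (systole (h * g)))
      have : 0 ≤ C ^ 2 * systole (h * g) ^ 2 := by positivity
      linarith
    have : (systole (h * g))⁻¹ ≤ 2 * C * √((systole (dual g))⁻¹) := by
      refine le_of_sq_le_sq ?_ (by positivity)
      rw [mul_pow, Real.sq_sqrt (by positivity), inv_pow, ← div_eq_mul_inv, le_div_iff₀ p3,
        inv_mul_le_iff₀ (by positivity)]
      linarith
    have : 0 ≤ ‖(h * g : G).1.mulVec (vec v)‖⁻¹ := by positivity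
    linarith

lemma gridIdx_bound (k : ℕ) : ∃ C : ℝ, 1 ≤ C ∧ ∀ j ∈ gridIdx k,
    absSum ((zoom k j)⁻¹ : G).1 ≤ C ∧ absSum ((dual (zoom k j))⁻¹ : G).1 ≤ C := by
  refine ⟨1 + ∑ j ∈ gridIdx k, (absSum ((zoom k j)⁻¹ : G).1 + absSum ((dual (zoom k j))⁻¹ : G).1),
    ?_, fun j hj => ?_⟩
  · have := Finset.sum_nonneg (s := gridIdx k) fun j _ =>
      add_nonneg (absSum_nonneg ((zoom k j)⁻¹ : G).1) (absSum_nonneg ((dual (zoom k j))⁻¹ : G).1)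
    linarith
  · have := Finset.single_le_sum (f := fun j => absSum ((zoom k j)⁻¹ : G).1 +
      absSum ((dual (zoom k j))⁻¹ : G).1)
      (fun j _ => add_nonneg (absSum_nonneg _) (absSum_nonneg _)) hj
    have h1 := absSum_nonneg ((zoom k j)⁻¹ : G).1
    have h2 := absSum_nonneg ((dual (zoom k j))⁻¹ : G).1
    constructor <;> linarith

/-- The contraction factor. -/
noncomputable def growth (k : ℕ) : ℝ := 50 * (1 + Real.log ((k ^ 3 : ℕ) : ℝ)) ^ 2 * (k : ℝ) ^ 4

/-- Contraction of the height function under averaging, high in the cusp. -/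
theorem exists_contraction {k : ℕ} (hk : 0 < k) : ∃ A : ℝ, 0 ≤ A ∧ ∃ M : ℝ, 1 ≤ M ∧ ∀ g : G,
    M ≤ height A g → ∑ j ∈ gridIdx k, height A (zoom k j * g) ≤ growth k * height A g := by
  obtain ⟨C, hC, hCj⟩ := gridIdx_bound k
  set N : ℝ := (((gridIdx k).card : ℕ) : ℝ) with hN
  have hN0 : 0 ≤ N := Nat.cast_nonneg _
  -- With this weight the total error in the primal sum, N · 2C² b, is exactly the dual part A b of
  -- the height.
  set A := 2 * C ^ 2 * N with hA
  have hA0 : 0 ≤ A := by positivity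
  set B := A * (N * (2 * C)) with hB
  have hB0 : 0 ≤ B := by positivity
  -- B collects the constants of the error in the dual sum; above this threshold the height
  -- dominates that error.
  refine ⟨A, hA0, 1 + B ^ 2, by nlinarith, fun g hg => ?_⟩
  set L := 1 + Real.log ((k ^ 3 : ℕ) : ℝ) with hL
  have hL1 : 1 ≤ L := one_le_one_add_log k
  have hk4 : (1 : ℝ) ≤ (k : ℝ) ^ 4 := one_le_pow₀ (by exact_mod_cast hk)
  have p1 := systole_pos g
  have p3 := systole_pos (dual g)
  obtain ⟨v, hv, hvmin⟩ := exists_systole_eq g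
  obtain ⟨c, hc, hcmin⟩ := exists_systole_eq (dual g)
  have hv' : g.1.mulVec (vec v) ≠ 0 := norm_pos_iff.1 (hvmin ▸ p1)
  have hc' : (dual g).1.mulVec (vec c) ≠ 0 := norm_pos_iff.1 (hcmin ▸ p3)
  have s1 := sum_zoom_le hk hv'
  have s2 := sum_dual_zoom_le hk hc'
  rw [← hvmin] at s1
  rw [← hcmin] at s2
  set a := (systole g ^ 2)⁻¹ with ha
  set b := (systole (dual g))⁻¹ with hb
  have ha0 : 0 ≤ a := by positivity
  have hb0 : 0 ≤ b := by positivity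
  have t1 : ∑ j ∈ gridIdx k, (systole (zoom k j * g) ^ 2)⁻¹ ≤
      36 * L ^ 2 * (k : ℝ) ^ 4 * a + N * (2 * C ^ 2 * b) := by
    calc _ ≤ ∑ j ∈ gridIdx k, ((‖(zoom k j).1.mulVec (g.1.mulVec (vec v))‖ ^ 2)⁻¹
          + 2 * C ^ 2 * b) := Finset.sum_le_sum fun j hj => by
            rw [← mul_mulVec]
            exact inv_systole_sq_step (hCj j hj).1 hv hvmin
      _ ≤ _ := by
        rw [Finset.sum_add_distrib, Finset.sum_const, nsmul_eq_mul]
        linarith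
  have t2 : ∑ j ∈ gridIdx k, (systole (dual (zoom k j * g)))⁻¹ ≤
      12 * L * (k : ℝ) ^ 4 * b + N * (2 * C * √((systole g)⁻¹)) := by
    calc _ ≤ ∑ j ∈ gridIdx k, (‖(dual (zoom k j)).1.mulVec ((dual g).1.mulVec (vec c))‖⁻¹
          + 2 * C * √((systole g)⁻¹)) := Finset.sum_le_sum fun j hj => by
            rw [← mul_mulVec, dual_mul]
            have := inv_systole_step (zero_le_one.trans hC) (hCj j hj).2 hc hcmin
            rwa [dual_dual] at this
      _ ≤ _ := by
        rw [Finset.sum_add_distrib, Finset.sum_const, nsmul_eq_mul]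
        linarith
  have e : height A g = a + A * b := rfl
  -- For y = systole^(-1/2) the primal part of the height is y⁴. If y ≤ B then B y ≤ B²; otherwise B
  -- y ≤ y², which is at most 1 or at most y⁴.
  have t3 : B * √((systole g)⁻¹) ≤ height A g := by
    set y := √((systole g)⁻¹) with hy
    have hy0 : 0 ≤ y := Real.sqrt_nonneg _
    have hy4 : y ^ 4 = a := by
      calc y ^ 4 = (y ^ 2) ^ 2 := by ring
        _ = a := by rw [hy, Real.sq_sqrt (by positivity), ha, inv_pow]
    rcases le_total y B with h | h
    · nlinarith
    · rcases le_total y 1 with h1 | h1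
      · nlinarith
      · have h2 : y ^ 2 ≤ y ^ 4 := pow_le_pow_right₀ h1 (by norm_num)
        have h3 : 0 ≤ A * b := mul_nonneg hA0 hb0
        nlinarith
  have e2 : ∑ j ∈ gridIdx k, height A (zoom k j * g) =
      ∑ j ∈ gridIdx k, (systole (zoom k j * g) ^ 2)⁻¹ +
      A * ∑ j ∈ gridIdx k, (systole (dual (zoom k j * g)))⁻¹ := by
    simp only [height, Finset.sum_add_distrib, Finset.mul_sum]
  rw [e2]
  have t4 := mul_le_mul_of_nonneg_left t2 hA0
  have hH : 0 ≤ height A g := height_nonneg hA0 g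
  set P := L ^ 2 * (k : ℝ) ^ 4 with hP
  have hP1 : 1 ≤ P := one_le_mul_of_one_le_of_one_le (one_le_pow₀ hL1) hk4
  have t5 : L * (k : ℝ) ^ 4 ≤ P := mul_le_mul_of_nonneg_right (by nlinarith) (by positivity)
  have hAb : 0 ≤ A * b := mul_nonneg hA0 hb0
  have t6 : 12 * (L * (k : ℝ) ^ 4) * (A * b) ≤ 12 * P * (A * b) :=
    mul_le_mul_of_nonneg_right (by linarith) hAb
  have t7 : A * (12 * L * (k : ℝ) ^ 4 * b + N * (2 * C * √((systole g)⁻¹))) =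
    12 * (L * (k : ℝ) ^ 4) * (A * b) + B * √((systole g)⁻¹) := by rw [hB]; ring
  have t8 : N * (2 * C ^ 2 * b) = A * b := by rw [hA]; ring
  have t9 : growth k * height A g = 50 * P * (a + A * b) := by
    rw [growth, e, hP]; ring
  rw [t9]
  rw [t7] at t4
  rw [t8] at t1
  have t10 : 36 * L ^ 2 * (k : ℝ) ^ 4 * a = 36 * P * a := by rw [hP]; ring
  have t11 : A * b ≤ P * (A * b) := le_mul_of_one_le_left hAb hP1
  have t12 : a + A * b ≤ P * (a + A * b) := le_mul_of_one_le_left (add_nonneg ha0 hAb) hP1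
  have t13 : 0 ≤ P * a := mul_nonneg (zero_le_one.trans hP1) ha0
  have t14 : 0 ≤ P * (A * b) := mul_nonneg (zero_le_one.trans hP1) hAb
  have t15 : 50 * P * (a + A * b) = 50 * (P * a) + 50 * (P * (A * b)) := by ring
  have t16 : P * (a + A * b) = P * a + P * (A * b) := by ring
  have t17 : 36 * P * a = 36 * (P * a) := by ring
  have t18 : 12 * P * (A * b) = 12 * (P * (A * b)) := by ring
  linarith

lemma absSum_unip_le {x : Fin 2 → ℝ} (hx : ∀ i, |x i| ≤ 1) :
    absSum (unip x).1 ≤ 5 ∧ absSum (dual (unip x)).1 ≤ 5 := by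
  have h : absSum (unip x).1 ≤ 5 := by
    have h0 := hx 0
    have h1 := hx 1
    simp [absSum, unip, Fin.sum_univ_three]
    linarith
  have h' : ∀ A : Matrix (Fin 3) (Fin 3) ℝ, absSum A.transpose = absSum A := fun A =>
    Finset.sum_comm
  refine ⟨h, ?_⟩
  have e : (dual (unip x)).1 = (unip (-x)).1.transpose := by rw [← unip_inv]; rfl
  rw [e, h']
  have h0 := hx 0
  have h1 := hx 1
  simp [absSum, unip, Fin.sum_univ_three]
  linarith

lemma dual_inv (g : G) : (dual g)⁻¹ = dual g⁻¹ := by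
  rw [inv_eq_iff_mul_eq_one, ← dual_mul, mul_inv_cancel]
  apply Subtype.ext
  simp [dual]

lemma height_unip_le {A : ℝ} (hA : 0 ≤ A) {x : Fin 2 → ℝ} (hx : ∀ i, |x i| ≤ 1) (g : G) :
    height A (unip x * g) ≤ 25 * height A g := by
  have hx' : ∀ i, |(-x) i| ≤ 1 := fun i => by rw [Pi.neg_apply, abs_neg]; exact hx i
  have := height_mul_le hA (C := 5) (by norm_num) (h := unip x)
    (by rw [unip_inv]; exact (absSum_unip_le hx').1)
    (by rw [dual_inv, unip_inv]; exact (absSum_unip_le hx').2) g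
  norm_num at this
  exact this

lemma step_mul_unip {k : ℕ} (hk : 0 < k) (z : Fin 2 → ℝ) :
    step k * unip (((k : ℝ) ^ 3)⁻¹ • z) = unip z * step k := by
  have hk' : (k : ℝ) ≠ 0 := by exact_mod_cast hk.ne'
  apply Subtype.ext
  apply Matrix.ext_of_mulVec_single
  intro i
  rw [mul_mulVec, mul_mulVec, unip_mulVec, step_mulVec hk, step_mulVec hk, unip_mulVec]
  funext l
  fin_cases l <;> simp <;> field_simp

/-! ### Covering the points whose trajectories stay high -/

/-- The points of the unit square along whose trajectories the height stays above `M` for `n`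
steps. -/
def highSet (k : ℕ) (A M : ℝ) (n : ℕ) (g : G) : Set (Fin 2 → ℝ) :=
  {x | (∀ i, 0 ≤ x i ∧ x i < 1) ∧ ∀ l ≤ n, M ≤ height A (step k ^ l * (unip x * g))}

/-- Each of the k⁶ cells of the square, magnified by k³, poses the same problem for `zoom k j * g`
with one step fewer. Summing the inductive bounds and contracting gives one more factor `growth k`.
Contraction is available only above M; below M nothing needs covering, because `unip x` changes the
height by a factor at most 25, which is why the set uses 25 M. -/
theorem exists_cover {k : ℕ} (hk : 0 < k) {A M : ℝ} (hA : 0 ≤ A) (hM : 1 ≤ M)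
    (hcon : ∀ g : G, M ≤ height A g →
      ∑ j ∈ gridIdx k, height A (zoom k j * g) ≤ growth k * height A g) (n : ℕ) (g : G) :
    ∃ t : Finset (Fin 2 → ℝ), (t.card : ℝ) ≤ growth k ^ n * height A g ∧
      ∀ x ∈ highSet k A (25 * M) n g, ∃ p ∈ t, ∀ i, |x i - p i| ≤ (((k : ℝ) ^ 3) ^ n)⁻¹ := by
  classical
  have hk' : (0 : ℝ) < k := by exact_mod_cast hk
  have hgr : 0 ≤ growth k := by unfold growth; positivity
  have hlow : ∀ n g, height A g < M → highSet k A (25 * M) n g = ∅ := by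
    intro n g hg
    refine Set.eq_empty_iff_forall_notMem.2 fun x hx => ?_
    have h1 := hx.2 0 (Nat.zero_le _)
    rw [pow_zero, one_mul] at h1
    have h2 := height_unip_le hA (x := x) (fun i => abs_le.2 ⟨by linarith [(hx.1 i).1],
      (hx.1 i).2.le⟩) g
    linarith
  induction n generalizing g with
  | zero =>
    by_cases hg : M ≤ height A g
    -- The single point is paid for by height ≥ M ≥ 1.
    · refine ⟨{0}, by simpa using hM.trans hg, fun x hx => ⟨0, by simp, fun i => ?_⟩⟩
      have := hx.1 i
      rw [pow_zero, inv_one, Pi.zero_apply, sub_zero]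
      exact abs_le.2 ⟨by linarith, this.2.le⟩
    · refine ⟨∅, by simpa using height_nonneg hA g, fun x hx => ?_⟩
      rw [hlow 0 g (not_le.1 hg)] at hx
      exact hx.elim
  | succ n ih =>
    by_cases hg : M ≤ height A g
    · choose t ht1 ht2 using ih
      refine ⟨(gridIdx k).biUnion fun j => (t (zoom k j * g)).image fun p =>
        gridPt k j + ((k : ℝ) ^ 3)⁻¹ • p, ?_, ?_⟩
      · calc _ ≤ ((∑ j ∈ gridIdx k, (t (zoom k j * g)).card : ℕ) : ℝ) := by
              exact_mod_cast Finset.card_biUnion_le.trans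
                (Finset.sum_le_sum fun j _ => Finset.card_image_le)
          _ ≤ ∑ j ∈ gridIdx k, growth k ^ n * height A (zoom k j * g) := by
              push_cast
              exact Finset.sum_le_sum fun j _ => ht1 _
          _ ≤ growth k ^ n * (growth k * height A g) := by
              rw [← Finset.mul_sum]
              exact mul_le_mul_of_nonneg_left (hcon g hg) (by positivity)
          _ = _ := by ring
      · intro x hx
        -- j is the cell containing x and z is the magnified position of x in that cell.
        set j : ℕ × ℕ := (⌊(k : ℝ) ^ 3 * x 0⌋₊, ⌊(k : ℝ) ^ 3 * x 1⌋₊) with hj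
        set z : Fin 2 → ℝ := (k : ℝ) ^ 3 • (x - gridPt k j) with hz
        have hx' : x = ((k : ℝ) ^ 3)⁻¹ • z + gridPt k j := by
          rw [hz, smul_smul, inv_mul_cancel₀ (by positivity), one_smul, sub_add_cancel]
        have hz0 : ∀ i, 0 ≤ z i ∧ z i < 1 := by
          have : ∀ y : ℝ, 0 ≤ y → 0 ≤ (k : ℝ) ^ 3 * (y - ⌊(k : ℝ) ^ 3 * y⌋₊ / (k : ℝ) ^ 3) ∧
              (k : ℝ) ^ 3 * (y - ⌊(k : ℝ) ^ 3 * y⌋₊ / (k : ℝ) ^ 3) < 1 := fun y hy => by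
            have e : (k : ℝ) ^ 3 * (y - ⌊(k : ℝ) ^ 3 * y⌋₊ / (k : ℝ) ^ 3) =
              (k : ℝ) ^ 3 * y - ⌊(k : ℝ) ^ 3 * y⌋₊ := by field_simp
            rw [e]
            have h1 := Nat.floor_le (show 0 ≤ (k : ℝ) ^ 3 * y by positivity)
            have h2 := Nat.lt_floor_add_one ((k : ℝ) ^ 3 * y)
            constructor <;> linarith
          intro i
          fin_cases i
          · exact this (x 0) (hx.1 0).1
          · exact this (x 1) (hx.1 1).1
        have hjm : j ∈ gridIdx k := by
          have : ∀ y : ℝ, 0 ≤ y → y < 1 → ⌊(k : ℝ) ^ 3 * y⌋₊ < k ^ 3 := fun y h0 h1 => by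
            rw [Nat.floor_lt (by positivity)]
            push_cast
            nlinarith [show (0 : ℝ) < (k : ℝ) ^ 3 by positivity]
          rw [gridIdx, Finset.mem_product, Finset.mem_range, Finset.mem_range]
          exact ⟨this _ (hx.1 0).1 (hx.1 0).2, this _ (hx.1 1).1 (hx.1 1).2⟩
        have hzm : z ∈ highSet k A (25 * M) n (zoom k j * g) := by
          refine ⟨hz0, fun l hl => ?_⟩
          have h1 := hx.2 (l + 1) (by omega)
          -- Conjugation by `step k` multiplies the unstable coordinate by k³, so time l + 1 for (x,
          -- g) is time l for (z, `zoom k j * g`).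
          have e : step k ^ (l + 1) * (unip x * g) =
              step k ^ l * (unip z * (zoom k j * g)) := by
            conv_lhs => rw [hx', unip_add, pow_succ]
            rw [zoom]
            simp only [mul_assoc]
            congr 1
            rw [← mul_assoc, step_mul_unip hk, mul_assoc]
          rwa [e] at h1
        obtain ⟨p, hp, hpz⟩ := ht2 _ z hzm
        refine ⟨_, Finset.mem_biUnion.2 ⟨j, hjm, Finset.mem_image_of_mem _ hp⟩, fun i => ?_⟩
        have e : x i - (gridPt k j + ((k : ℝ) ^ 3)⁻¹ • p) i = ((k : ℝ) ^ 3)⁻¹ * (z i - p i) := by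
          conv_lhs => rw [hx']
          simp only [Pi.add_apply, Pi.smul_apply, smul_eq_mul]
          ring
        rw [e, abs_mul, abs_of_nonneg (by positivity), pow_succ ((k : ℝ) ^ 3) n, mul_inv, mul_comm]
        exact mul_le_mul_of_nonneg_right (hpz i) (by positivity)
    · refine ⟨∅, ?_, fun x hx => ?_⟩
      · simpa using mul_nonneg (pow_nonneg hgr (n + 1)) (height_nonneg hA g)
      · rw [hlow _ g (not_le.1 hg)] at hx
        exact hx.elim

/-! ### Dimension bounds from covers -/

open MeasureTheory in
-- Such covers keep the d-dimensional Hausdorff measure at most H, hence finite.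
lemma dimH_le_of_covers {Z : Type*} [EMetricSpace Z] (E : Set Z) (d : NNReal)
    {ι : ℕ → Type} [∀ n, Fintype (ι n)] (T : ∀ n, ι n → Set Z) (r : ℕ → ℝ) (H : ℝ)
    (hr0 : ∀ n, 0 ≤ r n) (hr : Filter.Tendsto r Filter.atTop (𝓝 0))
    (hT : ∀ n i, ∀ x ∈ T n i, ∀ y ∈ T n i, edist x y ≤ ENNReal.ofReal (r n))
    (hE : ∀ n, E ⊆ ⋃ i, T n i) (hcard : ∀ n, (Fintype.card (ι n) : ℝ) * r n ^ (d : ℝ) ≤ H) :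
    dimH E ≤ d := by
  borelize Z
  refine dimH_le_of_hausdorffMeasure_ne_top (ne_top_of_le_ne_top (ENNReal.ofReal_ne_top (r := H)) ?_)
  refine (Measure.hausdorffMeasure_le_liminf_sum d E (l := Filter.atTop)
    (fun n => ENNReal.ofReal (r n)) ?_ T
    (Filter.Eventually.of_forall fun n i => Metric.ediam_le (hT n i))
    (Filter.Eventually.of_forall hE)).trans ?_
  · simpa using ENNReal.tendsto_ofReal hr
  · refine (Filter.liminf_le_liminf (v := fun _ => ENNReal.ofReal H)
      (Filter.Eventually.of_forall fun n => ?_)).trans (by simp)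
    calc ∑ i, Metric.ediam (T n i) ^ (d : ℝ) ≤ ∑ i : ι n, ENNReal.ofReal (r n) ^ (d : ℝ) :=
          Finset.sum_le_sum fun i _ => ENNReal.rpow_le_rpow (Metric.ediam_le (hT n i)) (NNReal.coe_nonneg d)
      _ = ENNReal.ofReal ((Fintype.card (ι n) : ℝ) * r n ^ (d : ℝ)) := by
        rw [Finset.sum_const, nsmul_eq_mul, ENNReal.ofReal_mul (Nat.cast_nonneg _),
          ENNReal.ofReal_natCast, ENNReal.ofReal_rpow_of_nonneg (hr0 n) (NNReal.coe_nonneg d), Finset.card_univ]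
      _ ≤ _ := ENNReal.ofReal_le_ofReal (hcard n)

/-- Local coordinates on `G`: two columns, and the position in the unstable direction. -/
abbrev Coord : Type := (Fin 3 × Fin 2 → ℝ) × (Fin 2 → ℝ)

/-- At scale K⁻ⁿ, K = k³, a cube in the six remaining coordinates needs (2Kⁿ)⁶ boxes and the high
set at most growthⁿ · height squares. Hypothesis `hd` says that these numbers, weighted by the power
d of the scale, stay bounded. -/
lemma dimH_box_highSet_le {k : ℕ} (hk : 2 ≤ k) {A M : ℝ} (hA : 0 ≤ A) (hM : 1 ≤ M)
    (hcon : ∀ g : G, M ≤ height A g →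
      ∑ j ∈ gridIdx k, height A (zoom k j * g) ≤ growth k * height A g) (g : G)
    (c : Fin 3 × Fin 2 → ℝ) (d : NNReal)
    (hd : ((k : ℝ) ^ 3) ^ 6 * growth k ≤ ((k : ℝ) ^ 3) ^ (d : ℝ)) :
    dimH {z : Coord | (∀ e, c e - 1 ≤ z.1 e ∧ z.1 e < c e + 1) ∧
      ∀ n, z.2 ∈ highSet k A (25 * M) n g} ≤ d := by
  have hk0 : 0 < k := by omega
  have hk' : (0 : ℝ) < k := by exact_mod_cast hk0
  choose t ht1 ht2 using fun n => exists_cover hk0 hA hM hcon n g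
  set K : ℝ := (k : ℝ) ^ 3 with hK
  have hK0 : 0 < K := by positivity
  have hK1 : 1 < K := one_lt_pow₀ (by exact_mod_cast hk) (by norm_num)
  have hgr : 0 ≤ growth k := by unfold growth; positivity
  refine dimH_le_of_covers _ d (ι := fun n => (Fin 3 × Fin 2 → Fin (2 * (k ^ 3) ^ n)) × t n)
    (fun n i => {z : Coord | (∀ e, |z.1 e - (c e - 1 + (i.1 e : ℕ) / K ^ n)| ≤ (K ^ n)⁻¹) ∧
      ∀ l, |z.2 l - i.2.1 l| ≤ (K ^ n)⁻¹}) (fun n => 2 * (K ^ n)⁻¹)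
    (2 ^ 6 * height A g * 2 ^ (d : ℝ)) (fun n => by positivity) ?_ ?_ ?_ ?_
  · have := (tendsto_inv_atTop_zero.comp (tendsto_pow_atTop_atTop_of_one_lt hK1)).const_mul 2
    simpa using this
  · rintro n i x ⟨hx1, hx2⟩ y ⟨hy1, hy2⟩
    rw [edist_dist]
    refine ENNReal.ofReal_le_ofReal ?_
    have key : ∀ a b p q : ℝ, |a - p| ≤ q → |b - p| ≤ q → |a - b| ≤ 2 * q := by
      intro a b p q h1 h2
      rw [abs_le] at *
      constructor <;> linarith
    refine max_le ((dist_pi_le_iff (by positivity)).2 fun e => ?_)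
      ((dist_pi_le_iff (by positivity)).2 fun e => ?_)
    · exact key _ _ _ _ (hx1 e) (hy1 e)
    · exact key _ _ _ _ (hx2 e) (hy2 e)
  · rintro n z ⟨hz1, hz2⟩
    obtain ⟨p, hp, hpz⟩ := ht2 n z.2 (hz2 n)
    have hKn : 0 < K ^ n := by positivity
    have hlt : ∀ e, ⌊(z.1 e - (c e - 1)) * K ^ n⌋₊ < 2 * (k ^ 3) ^ n := fun e => by
      have h1 := hz1 e
      rw [Nat.floor_lt (mul_nonneg (by linarith) hKn.le)]
      push_cast
      exact mul_lt_mul_of_pos_right (by linarith) hKn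
    refine Set.mem_iUnion.2 ⟨(fun e => ⟨_, hlt e⟩, ⟨p, hp⟩), fun e => ?_, hpz⟩
    have h0 : 0 ≤ z.1 e - (c e - 1) := by linarith [(hz1 e).1]
    have h1 := Nat.floor_le (show 0 ≤ (z.1 e - (c e - 1)) * K ^ n by positivity)
    have h2 := Nat.lt_floor_add_one ((z.1 e - (c e - 1)) * K ^ n)
    set f : ℝ := (⌊(z.1 e - (c e - 1)) * K ^ n⌋₊ : ℝ) with hf
    have e1 : z.1 e - (c e - 1 + f / K ^ n) = ((z.1 e - (c e - 1)) * K ^ n - f) * (K ^ n)⁻¹ := by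
      field_simp
      ring
    change |z.1 e - (c e - 1 + f / K ^ n)| ≤ _
    rw [e1, abs_mul, abs_of_nonneg (inv_nonneg.2 hKn.le)]
    refine mul_le_of_le_one_left (by positivity) (abs_le.2 ⟨by linarith, by linarith⟩)
  · intro n
    have hcard : (Fintype.card ((Fin 3 × Fin 2 → Fin (2 * (k ^ 3) ^ n)) × t n) : ℝ) =
        (2 * K ^ n) ^ 6 * (t n).card := by
      simp [hK]
    have hrp : (2 * (K ^ n)⁻¹) ^ (d : ℝ) = 2 ^ (d : ℝ) * ((K ^ (d : ℝ)) ^ n)⁻¹ := by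
      rw [Real.mul_rpow (by norm_num) (by positivity), Real.inv_rpow (by positivity),
        ← Real.rpow_natCast, ← Real.rpow_natCast, ← Real.rpow_mul hK0.le, ← Real.rpow_mul hK0.le,
        mul_comm (n : ℝ)]
    rw [hcard, hrp]
    have hH := height_nonneg hA g
    have h2d : (0 : ℝ) < 2 ^ (d : ℝ) := by positivity
    have hKd : 0 < K ^ (d : ℝ) := by positivity
    calc (2 * K ^ n) ^ 6 * (t n).card * (2 ^ (d : ℝ) * ((K ^ (d : ℝ)) ^ n)⁻¹)
        ≤ (2 * K ^ n) ^ 6 * (growth k ^ n * height A g) * (2 ^ (d : ℝ) * ((K ^ (d : ℝ)) ^ n)⁻¹) := by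
          gcongr
          exact ht1 n
      _ = 2 ^ 6 * height A g * 2 ^ (d : ℝ) * ((K ^ 6 * growth k) ^ n * ((K ^ (d : ℝ)) ^ n)⁻¹) := by
          rw [mul_pow, mul_pow, ← pow_mul, ← pow_mul, mul_comm n 6]
          ring
      _ ≤ 2 ^ 6 * height A g * 2 ^ (d : ℝ) * 1 := by
          refine mul_le_mul_of_nonneg_left ?_ (by positivity)
          rw [← div_eq_mul_inv, div_le_one (by positivity)]
          exact pow_le_pow_left₀ (by positivity) hd n
      _ = _ := mul_one _

/-! ### Passing between the quotient and the group -/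

lemma isInducing_entries : IsInducing entries := IsInducing.subtypeVal

lemma entries_injective : Function.Injective entries := fun _ _ h => Subtype.ext h

instance : SecondCountableTopology G := isInducing_entries.secondCountableTopology

/-- `G` is second countable, so countably many of the neighbourhoods cover it, and the dimension of
a countable union is the supremum. -/
lemma dimH_le_of_nhds {Y : Type*} [EMetricSpace Y] (f : G → Y) (S : Set G) (d : ENNReal)
    (h : ∀ g : G, ∃ U ∈ 𝓝 g, dimH (f '' (S ∩ U)) ≤ d) : dimH (f '' S) ≤ d := by
  choose U hU hd using h
  obtain ⟨s, hs, hcov⟩ := TopologicalSpace.countable_cover_nhds hU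
  have hsub : f '' S ⊆ ⋃ g ∈ s, f '' (S ∩ U g) := by
    rintro _ ⟨a, ha, rfl⟩
    have : a ∈ ⋃ g ∈ s, U g := hcov ▸ Set.mem_univ a
    obtain ⟨g, hg, hag⟩ := Set.mem_iUnion₂.1 this
    exact Set.mem_iUnion₂.2 ⟨g, hg, a, ⟨ha, hag⟩, rfl⟩
  refine (dimH_mono hsub).trans ?_
  rw [dimH_bUnion hs]
  exact iSup₂_le fun g _ => hd g

/-- The Hausdorff dimension of `D` can be computed in `G`. -/
theorem hausdorffDim_D_eq {m : MetricSpace X} (hm : IsAdmissible m) :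
    hausdorffDim m D = dimH (entries '' Dlift) := by
  let _ : EMetricSpace X := m.toEMetricSpace
  change dimH D = _
  have hD : D = proj '' Dlift := by
    ext x
    obtain ⟨g, rfl⟩ := QuotientGroup.mk_surjective x
    constructor
    · exact fun h => ⟨g, (proj_mem_D_iff g).1 h, rfl⟩
    · rintro ⟨a, ha, e⟩
      rw [← e]
      exact (proj_mem_D_iff a).2 ha
  rw [hD]
  refine le_antisymm ?_ ?_
  · refine dimH_le_of_nhds proj Dlift _ fun g => ?_
    obtain ⟨U, hU, C, hC, h⟩ := hm.locally_biLipschitz g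
    refine ⟨U, hU, ?_⟩
    have hinv : ∀ a, Function.invFun entries (entries a) = a :=
      Function.leftInverse_invFun entries_injective
    have hlip : LipschitzOnWith C.toNNReal (fun e => proj (Function.invFun entries e))
        (entries '' (Dlift ∩ U)) := by
      rintro _ ⟨a, ha, rfl⟩ _ ⟨b, hb, rfl⟩
      simp only [hinv]
      rw [edist_dist, edist_dist, show ((C.toNNReal : NNReal) : ENNReal) = ENNReal.ofReal C from rfl, ← ENNReal.ofReal_mul hC.le]
      exact ENNReal.ofReal_le_ofReal (h a ha.2 b hb.2).1
    have := hlip.dimH_image_le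
    rw [Set.image_image] at this
    simp only [hinv] at this
    exact this.trans (dimH_mono (Set.image_mono Set.inter_subset_left))
  · refine dimH_le_of_nhds entries Dlift _ fun g => ?_
    obtain ⟨U, hU, C, hC, h⟩ := hm.locally_biLipschitz g
    refine ⟨U, hU, ?_⟩
    -- The lower Lipschitz bound makes `proj` injective on this piece, so R inverts it there and is
    -- Lipschitz.
    set R : X → G := Function.invFunOn proj (Dlift ∩ U) with hR
    have hinv : ∀ a ∈ Dlift ∩ U, R (proj a) = a := fun a ha => by
      have h1 : R (proj a) ∈ Dlift ∩ U := Function.invFunOn_mem ⟨a, ha, rfl⟩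
      have h2 : proj (R (proj a)) = proj a := Function.invFunOn_eq ⟨a, ha, rfl⟩
      have h3 := (h _ h1.2 a ha.2).2
      rw [h2, m.dist_self, mul_zero] at h3
      exact entries_injective (dist_le_zero.1 h3)
    have hlip : LipschitzOnWith C.toNNReal (fun x => entries (R x)) (proj '' (Dlift ∩ U)) := by
      rintro _ ⟨a, ha, rfl⟩ _ ⟨b, hb, rfl⟩
      simp only [hinv a ha, hinv b hb]
      rw [edist_dist, edist_dist, show ((C.toNNReal : NNReal) : ENNReal) = ENNReal.ofReal C from rfl, ← ENNReal.ofReal_mul hC.le]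
      exact ENNReal.ofReal_le_ofReal (h a ha.2 b hb.2).2
    have h4 := hlip.dimH_image_le
    rw [Set.image_image] at h4
    have h5 : (fun a => entries (R (proj a))) '' (Dlift ∩ U) = entries '' (Dlift ∩ U) :=
      Set.image_congr fun a ha => by rw [hinv a ha]
    rw [h5] at h4
    exact h4.trans (dimH_mono (Set.image_mono Set.inter_subset_left))

/-! ### Local coordinates on the group -/

/-- The first two columns of an array. -/
def cols (e : Fin 3 → Fin 3 → ℝ) : Fin 3 × Fin 2 → ℝ := fun p => e p.1 p.2.castSucc

/-- The determinant of the upper left block. -/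
def minor (B : Fin 3 × Fin 2 → ℝ) : ℝ := B (0, 0) * B (1, 1) - B (0, 1) * B (1, 0)

/-- The columns of the identity matrix. -/
def idCols : Fin 3 × Fin 2 → ℝ := cols (entries 1)

/-- The unstable coordinate of an array. -/
noncomputable def unst (e : Fin 3 → Fin 3 → ℝ) : Fin 2 → ℝ :=
  ![(e 1 1 * e 0 2 - e 0 1 * e 1 2) / minor (cols e),
    (e 0 0 * e 1 2 - e 1 0 * e 0 2) / minor (cols e)]

/-- The array of entries of `p * unip x`, where `p` fixes the repelling direction and has the
first two columns `B`. -/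
noncomputable def param (z : Coord) : Fin 3 → Fin 3 → ℝ := fun i =>
  ![z.1 (i, 0), z.1 (i, 1), z.1 (i, 0) * z.2 0 + z.1 (i, 1) * z.2 1 +
    ![0, 0, (minor z.1)⁻¹] i]

lemma minor_pos {B : Fin 3 × Fin 2 → ℝ} (hB : ∀ e, |B e - idCols e| < 1 / 4) :
    1 / 2 < minor B := by
  have h1 := abs_lt.1 (hB (0, 0))
  have h2 := abs_lt.1 (hB (1, 1))
  have h3 := abs_lt.1 (hB (0, 1))
  have h4 := abs_lt.1 (hB (1, 0))
  simp [idCols, cols, entries] at h1 h2 h3 h4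
  unfold minor
  nlinarith

/-- Cramer's rule for the first two rows yields the unstable coordinate, and det g = 1 forces the
last entry of p to be the reciprocal of the minor. -/
lemma entries_eq_param {g : G} (hg : minor (cols (entries g)) ≠ 0) :
    entries g = param (cols (entries g), unst (entries g)) := by
  have hd : g.1.det = 1 := g.2
  rw [Matrix.det_fin_three] at hd
  have h0 : minor (cols (entries g)) = g.1 0 0 * g.1 1 1 - g.1 0 1 * g.1 1 0 := rfl
  funext i j
  simp only [param, unst]
  generalize minor (cols (entries g)) = δ at hg h0
  fin_cases j
  · rfl
  · rfl
  · fin_cases i <;> simp [cols, entries] <;> field_simp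
    · rw [h0]; ring
    · rw [h0]; ring
    · rw [h0]
      linear_combination hd

/-- The domain of the coordinates. -/
def coordBox : Set Coord := {z | ∀ e, |z.1 e - idCols e| < 1 / 4}

lemma convex_coordBox : Convex ℝ coordBox := by
  have : coordBox = ⋂ e, {z : Coord | z.1 e ∈ Metric.ball (idCols e) (1 / 4)} := by
    ext z
    simp [coordBox, Real.dist_eq]
  rw [this]
  refine convex_iInter fun e => ?_
  exact (convex_ball (idCols e) (1 / 4)).is_linear_preimage
    ⟨fun _ _ => rfl, fun _ _ => rfl⟩

lemma contDiffOn_param (g : G) : ContDiffOn ℝ 1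
    (fun z : Coord => fun i j => ∑ l, param z i l * g.1 l j) coordBox := by
  refine contDiffOn_pi.2 fun i => contDiffOn_pi.2 fun j => ContDiffOn.sum fun l _ => ?_
  refine ContDiffOn.mul ?_ contDiffOn_const
  have hm : ContDiff ℝ 1 fun z : Coord => minor z.1 := by unfold minor; fun_prop
  have hinv : ContDiffOn ℝ 1 (fun z : Coord => (minor z.1)⁻¹) coordBox :=
    hm.contDiffOn.inv fun z hz => by
      have := minor_pos hz
      linarith
  unfold param
  fin_cases l
  · simp; fun_prop
  · simp; fun_prop
  · fin_cases i
    · simp; fun_prop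
    · simp; fun_prop
    · simp
      exact ContDiffOn.add (by fun_prop) hinv

/-! ### The upper bound -/

lemma step_pow {k : ℕ} (n : ℕ) : step k ^ n = flow (n * Real.log k) := by
  induction n with
  | zero =>
    rw [pow_zero, Nat.cast_zero, zero_mul]
    have := flow_add 0 0
    rw [add_zero] at this
    exact (mul_eq_left.1 this.symm).symm
  | succ n ih =>
    rw [pow_succ, ih, step, ← flow_add]
    congr 1
    push_cast
    ring

lemma flow_conj_apply (t : ℝ) (p : G) (i j : Fin 3) :
    (flow t * p * flow (-t) : G).1 i j = (![Real.exp t, Real.exp t, Real.exp (-2 * t)] i *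
      ![Real.exp (-t), Real.exp (-t), Real.exp (-2 * -t)] j) * p.1 i j := by
  rw [Matrix.SpecialLinearGroup.coe_mul, Matrix.SpecialLinearGroup.coe_mul]
  change (Matrix.diagonal ![Real.exp t, Real.exp t, Real.exp (-2 * t)] * p.1 *
    Matrix.diagonal ![Real.exp (-t), Real.exp (-t), Real.exp (-2 * -t)]) i j = _
  rw [Matrix.mul_diagonal, Matrix.diagonal_mul]
  ring

/-- Conjugation scales each entry by a ratio of eigenvalues of the flow. Only the entries (0,2) and
(1,2) would grow, and they vanish. -/
lemma absSum_flow_conj_le {t : ℝ} (ht : 0 ≤ t) {p : G} (h0 : p.1 0 2 = 0) (h1 : p.1 1 2 = 0) :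
    absSum (flow t * p * flow (-t) : G).1 ≤ absSum p.1 := by
  refine Finset.sum_le_sum fun i _ => Finset.sum_le_sum fun j _ => ?_
  rw [flow_conj_apply, abs_mul]
  have hz : ∀ c x : ℝ, |c| ≤ 1 ∨ x = 0 → |c| * |x| ≤ |x| := by
    rintro c x (h | h)
    · exact mul_le_of_le_one_left (abs_nonneg _) h
    · rw [h]; simp
  refine hz _ _ ?_
  have e1 : Real.exp t * Real.exp (-t) = 1 := by rw [← Real.exp_add]; simp
  have e2 : Real.exp (-2 * t) * Real.exp (-2 * -t) = 1 := by
    rw [← Real.exp_add]; ring_nf; simp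
  have e3 : |Real.exp (-2 * t) * Real.exp (-t)| ≤ 1 := by
    rw [abs_of_pos (by positivity), ← Real.exp_add]
    exact Real.exp_le_one_iff.2 (by linarith)
  fin_cases i <;> fin_cases j
  all_goals first
    | (left; change |Real.exp t * Real.exp (-t)| ≤ 1; rw [e1, abs_one])
    | (left; exact e3)
    | (left; change |Real.exp (-2 * t) * Real.exp (-2 * -t)| ≤ 1; rw [e2, abs_one])
    | (right; exact h0)
    | (right; exact h1)

lemma absSum_transpose (A : Matrix (Fin 3) (Fin 3) ℝ) : absSum A.transpose = absSum A :=
  Finset.sum_comm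

/-- The inverse of p has the same vanishing entries, so the conjugates of p and of p⁻¹ stay bounded
and p alters the height by a bounded factor at all positive times. -/
lemma height_conj_le {A C t : ℝ} (hA : 0 ≤ A) (hC : 1 ≤ C) (ht : 0 ≤ t) {p : G}
    (h0 : p.1 0 2 = 0) (h1 : p.1 1 2 = 0) (h2 : absSum p.1 ≤ C) (h3 : absSum (p⁻¹ : G).1 ≤ C)
    (g : G) : height A (flow t * (p * g)) ≤ C ^ 2 * height A (flow t * g) := by
  have e : flow t * (p * g) = (flow t * p * flow (-t)) * (flow t * g) := by
    rw [flow_neg]; group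
  have hi : (flow t * p * flow (-t))⁻¹ = flow t * p⁻¹ * flow (-t) := by
    rw [flow_neg]; group
  have hinv : (p⁻¹ : G).1 0 2 = 0 ∧ (p⁻¹ : G).1 1 2 = 0 := by
    rw [Matrix.SpecialLinearGroup.coe_inv, Matrix.adjugate_fin_three]
    simp [h0, h1]
  rw [e]
  refine height_mul_le hA hC ?_ ?_ _
  · rw [hi]
    exact (absSum_flow_conj_le ht hinv.1 hinv.2).trans h3
  · have : ((dual (flow t * p * flow (-t)))⁻¹ : G).1 = (flow t * p * flow (-t) : G).1.transpose := by
      rw [dual_inv, dual, inv_inv]; rfl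
    rw [this, absSum_transpose]
    exact (absSum_flow_conj_le ht h0 h1).trans h2

/-- The elements of `G` whose trajectories stay high. -/
def highLift (k : ℕ) (A M : ℝ) : Set G := {g | ∀ l : ℕ, M ≤ height A (step k ^ l * g)}

lemma continuous_unip : Continuous unip := by
  refine Continuous.subtype_mk (continuous_matrix fun i j => ?_) _
  fin_cases i <;> fin_cases j <;> simp <;> fun_prop

/-- Near g₁ write g = p · `unip x` · g₀. Replacing g by `unip x` · g₀ costs at most 16 = 4² in the
height, after which x lies in every `highSet`. The coordinates (columns, x) depend on g through a C¹
parametrisation, which does not raise the dimension. -/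
lemma dimH_highLift_le {k : ℕ} (hk : 2 ≤ k) {A M : ℝ} (hA : 0 ≤ A) (hM : 1 ≤ M)
    (hcon : ∀ g : G, M ≤ height A g →
      ∑ j ∈ gridIdx k, height A (zoom k j * g) ≤ growth k * height A g) (d : NNReal)
    (hd : ((k : ℝ) ^ 3) ^ 6 * growth k ≤ ((k : ℝ) ^ 3) ^ (d : ℝ)) :
    dimH (entries '' highLift k A (16 * (25 * M))) ≤ d := by
  refine dimH_le_of_nhds _ _ _ fun g₁ => ?_
  -- The base point is shifted so that g₁ sits at the centre of the unit square, and nearby points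
  -- have x in its interior.
  set c : Fin 2 → ℝ := fun _ => 1 / 2 with hc
  set g₀ : G := unip (-c) * g₁ with hg₀
  set x : G → Fin 2 → ℝ := fun g => unst (entries (g * g₀⁻¹)) with hx
  set p : G → G := fun g => g * g₀⁻¹ * unip (-x g) with hp
  have h1 : g₁ * g₀⁻¹ = unip c := by rw [hg₀, mul_inv_rev, mul_inv_cancel_left, unip_inv, neg_neg]
  have hmin : minor (cols (entries (unip c))) = 1 := by
    simp [minor, cols, entries, unip]
  have hx1 : x g₁ = c := by
    simp only [hx, h1]
    simp only [unst, hmin]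
    funext i
    fin_cases i <;> simp [entries, unip]
  have hp1 : p g₁ = 1 := by
    simp only [hp, hx1, h1]
    rw [← unip_inv, mul_inv_cancel]
  have hent : Continuous fun g : G => entries (g * g₀⁻¹) :=
    isInducing_entries.continuous.comp (continuous_mul_const _)
  have hent' : ∀ i j, Continuous fun g : G => entries (g * g₀⁻¹) i j := fun i j =>
    (continuous_apply_apply i j).comp hent
  have hmc : Continuous fun g : G => minor (cols (entries (g * g₀⁻¹))) := by
    unfold minor cols
    exact ((hent' _ _).mul (hent' _ _)).sub ((hent' _ _).mul (hent' _ _))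
  have hm1 : minor (cols (entries (g₁ * g₀⁻¹))) ≠ 0 := by rw [h1, hmin]; exact one_ne_zero
  have hxc : ContinuousAt x g₁ := by
    refine continuousAt_pi.2 fun i => ?_
    simp only [hx, unst]
    fin_cases i
    · exact (((hent' _ _).mul (hent' _ _)).sub ((hent' _ _).mul (hent' _ _))).continuousAt.div
        hmc.continuousAt hm1
    · exact (((hent' _ _).mul (hent' _ _)).sub ((hent' _ _).mul (hent' _ _))).continuousAt.div
        hmc.continuousAt hm1
  have hpc : ContinuousAt p g₁ :=
    (continuous_mul_const _).continuousAt.mul (continuous_unip.continuousAt.comp hxc.neg)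
  have hsc : Continuous fun g : G => absSum g.1 := continuous_absSum.comp continuous_subtype_val
  have h31 : absSum (1 : G).1 < 4 := by
    rw [show (1 : G).1 = 1 from rfl, absSum_one]; norm_num
  -- At g₁ the factor p is 1, and `absSum 1 = 3 < 4`; hence the bound 4 on a neighbourhood.
  set U : Set G := {g | (∀ i, x g i ∈ Set.Ioo (0 : ℝ) 1) ∧
    (∀ e, cols (entries (g * g₀⁻¹)) e ∈ Metric.ball (idCols e) (1 / 4)) ∧
    absSum (p g).1 < 4 ∧ absSum ((p g)⁻¹ : G).1 < 4} with hU
  have hUn : U ∈ 𝓝 g₁ := by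
    refine Filter.eventually_and.2 ⟨Filter.eventually_all.2 fun i => ?_,
      Filter.eventually_and.2 ⟨Filter.eventually_all.2 fun e => ?_,
        Filter.eventually_and.2 ⟨?_, ?_⟩⟩⟩
    · refine (continuousAt_pi.1 hxc i).eventually_mem (Ioo_mem_nhds ?_ ?_) <;> rw [hx1] <;>
        norm_num [hc]
    · have : Continuous fun g : G => cols (entries (g * g₀⁻¹)) e := hent' _ _
      refine this.continuousAt.eventually_mem (Metric.isOpen_ball.mem_nhds ?_)
      rw [h1]
      have : cols (entries (unip c)) e = idCols e := by
        obtain ⟨i, j⟩ := e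
        fin_cases i <;> fin_cases j <;> simp [cols, idCols, entries, unip]
      rw [this]
      exact Metric.mem_ball_self (by norm_num)
    · refine (hsc.continuousAt.comp hpc).eventually_mem (Iio_mem_nhds ?_)
      change absSum (p g₁).1 < 4
      rw [hp1]
      exact h31
    · refine (hsc.continuousAt.comp hpc.inv).eventually_mem (Iio_mem_nhds ?_)
      change absSum ((p g₁)⁻¹ : G).1 < 4
      rw [hp1, inv_one]
      exact h31
  refine ⟨U, hUn, ?_⟩
  set E := {z : Coord | (∀ e, idCols e - 1 ≤ z.1 e ∧ z.1 e < idCols e + 1) ∧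
      ∀ n, z.2 ∈ highSet k A (25 * M) n g₀} with hE
  have hsub : entries '' (highLift k A (16 * (25 * M)) ∩ U) ⊆
      (fun z : Coord => fun i j => ∑ l, param z i l * g₀.1 l j) '' (E ∩ coordBox) := by
    rintro _ ⟨g, ⟨hg, hgU⟩, rfl⟩
    have hbox : ∀ e, |cols (entries (g * g₀⁻¹)) e - idCols e| < 1 / 4 := fun e => by
      have := hgU.2.1 e
      rwa [Metric.mem_ball, Real.dist_eq] at this
    have hm0 : minor (cols (entries (g * g₀⁻¹))) ≠ 0 := by
      have := minor_pos hbox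
      linarith
    have hpar := entries_eq_param hm0
    refine ⟨(cols (entries (g * g₀⁻¹)), x g), ⟨⟨fun e => ?_, fun n => ⟨fun i => ?_, fun l _ => ?_⟩⟩,
      hbox⟩, ?_⟩
    · have := abs_lt.1 (hbox e)
      constructor <;> simp only <;> linarith
    · exact ⟨(hgU.1 i).1.le, (hgU.1 i).2⟩
    · have h2 := hg l
      have hg' : g = p g * (unip (x g) * g₀) := by
        simp only [hp]
        rw [← unip_inv]
        group
      have hentry : ∀ i : Fin 3, (p g).1 i 2 = (g * g₀⁻¹ : G).1 i 2
          - (g * g₀⁻¹ : G).1 i 0 * x g 0 - (g * g₀⁻¹ : G).1 i 1 * x g 1 := fun i => by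
        simp only [hp]
        rw [Matrix.SpecialLinearGroup.coe_mul, Matrix.mul_apply, Fin.sum_univ_three]
        simp [unip]
        ring
      have hpar' : ∀ i : Fin 3, (g * g₀⁻¹ : G).1 i 2 = (g * g₀⁻¹ : G).1 i 0 * x g 0
          + (g * g₀⁻¹ : G).1 i 1 * x g 1 +
          ![0, 0, (minor (cols (entries (g * g₀⁻¹))))⁻¹] i := fun i => congrFun (congrFun hpar i) 2
      have hp0 : (p g).1 0 2 = 0 := by
        rw [hentry, hpar']; simp
      have hp1 : (p g).1 1 2 = 0 := by
        rw [hentry, hpar']; simp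
      have h3 := height_conj_le (t := l * Real.log k) hA (C := 4) (by norm_num)
        (mul_nonneg (Nat.cast_nonneg _) (Real.log_natCast_nonneg _)) hp0 hp1
        hgU.2.2.1.le hgU.2.2.2.le (unip (x g) * g₀)
      rw [← hg', ← step_pow] at h3
      linarith
    · funext i j
      simp only
      rw [show x g = unst (entries (g * g₀⁻¹)) from rfl, ← hpar]
      have : g = g * g₀⁻¹ * g₀ := by group
      conv_rhs => rw [this]
      change _ = (g * g₀⁻¹ * g₀ : G).1 i j
      rw [Matrix.SpecialLinearGroup.coe_mul _ g₀, Matrix.mul_apply]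
      rfl
  refine (dimH_mono hsub).trans (((contDiffOn_param g₀).dimH_image_le convex_coordBox
    Set.inter_subset_right).trans ((dimH_mono Set.inter_subset_left).trans ?_))
  exact dimH_box_highSet_le hk hA hM hcon g₀ idCols d hd

lemma dimH_left_mul_le (c : G) (S : Set G) :
    dimH (entries '' {g | c * g ∈ S}) ≤ dimH (entries '' S) := by
  set L : (Fin 3 → Fin 3 → ℝ) → Fin 3 → Fin 3 → ℝ := fun e i j => ∑ l, (c⁻¹ : G).1 i l * e l j
  have hL : ContDiff ℝ 1 L := by
    refine contDiff_pi.2 fun i => contDiff_pi.2 fun j => ContDiff.sum fun l _ => ?_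
    fun_prop
  refine (dimH_mono ?_).trans
    (hL.contDiffOn.dimH_image_le (s := Set.univ) convex_univ (Set.subset_univ (entries '' S)))
  rintro _ ⟨g, hg, rfl⟩
  refine ⟨_, ⟨c * g, hg, rfl⟩, ?_⟩
  funext i j
  have : g = c⁻¹ * (c * g) := by group
  conv_rhs => rw [this]
  change _ = (c⁻¹ * (c * g) : G).1 i j
  rw [Matrix.SpecialLinearGroup.coe_mul c⁻¹, Matrix.mul_apply]
  rfl

/-- Source of 22/3: with K = k³ one has K⁶ k⁴ = k²² = K^(22/3). The constants and the squared
logarithm are absorbed by K^δ = k^(3δ). -/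
lemma exists_growth_le {δ : ℝ} (hδ : 0 < δ) : ∃ k : ℕ, 2 ≤ k ∧
    ((k : ℝ) ^ 3) ^ 6 * growth k ≤ ((k : ℝ) ^ 3) ^ (22 / 3 + δ) := by
  obtain ⟨k, hk, hk2⟩ := (((tendsto_rpow_atTop hδ).comp tendsto_natCast_atTop_atTop).eventually_ge_atTop
    (50 * (1 + 3 / δ) ^ 2) |>.and (Filter.eventually_ge_atTop 2)).exists
  have hk1 : (1 : ℝ) ≤ k := by exact_mod_cast (by omega : 1 ≤ k)
  have hk0 : (0 : ℝ) < k := by linarith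
  refine ⟨k, hk2, ?_⟩
  have h1 : 1 + Real.log ((k ^ 3 : ℕ) : ℝ) ≤ (1 + 3 / δ) * (k : ℝ) ^ δ := by
    push_cast
    rw [Real.log_pow]
    have h2 := Real.log_le_rpow_div hk0.le hδ
    have h3 := Real.one_le_rpow hk1 hδ.le
    push_cast
    calc _ ≤ (k : ℝ) ^ δ + 3 * ((k : ℝ) ^ δ / δ) := by linarith
      _ = _ := by ring
  have h0 : 0 ≤ 1 + Real.log ((k ^ 3 : ℕ) : ℝ) := zero_le_one.trans (one_le_one_add_log k)
  have h4 := pow_le_pow_left₀ h0 h1 2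
  have h5 : ((k : ℝ) ^ 3) ^ (22 / 3 + δ) = (k : ℝ) ^ 22 * ((k : ℝ) ^ δ * ((k : ℝ) ^ δ) ^ 2) := by
    rw [← Real.rpow_natCast (k : ℝ) 3, ← Real.rpow_mul hk0.le,
      show ((3 : ℕ) : ℝ) * (22 / 3 + δ) = (22 : ℕ) + (δ + (δ + δ)) by push_cast; ring,
      Real.rpow_add hk0, Real.rpow_add hk0, Real.rpow_add hk0, Real.rpow_natCast]
    ring
  have hr : 0 < (k : ℝ) ^ δ := Real.rpow_pos_of_pos hk0 _
  have hk' : 50 * (1 + 3 / δ) ^ 2 ≤ (k : ℝ) ^ δ := hk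
  rw [h5, growth]
  calc _ = (k : ℝ) ^ 22 * (50 * (1 + Real.log ((k ^ 3 : ℕ) : ℝ)) ^ 2) := by ring
    _ ≤ (k : ℝ) ^ 22 * (50 * ((1 + 3 / δ) * (k : ℝ) ^ δ) ^ 2) := by gcongr
    _ = (k : ℝ) ^ 22 * ((50 * (1 + 3 / δ) ^ 2) * ((k : ℝ) ^ δ) ^ 2) := by ring
    _ ≤ _ := by gcongr

/-- Small systole means large height, so every divergent trajectory is above the threshold from some
discrete time on; `Dlift` lies in countably many translates of `highLift`. -/
theorem dimH_Dlift_le : dimH (entries '' Dlift) ≤ 22 / 3 := by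
  have key : ∀ δ : NNReal, 0 < δ → dimH (entries '' Dlift) ≤ ((22 / 3 + δ : NNReal) : ENNReal) := by
    intro δ hδ
    obtain ⟨k, hk2, hd⟩ := exists_growth_le (δ := δ) (by exact_mod_cast hδ)
    obtain ⟨A, hA, M, hM, hcon⟩ := exists_contraction (k := k) (by omega)
    have hW := dimH_highLift_le hk2 hA hM hcon (22 / 3 + δ) (by push_cast; exact hd)
    set M' := 16 * (25 * M) with hM'
    have hM'0 : 0 < M' := by positivity
    have hsub : entries '' Dlift ⊆ ⋃ n : ℕ, entries '' {g | step k ^ n * g ∈ highLift k A M'} := by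
      rintro _ ⟨g, hg, rfl⟩
      obtain ⟨T, hT⟩ := hg (√M')⁻¹ (by positivity)
      have hlog : 0 < Real.log k := Real.log_pos (by exact_mod_cast (by omega : 1 < k))
      obtain ⟨n, hn⟩ := exists_nat_gt (T / Real.log k)
      refine Set.mem_iUnion.2 ⟨n, g, fun l => ?_, rfl⟩
      rw [← mul_assoc, ← pow_add, step_pow]
      have hlt : T < ((l + n : ℕ) : ℝ) * Real.log k := by
        rw [div_lt_iff₀ hlog] at hn
        have : (n : ℝ) * Real.log k ≤ ((l + n : ℕ) : ℝ) * Real.log k := by gcongr; omega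
        linarith
      have h1 := hT _ hlt
      set g' := flow (((l + n : ℕ) : ℝ) * Real.log k) * g
      have h2 := systole_pos g'
      have h3 := systole_pos (dual g')
      have h4 : M' ≤ (systole g' ^ 2)⁻¹ := by
        rw [le_inv_comm₀ hM'0 (by positivity)]
        calc systole g' ^ 2 ≤ (√M')⁻¹ ^ 2 := pow_le_pow_left₀ h2.le h1.le 2
          _ = M'⁻¹ := by rw [inv_pow, Real.sq_sqrt hM'0.le]
      have h5 : 0 ≤ A * (systole (dual g'))⁻¹ := by positivity
      unfold height
      linarith
    refine (dimH_mono hsub).trans ?_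
    rw [dimH_iUnion]
    exact iSup_le fun n => (dimH_left_mul_le _ _).trans hW
  refine ENNReal.le_of_forall_pos_le_add fun δ hδ _ => ?_
  refine (key δ hδ).trans (le_of_eq ?_)
  rw [ENNReal.coe_add, ENNReal.coe_div (by norm_num)]
  norm_num

/-! ### Trees of points and the mass distribution principle -/

lemma exists_limit_of_halving {Y : Type*} [PseudoMetricSpace Y] [CompleteSpace Y] (u : ℕ → Y)
    (d : ℕ → ℝ) (h1 : ∀ n, dist (u (n + 1)) (u n) ≤ d n) (h2 : ∀ n, 2 * d (n + 1) ≤ d n) :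
    ∃ a, ∀ n, dist a (u n) ≤ 2 * d n := by
  have hd : ∀ k n, d (k + n) ≤ d k / 2 ^ n := by
    intro k n
    induction n with
    | zero => simp
    | succ n ih =>
      have h3 := h2 (k + n)
      have : d k / 2 ^ (n + 1) = d k / 2 ^ n / 2 := by rw [pow_succ]; field_simp
      rw [this, ← add_assoc]
      linarith
  have hb : ∀ k n, dist (u (k + n)) (u (k + (n + 1))) ≤ (2 * d k) / 2 / 2 ^ n := fun k n => by
    rw [dist_comm, mul_div_cancel_left₀ _ two_ne_zero]
    exact (h1 (k + n)).trans (hd k n)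
  obtain ⟨a, ha⟩ := cauchySeq_tendsto_of_complete
    (cauchySeq_of_le_geometric_two (fun n => hb 0 n))
  simp only [zero_add] at ha
  refine ⟨a, fun k => ?_⟩
  have ha' : Filter.Tendsto (fun n => u (k + n)) Filter.atTop (𝓝 a) := by
    simpa [add_comm] using (Filter.tendsto_add_atTop_iff_nat k).2 ha
  have := dist_le_of_le_geometric_two_of_tendsto₀ (fun n => hb k n) ha'
  rwa [add_zero, dist_comm] at this

/-- The number of nodes at level `k` of a tree whose nodes at level `i` have `M i` children. -/
def levelCard (M : ℕ → ℕ) (k : ℕ) : ℕ := ∏ i ∈ Finset.range k, M i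

/-- The node at level `k` above the point `y` of the unit interval. -/
noncomputable def nodeAt (M : ℕ → ℕ) (k : ℕ) (y : ℝ) : ℕ := ⌊(levelCard M k : ℝ) * y⌋₊

lemma nodeAt_succ_div {M : ℕ → ℕ} (hM : ∀ k, 0 < M k) (k : ℕ) (y : ℝ) :
    nodeAt M (k + 1) y / M k = nodeAt M k y := by
  have h0 : (M k : ℝ) ≠ 0 := by exact_mod_cast (hM k).ne'
  rw [nodeAt, nodeAt, ← Nat.floor_div_natCast]
  congr 1
  rw [levelCard, Finset.prod_range_succ]
  push_cast [levelCard]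
  field_simp

/-- A tree of points in a metric space, with `M k` children for every node at level `k`. -/
structure PointTree {Y : Type*} [PseudoMetricSpace Y] (M : ℕ → ℕ) (z : ℕ → ℕ → Y)
    (δ : ℕ → ℕ → ℝ) (σ : ℕ → ℝ) : Prop where
  pos : ∀ k, 0 < M k
  dist_parent : ∀ k n, dist (z (k + 1) n) (z k (n / M k)) ≤ δ k (n / M k)
  halving : ∀ k n, 2 * δ (k + 1) n ≤ δ k (n / M k)
  separated : ∀ k n n', n / M k = n' / M k → n ≠ n' →
    σ k + 2 * δ (k + 1) n + 2 * δ (k + 1) n' ≤ dist (z (k + 1) n) (z (k + 1) n')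
  antitone : Antitone σ

lemma PointTree.exists_limit {Y : Type*} [PseudoMetricSpace Y] [CompleteSpace Y] {M : ℕ → ℕ}
    {z : ℕ → ℕ → Y} {δ : ℕ → ℕ → ℝ} {σ : ℕ → ℝ} (h : PointTree M z δ σ) (y : ℝ) :
    ∃ a, ∀ k, dist a (z k (nodeAt M k y)) ≤ 2 * δ k (nodeAt M k y) := by
  refine exists_limit_of_halving (fun k => z k (nodeAt M k y)) (fun k => δ k (nodeAt M k y))
    (fun k => ?_) (fun k => ?_)
  · have := h.dist_parent k (nodeAt M (k + 1) y)
    rwa [nodeAt_succ_div h.pos] at this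
  · have := h.halving k (nodeAt M (k + 1) y)
    rwa [nodeAt_succ_div h.pos] at this

/-- A limit strays at most 2δ from its node, and separation leaves room for this on both sides, so
limits below distinct siblings are at least σ apart. Descending from the common root, close limits
must follow the same nodes. -/
lemma PointTree.nodeAt_eq {Y : Type*} [PseudoMetricSpace Y] {M : ℕ → ℕ}
    {z : ℕ → ℕ → Y} {δ : ℕ → ℕ → ℝ} {σ : ℕ → ℝ} (h : PointTree M z δ σ) {y y' : ℝ}
    (hy : y ∈ Set.Ico (0 : ℝ) 1) (hy' : y' ∈ Set.Ico (0 : ℝ) 1) {a a' : Y}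
    (ha : ∀ k, dist a (z k (nodeAt M k y)) ≤ 2 * δ k (nodeAt M k y))
    (ha' : ∀ k, dist a' (z k (nodeAt M k y')) ≤ 2 * δ k (nodeAt M k y'))
    (k : ℕ) (hlt : dist a a' < σ k) : nodeAt M (k + 1) y = nodeAt M (k + 1) y' := by
  have step : ∀ k, nodeAt M k y = nodeAt M k y' → dist a a' < σ k →
      nodeAt M (k + 1) y = nodeAt M (k + 1) y' := by
    intro k he hlt
    by_contra hne
    have h1 := h.separated k _ _
      (by rw [nodeAt_succ_div h.pos, nodeAt_succ_div h.pos, he]) hne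
    have h2 := dist_triangle4 (z (k + 1) (nodeAt M (k + 1) y)) a a'
      (z (k + 1) (nodeAt M (k + 1) y'))
    rw [dist_comm _ a] at h2
    have h3 := ha (k + 1)
    have h4 := ha' (k + 1)
    linarith
  induction k with
  | zero =>
    refine step 0 ?_ hlt
    rw [nodeAt, nodeAt, Nat.floor_eq_zero.2 (by simpa [levelCard] using hy.2),
      Nat.floor_eq_zero.2 (by simpa [levelCard] using hy'.2)]
  | succ k ih => exact step (k + 1) (ih (hlt.trans_le (h.antitone k.le_succ))) hlt

lemma abs_sub_le_of_nodeAt_eq {M : ℕ → ℕ} (hM : ∀ k, 0 < M k) {y y' : ℝ} (hy : 0 ≤ y)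
    (hy' : 0 ≤ y') {k : ℕ} (h : nodeAt M k y = nodeAt M k y') :
    |y - y'| ≤ (levelCard M k : ℝ)⁻¹ := by
  have hP : (0 : ℝ) < levelCard M k := by
    exact_mod_cast Finset.prod_pos fun i _ => hM i
  have h1 := Nat.floor_le (mul_nonneg hP.le hy)
  have h2 := Nat.lt_floor_add_one ((levelCard M k : ℝ) * y)
  have h3 := Nat.floor_le (mul_nonneg hP.le hy')
  have h4 := Nat.lt_floor_add_one ((levelCard M k : ℝ) * y')
  rw [show ⌊(levelCard M k : ℝ) * y⌋₊ = ⌊(levelCard M k : ℝ) * y'⌋₊ from h] at h1 h2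
  have h5 : |(levelCard M k : ℝ) * (y - y')| ≤ 1 := by
    rw [mul_sub]
    exact abs_le.2 ⟨by linarith, by linarith⟩
  rw [abs_mul, abs_of_pos hP] at h5
  rw [← one_div, le_div_iff₀ hP]
  linarith

open MeasureTheory in
/-- A lower bound for the dimension of the product of a box with the limit set of a tree. -/
theorem PointTree.le_dimH_prod {ι : Type*} [Fintype ι] [Nonempty ι] {Y : Type*}
    [MetricSpace Y] {M : ℕ → ℕ}
    {z : ℕ → ℕ → Y} {δ : ℕ → ℕ → ℝ} {σ : ℕ → ℝ} (h : PointTree M z δ σ) (f : ℝ → Y)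
    (hf : ∀ y k, dist (f y) (z k (nodeAt M k y)) ≤ 2 * δ k (nodeAt M k y))
    (hσ0 : ∀ k, 0 < σ k) (hσ : Filter.Tendsto σ Filter.atTop (𝓝 0)) (s : NNReal)
    (hs : ∀ᶠ k in Filter.atTop, 2 ^ (Fintype.card ι + 1) ≤ (levelCard M k : ℝ) * σ k ^ (s : ℝ))
    (U : Set (ι → ℝ)) (hU : MeasurableSet U) (hU0 : volume U ≠ 0) :
    ((Fintype.card ι + s : NNReal) : ENNReal) ≤ dimH (U ×ˢ (f '' Set.Ico (0 : ℝ) 1)) := by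
  borelize ((ι → ℝ) × Y)
  set V : Set ((ι → ℝ) × ℝ) := U ×ˢ Set.Ico (0 : ℝ) 1 with hV
  have hVm : MeasurableSet V := hU.prod measurableSet_Ico
  -- The mass is Lebesgue measure transported by (b, y) ↦ (b, f y). An outer measure is used so that
  -- measurability of f is not needed.
  set μ : OuterMeasure ((ι → ℝ) × Y) :=
    OuterMeasure.map (fun p : (ι → ℝ) × ℝ => (p.1, f p.2)) (volume.restrict V).toOuterMeasure with hμ
  have hμa : ∀ A, μ A = volume ((fun p : (ι → ℝ) × ℝ => (p.1, f p.2)) ⁻¹' A ∩ V) := fun A => by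
    rw [hμ, OuterMeasure.map_apply, Measure.coe_toOuterMeasure, Measure.restrict_apply' hVm]
  set d : NNReal := Fintype.card ι + s with hd
  obtain ⟨k₀, hk₀⟩ := Filter.eventually_atTop.1 hs
  have hle : μ ≤ OuterMeasure.mkMetric (fun r => r ^ (d : ℝ)) := by
    refine OuterMeasure.le_mkMetric _ μ (ENNReal.ofReal (σ k₀ / 2))
      (by simpa using half_pos (hσ0 k₀)) fun A hA => ?_
    rw [hμa]
    rcases Set.eq_empty_or_nonempty
      ((fun p : (ι → ℝ) × ℝ => (p.1, f p.2)) ⁻¹' A ∩ V) with he | ⟨⟨b, y⟩, hbA, hbV⟩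
    · rw [he, measure_empty]
      exact zero_le
    have htop : Metric.ediam A ≠ ⊤ := ne_top_of_le_ne_top ENNReal.ofReal_ne_top hA
    set r := (Metric.ediam A).toReal with hr
    have hr0 : 0 ≤ r := ENNReal.toReal_nonneg
    have hrA : Metric.ediam A = ENNReal.ofReal r := (ENNReal.ofReal_toReal htop).symm
    have hrk : r < σ k₀ := by
      have := ENNReal.toReal_le_of_le_ofReal (half_pos (hσ0 k₀)).le hA
      linarith [hσ0 k₀]
    have hdist : ∀ p ∈ (fun p : (ι → ℝ) × ℝ => (p.1, f p.2)) ⁻¹' A ∩ V,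
        dist p.1 b ≤ r ∧ dist (f p.2) (f y) ≤ r := fun p hp => by
      have h1 : edist (p.1, f p.2) (b, f y) ≤ Metric.ediam A :=
        Metric.edist_le_ediam_of_mem hp.1 hbA
      rw [hrA, edist_dist] at h1
      have h2 := (ENNReal.ofReal_le_ofReal_iff hr0).1 h1
      exact ⟨(le_max_left _ _).trans h2, (le_max_right _ _).trans h2⟩
    have hvol : ∀ k, r < σ k → volume ((fun p : (ι → ℝ) × ℝ => (p.1, f p.2)) ⁻¹' A ∩ V) ≤
        ENNReal.ofReal ((2 * r) ^ Fintype.card ι * (2 * (levelCard M (k + 1) : ℝ)⁻¹)) := by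
      intro k hk
      refine (measure_mono (t := Metric.closedBall b r ×ˢ
        Metric.closedBall y (levelCard M (k + 1) : ℝ)⁻¹) fun p hp => ⟨(hdist p hp).1, ?_⟩).trans ?_
      · rw [Metric.mem_closedBall, Real.dist_eq]
        exact abs_sub_le_of_nodeAt_eq h.pos hp.2.2.1 hbV.2.1
          (h.nodeAt_eq hp.2.2 hbV.2 (hf _) (hf _) k ((hdist p hp).2.trans_lt hk))
      · rw [Measure.volume_eq_prod, Measure.prod_prod, Real.volume_pi_closedBall _ hr0,
          Real.volume_closedBall, ← ENNReal.ofReal_mul (by positivity)]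
    rcases hr0.eq_or_lt with h0 | h0
    -- For diameter zero the box factor already has volume zero, as ι is nonempty.
    · refine (hvol k₀ hrk).trans ?_
      rw [← h0]
      rw [mul_zero, zero_pow Fintype.card_ne_zero, zero_mul, ENNReal.ofReal_zero]
      exact zero_le
    · have hex : ∃ k, σ (k₀ + k + 1) ≤ r := by
        have := (hσ.comp (Filter.tendsto_add_atTop_nat (k₀ + 1))).eventually_lt_const h0
        obtain ⟨k, hk⟩ := this.exists
        refine ⟨k, le_of_lt ?_⟩
        rw [show k₀ + k + 1 = k + (k₀ + 1) by ring]
        exact hk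
      classical
      -- Locate r between consecutive gaps. Being below the larger one confines y to a common node
      -- at the next level; being above the smaller one turns that node's mass into a power of r.
      obtain ⟨k, hk1, hk2⟩ : ∃ k, σ (k₀ + k + 1) ≤ r ∧ r < σ (k₀ + k) := by
        refine ⟨Nat.find hex, Nat.find_spec hex, ?_⟩
        rcases Nat.eq_zero_or_pos (Nat.find hex) with hz | hp
        · rw [hz, add_zero]; exact hrk
        · have := Nat.find_min hex (Nat.sub_lt hp one_pos)
          rw [show k₀ + (Nat.find hex - 1) + 1 = k₀ + Nat.find hex by omega] at this
          exact not_le.1 this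
      refine (hvol _ hk2).trans ?_
      rw [hrA, ENNReal.ofReal_rpow_of_pos h0]
      refine ENNReal.ofReal_le_ofReal ?_
      have h1 := hk₀ (k₀ + k + 1) (by omega)
      have hP : (0 : ℝ) < levelCard M (k₀ + k + 1) := by
        exact_mod_cast Finset.prod_pos fun i _ => h.pos i
      have h2 : σ (k₀ + k + 1) ^ (s : ℝ) ≤ r ^ (s : ℝ) :=
        Real.rpow_le_rpow (hσ0 _).le hk1 s.2
      have h3 : 2 ^ (Fintype.card ι + 1) * (levelCard M (k₀ + k + 1) : ℝ)⁻¹ ≤ r ^ (s : ℝ) := by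
        rw [← div_eq_mul_inv, div_le_iff₀ hP]
        nlinarith
      have h4 : r ^ (d : ℝ) = r ^ Fintype.card ι * r ^ (s : ℝ) := by
        rw [hd]
        push_cast
        rw [Real.rpow_add h0, Real.rpow_natCast]
      rw [h4]
      calc _ = r ^ Fintype.card ι *
            (2 ^ (Fintype.card ι + 1) * (levelCard M (k₀ + k + 1) : ℝ)⁻¹) := by
            rw [mul_pow, pow_succ]; ring
        _ ≤ _ := by gcongr
  refine le_dimH_of_hausdorffMeasure_ne_zero (d := d) fun h0 => ?_
  have h1 : μ (U ×ˢ (f '' Set.Ico (0 : ℝ) 1)) ≤ 0 := by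
    refine (hle _).trans (le_of_eq ?_)
    rw [← Measure.mkMetric_toOuterMeasure]
    exact h0
  have h2 : μ (U ×ˢ (f '' Set.Ico (0 : ℝ) 1)) = volume V := by
    rw [hμa, Set.inter_eq_right.2]
    rintro ⟨b, y⟩ ⟨hb, hy⟩
    exact ⟨hb, y, hy, rfl⟩
  rw [h2, hV, Measure.volume_eq_prod, Measure.prod_prod] at h1
  simp [hU0] at h1

/-! ### Coprime pairs and plane lattices -/

/-- Telescoping: 1/(n+1)² ≤ 1/n − 1/(n+1), starting from 1/4 = 3/4 − 1/2. -/
lemma sum_inv_sq_le (n : ℕ) : ∑ d ∈ Finset.Icc 2 n, ((d : ℝ) ^ 2)⁻¹ ≤ 3 / 4 := by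
  rcases Nat.lt_or_ge n 2 with hn | hn
  · rw [Finset.Icc_eq_empty (by omega)]
    norm_num
  have key : ∀ n : ℕ, 2 ≤ n → ∑ d ∈ Finset.Icc 2 n, ((d : ℝ) ^ 2)⁻¹ ≤ 3 / 4 - (n : ℝ)⁻¹ := by
    intro n hn
    induction n, hn using Nat.le_induction with
    | base => norm_num
    | succ n hn ih =>
      rw [Finset.sum_Icc_succ_top (by omega)]
      have h0 : (0 : ℝ) < n := by exact_mod_cast (by omega : 0 < n)
      have : ((((n + 1 : ℕ) : ℝ)) ^ 2)⁻¹ ≤ (n : ℝ)⁻¹ - (((n + 1 : ℕ) : ℝ))⁻¹ := by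
        push_cast
        rw [inv_sub_inv h0.ne' (by positivity), add_sub_cancel_left, inv_eq_one_div]
        exact div_le_div_of_nonneg_left zero_le_one (by positivity) (by nlinarith)
      linarith
  have h0 : 0 ≤ (n : ℝ)⁻¹ := by positivity
  linarith [key n hn]

/-- The coprime pairs in a box, away from one of its sides. -/
def coprimePairs (A B : ℕ) : Finset (ℕ × ℕ) :=
  (Finset.Ioc 0 A ×ˢ Finset.Ioc 0 B).filter fun p => A < 8 * p.1 ∧ Nat.Coprime p.1 p.2

/-- A positive proportion of the pairs are coprime. -/
lemma le_card_coprimePairs (A B : ℕ) : A * B ≤ 8 * (coprimePairs A B).card := by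
  set R := Finset.Ioc 0 A ×ˢ Finset.Ioc 0 B
  set S₁ := Finset.Ioc 0 (A / 8) ×ˢ Finset.Ioc 0 B
  set S₂ := (Finset.Icc 2 A).biUnion fun d =>
    ((Finset.Ioc 0 A).filter (d ∣ ·)) ×ˢ ((Finset.Ioc 0 B).filter (d ∣ ·))
  -- A discarded pair has a ≤ A/8, a proportion of at most 1/8, or a common divisor d ≥ 2, a
  -- proportion of at most Σ d⁻² ≤ 3/4. At least 1/8 remains.
  have hcov : R ⊆ coprimePairs A B ∪ (S₁ ∪ S₂) := by
    rintro ⟨a, b⟩ hp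
    have hp' := Finset.mem_product.1 hp
    simp only [Finset.mem_Ioc] at hp'
    by_cases h8 : A < 8 * a
    · by_cases hc : Nat.Coprime a b
      · exact Finset.mem_union_left _ (Finset.mem_filter.2 ⟨hp, h8, hc⟩)
      · refine Finset.mem_union_right _ (Finset.mem_union_right _ (Finset.mem_biUnion.2
          ⟨Nat.gcd a b, ?_, ?_⟩))
        · have h1 : 0 < Nat.gcd a b := Nat.gcd_pos_of_pos_left _ hp'.1.1
          have h2 : Nat.gcd a b ≠ 1 := hc
          have h3 : Nat.gcd a b ≤ a := Nat.gcd_le_left _ hp'.1.1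
          exact Finset.mem_Icc.2 ⟨by omega, by omega⟩
        · simp only [Finset.mem_product, Finset.mem_filter, Finset.mem_Ioc]
          exact ⟨⟨hp'.1, Nat.gcd_dvd_left _ _⟩, hp'.2, Nat.gcd_dvd_right _ _⟩
    · refine Finset.mem_union_right _ (Finset.mem_union_left _ ?_)
      simp only [S₁, Finset.mem_product, Finset.mem_Ioc]
      exact ⟨⟨hp'.1.1, by omega⟩, hp'.2⟩
  have h1 : A * B ≤ (coprimePairs A B).card + (S₁.card + S₂.card) := by
    calc A * B = R.card := by simp [R]
      _ ≤ _ := (Finset.card_le_card hcov).trans ((Finset.card_union_le _ _).trans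
        (Nat.add_le_add_left (Finset.card_union_le _ _) _))
  have h2 : (S₁.card : ℝ) ≤ A * B / 8 := by
    have : S₁.card = A / 8 * B := by simp [S₁]
    rw [this]
    push_cast
    have : ((A / 8 : ℕ) : ℝ) ≤ A / 8 := by
      simpa using (Nat.cast_div_le : ((A / 8 : ℕ) : ℝ) ≤ (A : ℝ) / (8 : ℕ))
    have hB : (0 : ℝ) ≤ B := Nat.cast_nonneg _
    nlinarith
  have h3 : (S₂.card : ℝ) ≤ A * B * (3 / 4) := by
    calc (S₂.card : ℝ) ≤ ∑ d ∈ Finset.Icc 2 A, ((A / d * (B / d) : ℕ) : ℝ) := by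
          rw [← Nat.cast_sum, Nat.cast_le]
          refine Finset.card_biUnion_le.trans (Finset.sum_le_sum fun d _ => ?_)
          rw [Finset.card_product, Nat.Ioc_filter_dvd_card_eq_div, Nat.Ioc_filter_dvd_card_eq_div]
      _ ≤ ∑ d ∈ Finset.Icc 2 A, (A * B : ℝ) * ((d : ℝ) ^ 2)⁻¹ := by
          refine Finset.sum_le_sum fun d _ => ?_
          push_cast
          calc ((A / d : ℕ) : ℝ) * ((B / d : ℕ) : ℝ) ≤ (A / d : ℝ) * (B / d : ℝ) :=
                mul_le_mul Nat.cast_div_le Nat.cast_div_le (Nat.cast_nonneg _) (by positivity)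
            _ = _ := by
              rw [div_mul_div_comm, ← sq, div_eq_mul_inv]
      _ ≤ _ := by
          rw [← Finset.mul_sum]
          exact mul_le_mul_of_nonneg_left (sum_inv_sq_le A) (by positivity)
  have h4 : ((A * B : ℕ) : ℝ) ≤ (coprimePairs A B).card + (S₁.card + S₂.card) := by
    exact_mod_cast h1
  push_cast at h4
  have h5 : ((A * B : ℕ) : ℝ) ≤ ((8 * (coprimePairs A B).card : ℕ) : ℝ) := by
    push_cast
    linarith
  exact_mod_cast h5

/-- The determinant of two plane vectors. -/
def cross₂ (s t : Fin 2 → ℝ) : ℝ := s 0 * t 1 - s 1 * t 0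

lemma abs_cross₂_le (s t : Fin 2 → ℝ) : |cross₂ s t| ≤ 2 * ‖s‖ * ‖t‖ := by
  have h : ∀ i j, |s i * t j| ≤ ‖s‖ * ‖t‖ := fun i j => by
    rw [abs_mul]
    exact mul_le_mul (norm_le_pi_norm s i) (norm_le_pi_norm t j) (abs_nonneg _) (norm_nonneg _)
  have := abs_sub (s 0 * t 1) (s 1 * t 0)
  unfold cross₂
  linarith [h 0 1, h 1 0]

/-- Reduction of a vector modulo another one. -/
lemma exists_norm_sub_zsmul_le {s : Fin 2 → ℝ} (hs : s ≠ 0) (t : Fin 2 → ℝ) :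
    ∃ n : ℤ, ‖t - (n : ℝ) • s‖ ≤ |cross₂ s t| / ‖s‖ + ‖s‖ / 2 := by
  have hs0 : 0 < ‖s‖ := norm_pos_iff.2 hs
  have key : ∀ i j : Fin 2, (∀ l, l = i ∨ l = j) → |s i| = ‖s‖ →
      |s i * t j - s j * t i| = |cross₂ s t| →
      ∃ n : ℤ, ‖t - (n : ℝ) • s‖ ≤ |cross₂ s t| / ‖s‖ + ‖s‖ / 2 := by
    intro i j hl hi hc
    have hi0 : s i ≠ 0 := abs_pos.1 (hi ▸ hs0)
    -- Rounding is done in the coordinate i where s attains its norm; the other coordinate is then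
    -- recovered from the determinant.
    refine ⟨round (t i / s i), ?_⟩
    have hr := abs_sub_round (t i / s i)
    set n : ℝ := (round (t i / s i) : ℝ)
    have h1 : |t i - n * s i| ≤ ‖s‖ / 2 := by
      have : t i - n * s i = (t i / s i - n) * s i := by field_simp
      rw [this, abs_mul, hi]
      nlinarith
    have h2 : |t j - n * s j| ≤ |cross₂ s t| / ‖s‖ + ‖s‖ / 2 := by
      have e : t j - n * s j = (s i * t j - s j * t i) / s i + s j / s i * (t i - n * s i) := by
        field_simp
        ring
      rw [e]
      refine (abs_add_le _ _).trans ?_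
      rw [abs_div, hc, hi, abs_mul, abs_div, hi]
      have h3 : |s j| / ‖s‖ ≤ 1 := (div_le_one hs0).2 (norm_le_pi_norm s j)
      have h4 : |s j| / ‖s‖ * |t i - n * s i| ≤ 1 * (‖s‖ / 2) :=
        mul_le_mul h3 h1 (abs_nonneg _) zero_le_one
      linarith
    have h0 : 0 ≤ |cross₂ s t| / ‖s‖ := by positivity
    refine (pi_norm_le_iff_of_nonneg (by positivity)).2 fun l => ?_
    rw [Real.norm_eq_abs]
    rcases hl l with rfl | rfl
    · exact h1.trans (by linarith)
    · exact h2
  obtain ⟨i, -, hi⟩ := Finset.exists_max_image Finset.univ (fun i => ‖s i‖) Finset.univ_nonempty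
  have hi' : |s i| = ‖s‖ := le_antisymm (norm_le_pi_norm s i)
    ((pi_norm_le_iff_of_nonneg (norm_nonneg _)).2 fun l => hi l (Finset.mem_univ l))
  fin_cases i
  · refine key 0 1 (fun l => by fin_cases l <;> simp) hi' rfl
  · refine key 1 0 (fun l => by fin_cases l <;> simp) hi' ?_
    rw [← abs_neg]
    congr 1
    unfold cross₂
    ring

/-- Sizes of the integer combinations of a short vector and a complementary one. -/
lemma combination_bounds {s t : Fin 2 → ℝ} {η Y : ℝ} (hη : 0 < η) (hη1 : η ≤ 1) (hs : ‖s‖ = η)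
    (hst : |cross₂ s t| = 1) (ht : ‖t‖ ≤ 1 / η + η / 2) (hY : 8 ≤ η * Y) {a b : ℕ}
    (hab : (a, b) ∈ coprimePairs ⌊η * Y / 4⌋₊ ⌊Y / (4 * η)⌋₊) :
    ‖(a : ℝ) • t + (b : ℝ) • s‖ ≤ Y ∧ Y / 128 ≤ ‖(a : ℝ) • t + (b : ℝ) • s‖ := by
  rw [coprimePairs, Finset.mem_filter, Finset.mem_product, Finset.mem_Ioc, Finset.mem_Ioc] at hab
  obtain ⟨⟨⟨ha0, ha1⟩, hb0, hb1⟩, ha8, -⟩ := hab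
  simp only at ha0 ha1 hb0 hb1 ha8
  have hY0 : 0 < Y := pos_of_mul_pos_right (by linarith) hη.le
  have ha : (a : ℝ) ≤ η * Y / 4 := (Nat.le_floor_iff (by positivity)).1 ha1
  have hb : (b : ℝ) ≤ Y / (4 * η) := (Nat.le_floor_iff (by positivity)).1 hb1
  constructor
  · refine (norm_add_le _ _).trans ?_
    rw [norm_smul, norm_smul, hs, Real.norm_natCast, Real.norm_natCast]
    have h1 : (a : ℝ) * ‖t‖ ≤ η * Y / 4 * (1 / η + η / 2) :=
      mul_le_mul ha ht (norm_nonneg _) (by positivity)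
    have h2 : η * Y / 4 * (1 / η + η / 2) = Y / 4 + η * η * Y / 8 := by field_simp; ring
    have h3 : (b : ℝ) * η ≤ Y / 4 := by
      calc (b : ℝ) * η ≤ Y / (4 * η) * η := mul_le_mul_of_nonneg_right hb hη.le
        _ = Y / 4 := by field_simp
    have h4 : η * η * Y ≤ 1 * Y := mul_le_mul_of_nonneg_right (by nlinarith) hY0.le
    linarith
  -- The determinant against s sees only a t, and a ≥ ηY/64 by the restriction A < 8a.
  · have h1 := abs_cross₂_le s ((a : ℝ) • t + (b : ℝ) • s)
    have h2 : cross₂ s ((a : ℝ) • t + (b : ℝ) • s) = a * cross₂ s t := by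
      simp only [cross₂, Pi.add_apply, Pi.smul_apply, smul_eq_mul]
      ring
    rw [h2, abs_mul, hst, hs, mul_one, Nat.abs_cast] at h1
    have h3 := Nat.lt_floor_add_one (η * Y / 4)
    have h4 : (⌊η * Y / 4⌋₊ : ℝ) ≤ 8 * a := by exact_mod_cast ha8.le
    have h5 : η * Y / 8 ≤ 8 * a := by linarith
    have h6 : η * (Y / 128) ≤ η * ‖(a : ℝ) • t + (b : ℝ) • s‖ := by linarith
    exact le_of_mul_le_mul_left h6 hη

/-- Both sides of the box are at least 2, so rounding down loses at most a factor 2 in each. The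
area is at least Y²/64, of which 1/8 is coprime. -/
lemma le_card_coprimePairs_floor {η Y : ℝ} (hη : 0 < η) (hη1 : η ≤ 1) (hY : 8 ≤ η * Y) :
    Y ^ 2 / 512 ≤ (coprimePairs ⌊η * Y / 4⌋₊ ⌊Y / (4 * η)⌋₊).card := by
  have hY0 : 0 < Y := pos_of_mul_pos_right (by linarith) hη.le
  have h1 := Nat.lt_floor_add_one (η * Y / 4)
  have h2 := Nat.lt_floor_add_one (Y / (4 * η))
  have h3 : 2 ≤ Y / (4 * η) := by
    rw [le_div_iff₀ (by positivity)]
    nlinarith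
  have h4 : η * Y / 8 ≤ (⌊η * Y / 4⌋₊ : ℝ) := by linarith
  have h5 : Y / (8 * η) ≤ (⌊Y / (4 * η)⌋₊ : ℝ) := by
    have : Y / (8 * η) = Y / (4 * η) / 2 := by field_simp; norm_num
    linarith
  have h6 : η * Y / 8 * (Y / (8 * η)) ≤ (⌊η * Y / 4⌋₊ : ℝ) * (⌊Y / (4 * η)⌋₊ : ℝ) :=
    mul_le_mul h4 h5 (by positivity) (Nat.cast_nonneg _)
  have h7 : η * Y / 8 * (Y / (8 * η)) = Y ^ 2 / 64 := by field_simp; norm_num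
  have h8 : ((⌊η * Y / 4⌋₊ * ⌊Y / (4 * η)⌋₊ : ℕ) : ℝ) ≤
      ((8 * (coprimePairs ⌊η * Y / 4⌋₊ ⌊Y / (4 * η)⌋₊).card : ℕ) : ℝ) :=
    Nat.cast_le.2 (le_card_coprimePairs _ _)
  push_cast at h8
  linarith

/-! ### Rational points, shadows and the children of a node -/

/-- The rational point of the plane represented by an integer vector. -/
noncomputable def ratPt (u : Fin 3 → ℤ) : Fin 2 → ℝ := ![u 0 / u 2, u 1 / u 2]

/-- The projection of `w` along `u` to the horizontal plane. -/
noncomputable def shadow (u w : Fin 3 → ℤ) : Fin 2 → ℝ :=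
  ![w 0 - w 2 * (u 0 / u 2), w 1 - w 2 * (u 1 / u 2)]

/-- The determinant of three integer vectors. -/
def det₃ (u v w : Fin 3 → ℤ) : ℤ :=
  u 0 * (v 1 * w 2 - v 2 * w 1) - u 1 * (v 0 * w 2 - v 2 * w 0) + u 2 * (v 0 * w 1 - v 1 * w 0)

/-- When u extends to a basis of ℤ³, the shadows along u form a plane lattice of covolume 1 / u 2;
scaled by √(u 2) it becomes unimodular. -/
lemma cross₂_shadow {u : Fin 3 → ℤ} (hu : 0 < u 2) (v w : Fin 3 → ℤ) :
    cross₂ (shadow u v) (shadow u w) = det₃ u v w / u 2 := by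
  have : (u 2 : ℝ) ≠ 0 := by exact_mod_cast hu.ne'
  simp only [cross₂, shadow, det₃, Matrix.cons_val_zero, Matrix.cons_val_one]
  push_cast
  field_simp
  ring

lemma shadow_combination {u : Fin 3 → ℤ} (hu : 0 < u 2) (v w : Fin 3 → ℤ) (a b c : ℤ) :
    shadow u (a • v + b • w + c • u) = (a : ℝ) • shadow u v + (b : ℝ) • shadow u w := by
  have : (u 2 : ℝ) ≠ 0 := by exact_mod_cast hu.ne'
  funext i
  fin_cases i <;> simp [shadow] <;> field_simp <;> ring

lemma ratPt_sub {u w : Fin 3 → ℤ} (hw : 0 < w 2) :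
    ratPt w - ratPt u = (w 2 : ℝ)⁻¹ • shadow u w := by
  have : (w 2 : ℝ) ≠ 0 := by exact_mod_cast hw.ne'
  funext i
  fin_cases i <;> simp [shadow, ratPt] <;> field_simp

lemma shadow_swap {u w : Fin 3 → ℤ} (hu : 0 < u 2) (hw : 0 < w 2) :
    shadow w u = (-((u 2 : ℝ) / w 2)) • shadow u w := by
  have : (w 2 : ℝ) ≠ 0 := by exact_mod_cast hw.ne'
  have : (u 2 : ℝ) ≠ 0 := by exact_mod_cast hu.ne'
  funext i
  fin_cases i <;> simp [shadow] <;> field_simp <;> ring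

/-- Pairs of integer vectors that can be completed to a basis and span a plane of small area. -/
structure IsNode (T : ℕ) (v u : Fin 3 → ℤ) : Prop where
  pos : 0 < u 2
  basis : ∃ e, det₃ u v e = 1
  lower : 1 / (40000 * (T : ℝ) ^ 2) ≤ ‖shadow u v‖ ^ 2 * u 2
  upper : ‖shadow u v‖ ^ 2 * u 2 ≤ 4 / (T : ℝ) ^ 2

lemma exists_enumeration {α : Type*} [Nonempty α] (S : Finset α) {n : ℕ} (hn : n ≤ S.card) :
    ∃ f : ℕ → α, (∀ i < n, f i ∈ S) ∧ ∀ i < n, ∀ j < n, f i = f j → i = j := by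
  classical
  set e := S.equivFin.symm
  refine ⟨fun i => if h : i < S.card then e ⟨i, h⟩ else Classical.arbitrary α, fun i hi => ?_,
    fun i hi j hj h => ?_⟩
  · simp only [hi.trans_le hn, dif_pos]
    exact (e _).2
  · simp only [hi.trans_le hn, hj.trans_le hn, dif_pos] at h
    have := e.injective (Subtype.ext h)
    simpa using this

/-- Completion of a node to a basis whose last vector has a short shadow. -/
lemma IsNode.exists_reduced_basis {T : ℕ} {v u : Fin 3 → ℤ} (h : IsNode T v u) :
    ∃ e, det₃ u v e = 1 ∧
      ‖√(u 2 : ℝ) • shadow u e‖ ≤ 1 / ‖√(u 2 : ℝ) • shadow u v‖ + ‖√(u 2 : ℝ) • shadow u v‖ / 2 := by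
  obtain ⟨e₀, he₀⟩ := h.basis
  have hq : (0 : ℝ) < u 2 := by exact_mod_cast h.pos
  have hsq := Real.mul_self_sqrt hq.le
  have hc : ∀ w, cross₂ (√(u 2 : ℝ) • shadow u v) (√(u 2 : ℝ) • shadow u w) = det₃ u v w := by
    intro w
    have h1 : cross₂ (√(u 2 : ℝ) • shadow u v) (√(u 2 : ℝ) • shadow u w) =
        (√(u 2 : ℝ) * √(u 2 : ℝ)) * cross₂ (shadow u v) (shadow u w) := by
      simp only [cross₂, Pi.smul_apply, smul_eq_mul]
      ring
    rw [h1, hsq, cross₂_shadow h.pos]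
    field_simp
  have hs : √(u 2 : ℝ) • shadow u v ≠ 0 := by
    intro h0
    have h1 := hc e₀
    rw [h0, he₀] at h1
    simp [cross₂] at h1
  obtain ⟨n, hn⟩ := exists_norm_sub_zsmul_le hs (√(u 2 : ℝ) • shadow u e₀)
  refine ⟨(1 : ℤ) • e₀ + (-n) • v + (0 : ℤ) • u, ?_, ?_⟩
  · refine Eq.trans ?_ he₀
    simp only [det₃, Pi.add_apply, Pi.smul_apply, smul_eq_mul]
    ring
  · rw [hc, he₀] at hn
    rw [shadow_combination h.pos]
    rw [Int.cast_one, abs_one] at hn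
    push_cast
    convert hn using 2
    rw [one_smul, smul_add, neg_smul, smul_neg, ← sub_eq_add_neg, smul_comm]

/-- The number of children of a node. -/
def childCard (m T : ℕ) : ℕ := T ^ (2 * m) / 512 * T ^ (2 * m + 2)

/-- The common properties of the children `c i` of the node `(v, u)`. -/
structure IsChildren (m T : ℕ) (u : Fin 3 → ℤ) (c : ℕ → Fin 3 → ℤ) : Prop where
  le_last : ∀ i < childCard m T, (T : ℤ) ^ (2 * m + 2) * u 2 ≤ c i 2
  last_le : ∀ i < childCard m T, c i 2 ≤ 2 * (T : ℤ) ^ (2 * m + 2) * u 2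
  basis : ∀ i < childCard m T, ∃ e, det₃ (c i) u e = 1
  lower : ∀ i < childCard m T, 1 / (32768 * (T : ℝ) ^ 2) ≤ ‖shadow (c i) u‖ ^ 2 * c i 2
  upper : ∀ i < childCard m T, ‖shadow (c i) u‖ ^ 2 * c i 2 ≤ 1 / (T : ℝ) ^ 2
  dist_le : ∀ i < childCard m T, dist (ratPt (c i)) (ratPt u) ≤
    1 / ((T : ℝ) ^ (m + 2) * (u 2 * √(u 2 : ℝ)))
  separated : ∀ i < childCard m T, ∀ j < childCard m T, i ≠ j →
    1 / (512 * (T : ℝ) ^ (3 * m + 4) * (u 2 * √(u 2 : ℝ))) ≤ dist (ratPt (c i)) (ratPt (c j))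

/-- The determinant of W with the difference kills the W term and leaves that of W and W', divided
by w'. -/
lemma le_norm_sub_of_cross {q Y N w w' : ℝ} {W W' : Fin 2 → ℝ} (hq : 0 < q) (hY : 0 < Y)
    (hN : 0 < N) (hW : ‖W‖ * √q ≤ Y) (hw' : 0 < w') (hw1 : w' ≤ 2 * N * q)
    (hc : 1 / q ≤ |cross₂ W W'|) :
    1 / (4 * N * Y * (q * √q)) ≤ ‖w⁻¹ • W - w'⁻¹ • W'‖ := by
  have hsq : 0 < √q := Real.sqrt_pos.2 hq
  have h1 := abs_cross₂_le W (w⁻¹ • W - w'⁻¹ • W')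
  have h2 : cross₂ W (w⁻¹ • W - w'⁻¹ • W') = -(w'⁻¹ * cross₂ W W') := by
    simp only [cross₂, Pi.sub_apply, Pi.smul_apply, smul_eq_mul]
    ring
  rw [h2, abs_neg, abs_mul, abs_of_pos (inv_pos.2 hw')] at h1
  set x := ‖w⁻¹ • W - w'⁻¹ • W'‖
  have hx : 0 ≤ x := norm_nonneg _
  have h3 : (2 * N * q)⁻¹ * (1 / q) ≤ w'⁻¹ * |cross₂ W W'| :=
    mul_le_mul (inv_anti₀ hw' hw1) hc (by positivity) (by positivity)
  have h4 : ‖W‖ ≤ Y / √q := (le_div_iff₀ hsq).2 hW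
  have h5 : 2 * ‖W‖ * x ≤ 2 * (Y / √q) * x := by gcongr
  have h6 : (2 * N * q)⁻¹ * (1 / q) ≤ 2 * (Y / √q) * x := by linarith
  have h7 : 1 / (4 * N * Y * (q * √q)) = (2 * N * q)⁻¹ * (1 / q) / (2 * (Y / √q)) := by
    have h8 : √q * √q = q := Real.mul_self_sqrt hq.le
    field_simp
    nlinarith
  rw [h7, div_le_iff₀ (by positivity)]
  linarith

/-- For a common shadow only the reciprocals of the denominators differ. -/
lemma le_norm_sub_of_parallel {q Y N w w' : ℝ} {W : Fin 2 → ℝ} (hq : 0 < q) (hY : 0 < Y)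
    (hN : 0 < N) (hW : Y / 128 ≤ ‖W‖ * √q) (hw : 0 < w) (hw' : 0 < w') (hw0 : w ≤ 2 * N * q)
    (hw1 : w' ≤ 2 * N * q) (hd : q ≤ |w' - w|) :
    Y / (512 * N ^ 2 * (q * √q)) ≤ ‖w⁻¹ • W - w'⁻¹ • W‖ := by
  have hsq : 0 < √q := Real.sqrt_pos.2 hq
  rw [← sub_smul, norm_smul, inv_sub_inv hw.ne' hw'.ne', Real.norm_eq_abs, abs_div, abs_mul,
    abs_of_pos hw, abs_of_pos hw']
  have h1 : q / (2 * N * q * (2 * N * q)) ≤ |w' - w| / (w * w') := by gcongr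
  have h2 : Y / 128 / √q ≤ ‖W‖ := (div_le_iff₀ hsq).2 hW
  calc _ = q / (2 * N * q * (2 * N * q)) * (Y / 128 / √q) := by field_simp; norm_num
    _ ≤ _ := mul_le_mul h1 h2 (by positivity) (by positivity)

/-- Along u, the scaled shadows of v and e span a unimodular lattice with a short vector of length η
between 1/(200T) and 2/T. The children come from its primitive vectors of length about Y = Tᵐ, about
Y² of them, lifted to ℤ³ with N = T^(2m+2) choices of last coordinate each. -/
theorem IsNode.exists_children {m T : ℕ} (hm : 2 ≤ m) (hT : 8192 ≤ T) {v u : Fin 3 → ℤ}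
    (h : IsNode T v u) : ∃ c : ℕ → Fin 3 → ℤ, IsChildren m T u c := by
  obtain ⟨e, he, hred⟩ := h.exists_reduced_basis
  have hqz := h.pos
  have hq : (0 : ℝ) < u 2 := by exact_mod_cast h.pos
  set q : ℝ := (u 2 : ℝ) with hqdef
  have hsq : 0 < √q := Real.sqrt_pos.2 hq
  have hsq2 : √q * √q = q := Real.mul_self_sqrt hq.le
  set s := √q • shadow u v with hs
  set t := √q • shadow u e with ht
  set η := ‖s‖ with hη
  have hη2 : η ^ 2 = ‖shadow u v‖ ^ 2 * q := by
    rw [hη, hs, norm_smul, Real.norm_of_nonneg hsq.le, mul_pow, sq √q, hsq2, mul_comm]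
  have hTr : (8192 : ℝ) ≤ T := by exact_mod_cast hT
  have hT0 : (0 : ℝ) < T := by linarith
  have hηl : 1 / (200 * T) ≤ η := by
    refine le_of_sq_le_sq ?_ (norm_nonneg _)
    rw [hη2]
    refine le_trans (le_of_eq ?_) h.lower
    rw [div_pow, mul_pow]
    norm_num
  have hηu : η ≤ 2 / T := by
    refine le_of_sq_le_sq ?_ (by positivity)
    rw [hη2]
    refine h.upper.trans (le_of_eq ?_)
    rw [div_pow]
    norm_num
  have hη0 : 0 < η := lt_of_lt_of_le (by positivity) hηl
  have hη1 : η ≤ 1 := hηu.trans ((div_le_one hT0).2 (by linarith))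
  set Y : ℝ := (T : ℝ) ^ m with hY
  have hY0 : 0 < Y := by positivity
  have hYη : 8 ≤ η * Y := by
    have h1 : (T : ℝ) ^ 2 ≤ Y := pow_le_pow_right₀ (by linarith) hm
    calc (8 : ℝ) ≤ 1 / (200 * T) * (T : ℝ) ^ 2 := by
          rw [show 1 / (200 * (T : ℝ)) * (T : ℝ) ^ 2 = T / 200 by field_simp]
          linarith
      _ ≤ η * Y := mul_le_mul hηl h1 (by positivity) hη0.le
  have hst : |cross₂ s t| = 1 := by
    have h1 : cross₂ s t = (√q * √q) * cross₂ (shadow u v) (shadow u e) := by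
      simp only [hs, ht, cross₂, Pi.smul_apply, smul_eq_mul]
      ring
    rw [h1, hsq2, cross₂_shadow h.pos, he]
    push_cast
    rw [mul_one_div_cancel hq.ne', abs_one]
  -- N = Y² T² makes the squared area of (u, child), of order Y²/N, equal to T⁻² up to constants, so
  -- that children are nodes again.
  set N : ℕ := T ^ (2 * m + 2) with hN
  have hNpos : 0 < N := Nat.pow_pos (by omega)
  have hNr : (N : ℝ) = Y ^ 2 * (T : ℝ) ^ 2 := by
    rw [hN, hY]
    push_cast
    ring
  have hN0 : (0 : ℝ) < N := by exact_mod_cast hNpos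
  have hcard : T ^ (2 * m) / 512 ≤ (coprimePairs ⌊η * Y / 4⌋₊ ⌊Y / (4 * η)⌋₊).card := by
    have h1 := le_card_coprimePairs_floor hη0 hη1 hYη
    have h2 : ((T ^ (2 * m) / 512 : ℕ) : ℝ) ≤ Y ^ 2 / 512 := by
      refine Nat.cast_div_le.trans (le_of_eq ?_)
      rw [hY]
      push_cast
      ring
    exact_mod_cast h2.trans h1
  obtain ⟨pr, hpr, hinj⟩ := exists_enumeration _ hcard
  set r : ℕ → ℤ := fun i => (pr (i / N)).1 * e 2 + (pr (i / N)).2 * v 2 with hr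
  -- i / N selects the coprime pair and i % N the multiple of u. Subtracting r / u 2 replaces r by
  -- its remainder, which puts the last coordinate between N u 2 and 2 N u 2.
  set c : ℕ → Fin 3 → ℤ := fun i => ((pr (i / N)).1 : ℤ) • e + ((pr (i / N)).2 : ℤ) • v +
    ((N : ℤ) - r i / u 2 + (i % N : ℕ)) • u with hc
  have hlt : ∀ i < childCard m T, i / N < T ^ (2 * m) / 512 := fun i hi =>
    Nat.div_lt_of_lt_mul (by rw [mul_comm]; exact hi)
  have hlast : ∀ i, c i 2 = N * u 2 + r i % u 2 + (i % N : ℕ) * u 2 := fun i => by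
    have h1 := Int.mul_ediv_add_emod (r i) (u 2)
    simp only [hc, Pi.add_apply, Pi.smul_apply, smul_eq_mul]
    have h2 : ((pr (i / N)).1 : ℤ) * e 2 + (pr (i / N)).2 * v 2 = r i := rfl
    linear_combination h2 - h1
  have hlow : ∀ i, (N : ℤ) * u 2 ≤ c i 2 := fun i => by
    rw [hlast]
    have h1 := Int.emod_nonneg (r i) hqz.ne'
    have h2 : 0 ≤ ((i % N : ℕ) : ℤ) * u 2 := by positivity
    linarith
  have hup : ∀ i, c i 2 ≤ 2 * N * u 2 := fun i => by
    rw [hlast]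
    have h1 := Int.emod_lt_of_pos (r i) hqz
    have h2 : ((i % N : ℕ) : ℤ) + 1 ≤ N := by exact_mod_cast Nat.mod_lt i hNpos
    nlinarith
  have hcpos : ∀ i, 0 < c i 2 := fun i => lt_of_lt_of_le (by positivity) (hlow i)
  have hlowr : ∀ i, (N : ℝ) * q ≤ c i 2 := fun i => by
    rw [hqdef]
    exact_mod_cast hlow i
  have hupr : ∀ i, (c i 2 : ℝ) ≤ 2 * N * q := fun i => by
    rw [hqdef]
    exact_mod_cast hup i
  have hcposr : ∀ i, (0 : ℝ) < c i 2 := fun i => by exact_mod_cast hcpos i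
  have hsh : ∀ i, shadow u (c i) = ((pr (i / N)).1 : ℝ) • shadow u e +
      ((pr (i / N)).2 : ℝ) • shadow u v := fun i => by
    have := shadow_combination hqz e v (pr (i / N)).1 (pr (i / N)).2
      ((N : ℤ) - r i / u 2 + (i % N : ℕ))
    rwa [Int.cast_natCast, Int.cast_natCast] at this
  have hnorm : ∀ i, ‖shadow u (c i)‖ * √q =
      ‖((pr (i / N)).1 : ℝ) • t + ((pr (i / N)).2 : ℝ) • s‖ := fun i => by
    have h1 : ((pr (i / N)).1 : ℝ) • t + ((pr (i / N)).2 : ℝ) • s = √q • shadow u (c i) := by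
      rw [hsh, smul_add, ht, hs, smul_comm √q, smul_comm √q]
    rw [h1, norm_smul, Real.norm_of_nonneg hsq.le, mul_comm]
  have hbd : ∀ i < childCard m T, ‖shadow u (c i)‖ * √q ≤ Y ∧ Y / 128 ≤ ‖shadow u (c i)‖ * √q :=
    fun i hi => by
      rw [hnorm]
      exact combination_bounds hη0 hη1 rfl hst hred hYη (hpr _ (hlt i hi))
  have hsw : ∀ i, ‖shadow (c i) u‖ ^ 2 * c i 2 = (‖shadow u (c i)‖ * √q) ^ 2 * q / c i 2 :=
    fun i => by
      have h1 := hcposr i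
      rw [shadow_swap hqz (hcpos i), norm_smul, norm_neg, Real.norm_of_nonneg (by positivity),
        mul_pow, mul_pow, sq √q, hsq2]
      field_simp
      ring
  have hdist : ∀ i j, dist (ratPt (c i)) (ratPt (c j)) =
      ‖(c i 2 : ℝ)⁻¹ • shadow u (c i) - (c j 2 : ℝ)⁻¹ • shadow u (c j)‖ := fun i j => by
    rw [dist_eq_norm, ← ratPt_sub (hcpos i), ← ratPt_sub (hcpos j), sub_sub_sub_cancel_right]
  refine ⟨c, ⟨fun i _ => ?_, fun i _ => ?_, fun i hi => ?_, fun i hi => ?_, fun i hi => ?_,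
    fun i hi => ?_, fun i hi j hj hij => ?_⟩⟩
  · have := hlow i
    rwa [hN, Nat.cast_pow] at this
  · have := hup i
    rwa [hN, Nat.cast_pow] at this
  · have hcop : Nat.Coprime (pr (i / N)).1 (pr (i / N)).2 :=
      (Finset.mem_filter.1 (hpr _ (hlt i hi))).2.2
    have hbez := Nat.gcd_eq_gcd_ab (pr (i / N)).1 (pr (i / N)).2
    rw [hcop] at hbez
    push_cast at hbez
    set a : ℤ := ((pr (i / N)).1 : ℤ)
    set b : ℤ := ((pr (i / N)).2 : ℤ)
    set x := Nat.gcdA (pr (i / N)).1 (pr (i / N)).2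
    set y := Nat.gcdB (pr (i / N)).1 (pr (i / N)).2
    -- The Bézout coefficients of the coprime pair complete the child and u to a basis.
    refine ⟨(-y) • e + x • v, ?_⟩
    have h1 : det₃ (c i) u ((-y) • e + x • v) = (a * x + b * y) * det₃ u v e := by
      simp only [hc, det₃, Pi.add_apply, Pi.smul_apply, smul_eq_mul]
      ring
    rw [h1, he, ← hbez, one_mul]
  · rw [hsw]
    have h1 := hcposr i
    have h2 := pow_le_pow_left₀ (by positivity) (hbd i hi).2 2
    rw [le_div_iff₀ h1]
    calc 1 / (32768 * (T : ℝ) ^ 2) * (c i 2 : ℝ) ≤ 1 / (32768 * (T : ℝ) ^ 2) * (2 * N * q) := by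
          gcongr; exact hupr i
      _ = (Y / 128) ^ 2 * q := by rw [hNr]; field_simp; norm_num
      _ ≤ _ := by gcongr
  · rw [hsw]
    have h1 := hcposr i
    have h2 := pow_le_pow_left₀ (by positivity) (hbd i hi).1 2
    rw [div_le_iff₀ h1]
    calc _ ≤ Y ^ 2 * q := by gcongr
      _ = 1 / (T : ℝ) ^ 2 * (N * q) := by rw [hNr]; field_simp
      _ ≤ _ := by gcongr; exact hlowr i
  · have h1 := hcposr i
    rw [dist_eq_norm, ratPt_sub (hcpos i), norm_smul, Real.norm_of_nonneg (by positivity)]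
    have h2 : ‖shadow u (c i)‖ ≤ Y / √q := (le_div_iff₀ hsq).2 (hbd i hi).1
    calc _ ≤ (N * q)⁻¹ * (Y / √q) := by gcongr; exact hlowr i
      _ = _ := by
        rw [hNr, pow_add, ← hY]
        field_simp
        rw [hqdef]
  · rw [hdist]
    have hgoal : 1 / (512 * (T : ℝ) ^ (3 * m + 4) * (q * √q)) =
        1 / (512 * Y ^ 3 * (T : ℝ) ^ 4 * (q * √q)) := by
      rw [hY]; ring
    rw [hgoal]
    -- With the same pair the shadows agree and the last coordinates differ by a nonzero multiple of
    -- u 2. Distinct coprime positive pairs are not proportional, so the determinant of the shadows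
    -- is at least 1/q.
    by_cases hp : pr (i / N) = pr (j / N)
    · have hdiv := hinj _ (hlt i hi) _ (hlt j hj) hp
      have hmod : i % N ≠ j % N := fun h' => hij (by
        rw [← Nat.div_add_mod i N, ← Nat.div_add_mod j N, hdiv, h'])
      have hsame : shadow u (c j) = shadow u (c i) := by rw [hsh, hsh, hp]
      have hrr : r j = r i := by simp only [hr, hdiv]
      have hd : q ≤ |(c j 2 : ℝ) - c i 2| := by
        have h1 : c j 2 - c i 2 = (((j % N : ℕ) : ℤ) - (i % N : ℕ)) * u 2 := by
          rw [hlast, hlast, hrr]; ring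
        have h2 : (1 : ℤ) ≤ |((j % N : ℕ) : ℤ) - (i % N : ℕ)| :=
          Int.one_le_abs (sub_ne_zero.2 (by exact_mod_cast hmod.symm))
        have h3 : u 2 ≤ |c j 2 - c i 2| := by
          rw [h1, abs_mul, abs_of_pos hqz]
          nlinarith
        rw [hqdef]
        exact_mod_cast h3
      rw [hsame]
      refine le_trans (le_of_eq ?_) (le_norm_sub_of_parallel hq hY0 hN0 (hbd i hi).2 (hcposr i)
        (hcposr j) (hupr i) (hupr j) hd)
      rw [hNr]
      field_simp
    · have hcr : 1 / q ≤ |cross₂ (shadow u (c i)) (shadow u (c j))| := by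
        have hmi := Finset.mem_filter.1 (hpr _ (hlt i hi))
        have hmj := Finset.mem_filter.1 (hpr _ (hlt j hj))
        have hne : ((pr (i / N)).1 : ℤ) * (pr (j / N)).2 - (pr (i / N)).2 * (pr (j / N)).1 ≠ 0 := by
          intro h0
          apply hp
          have h1 : (pr (i / N)).1 * (pr (j / N)).2 = (pr (i / N)).2 * (pr (j / N)).1 := by
            exact_mod_cast sub_eq_zero.1 h0
          have d1 : (pr (i / N)).1 ∣ (pr (j / N)).1 :=
            hmi.2.2.dvd_of_dvd_mul_left ⟨_, h1.symm⟩
          have d2 : (pr (j / N)).1 ∣ (pr (i / N)).1 :=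
            hmj.2.2.dvd_of_dvd_mul_right ⟨(pr (i / N)).2, by rw [h1, mul_comm]⟩
          have e1 := Nat.dvd_antisymm d1 d2
          have hpos : 0 < (pr (i / N)).1 :=
            (Finset.mem_Ioc.1 (Finset.mem_product.1 hmi.1).1).1
          refine Prod.ext e1 ?_
          rw [← e1, mul_comm] at h1
          exact (Nat.eq_of_mul_eq_mul_right hpos h1).symm
        have h1 : cross₂ (shadow u (c i)) (shadow u (c j)) =
            -(((((pr (i / N)).1 : ℤ) * (pr (j / N)).2 - (pr (i / N)).2 * (pr (j / N)).1 : ℤ) : ℝ) *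
              cross₂ (shadow u v) (shadow u e)) := by
          rw [hsh, hsh]
          simp only [cross₂, Pi.add_apply, Pi.smul_apply, smul_eq_mul]
          push_cast
          ring
        have h2 : (1 : ℝ) ≤ |((((pr (i / N)).1 : ℤ) * (pr (j / N)).2 -
            (pr (i / N)).2 * (pr (j / N)).1 : ℤ) : ℝ)| := by
          exact_mod_cast Int.one_le_abs hne
        rw [h1, abs_neg, abs_mul, cross₂_shadow hqz, he, Int.cast_one,
          abs_of_pos (show 0 < 1 / (u 2 : ℝ) by positivity)]
        exact le_mul_of_one_le_left (by positivity) h2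
      refine le_trans ?_ (le_norm_sub_of_cross hq hY0 hN0 (hbd i hi).1
        (hcposr j) (hupr j) hcr)
      rw [hNr]
      refine one_div_le_one_div_of_le (by positivity) ?_
      have h1 : 4 * (Y ^ 2 * (T : ℝ) ^ 2) * Y * (q * √q) =
          4 * (Y ^ 3 * (T : ℝ) ^ 2 * (q * √q)) := by ring
      have h2 : 512 * Y ^ 3 * (T : ℝ) ^ 4 * (q * √q) =
          (512 * (T : ℝ) ^ 2) * (Y ^ 3 * (T : ℝ) ^ 2 * (q * √q)) := by ring
      rw [h1, h2]
      exact mul_le_mul_of_nonneg_right (by nlinarith) (by positivity)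

/-! ### Divergence from successive rational approximations -/

lemma mul_mem_Dlift {p g : G} (h0 : p.1 0 2 = 0) (h1 : p.1 1 2 = 0) (hg : g ∈ Dlift) :
    p * g ∈ Dlift := by
  intro ε hε
  have hp := absSum_pos p
  obtain ⟨T, hT⟩ := hg (ε / absSum p.1) (by positivity)
  refine ⟨max T 0, fun t ht => ?_⟩
  have ht0 : 0 ≤ t := (le_max_right _ _).trans ht.le
  have e : flow t * (p * g) = (flow t * p * flow (-t)) * (flow t * g) := by
    rw [flow_neg]
    group
  rw [e]
  have h2 := hT t ((le_max_left _ _).trans_lt ht)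
  calc _ ≤ absSum (flow t * p * flow (-t) : G).1 * systole (flow t * g) := systole_le_mul _ _
    _ ≤ absSum p.1 * systole (flow t * g) :=
      mul_le_mul_of_nonneg_right (absSum_flow_conj_le ht0 h0 h1) (systole_pos _).le
    _ < ε := by rwa [lt_div_iff₀' hp] at h2

lemma exists_between_consecutive (b : ℕ → ℝ) (hb : ∀ k : ℕ, (k : ℝ) ≤ b k) (K : ℕ) {E : ℝ}
    (hE : b K ≤ E) : ∃ k, K ≤ k ∧ b k ≤ E ∧ E < b (k + 1) := by
  by_contra! h
  have h1 : ∀ n, b (K + n) ≤ E := fun n => by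
    induction n with
    | zero => exact hE
    | succ n ih => exact h _ (Nat.le_add_right _ _) ih
  obtain ⟨n, hn⟩ := exists_nat_gt E
  have h2 := (hb (K + n)).trans (h1 n)
  push_cast at h2
  have h3 : (0 : ℝ) ≤ K := K.cast_nonneg
  linarith

lemma norm_flow_unip_le {x : Fin 2 → ℝ} {u : Fin 3 → ℤ} (hu : 0 < u 2) {t d ε : ℝ}
    (hd : dist x (-ratPt u) ≤ d) (h1 : Real.exp t * (u 2 * d) ≤ ε)
    (h2 : Real.exp (-2 * t) * u 2 ≤ ε) :
    ‖(flow t * unip x : G).1.mulVec (vec u)‖ ≤ ε := by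
  have hq : (0 : ℝ) < u 2 := by exact_mod_cast hu
  have hpos : 0 < Real.exp t := Real.exp_pos t
  have hpos2 : 0 < Real.exp (-2 * t) := Real.exp_pos _
  have hε : 0 ≤ ε := le_trans (by positivity) h2
  have hi : ∀ i, |x i + ratPt u i| ≤ d := fun i => by
    have := (dist_le_pi_dist x (-ratPt u) i).trans hd
    rwa [Real.dist_eq, Pi.neg_apply, sub_neg_eq_add] at this
  have hj : ∀ (i : Fin 2) (a : ℝ), a = u 2 * ratPt u i →
      |Real.exp t * (a + x i * u 2)| ≤ ε := by
    rintro i _ rfl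
    rw [show (u 2 : ℝ) * ratPt u i + x i * u 2 = u 2 * (x i + ratPt u i) by ring, abs_mul, abs_mul,
      abs_of_pos hpos, abs_of_pos hq]
    refine le_trans ?_ h1
    gcongr
    exact hi i
  rw [mul_mulVec, unip_mulVec, flow_mulVec, pi_norm_le_iff_of_nonneg hε]
  intro i
  rw [Real.norm_eq_abs]
  fin_cases i
  · refine hj 0 _ ?_
    simp [vec, ratPt]
    field_simp
  · refine hj 1 _ ?_
    simp [vec, ratPt]
    field_simp
  · change |Real.exp (-2 * t) * u 2| ≤ ε
    rwa [abs_of_pos (by positivity)]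

/-- With T = k + 8192 and T' = k + 8193, the vector u k is short while exp(2t) runs from T · u k 2
to T' · u (k+1) 2. Its last coordinate has then dropped below 1/T, and the others, growing like eᵗ,
are still below 4/√T. These intervals cover all large times. The sign in −`ratPt` appears because
`unip x` adds x times the last coordinate. -/
lemma unip_mem_Dlift {m : ℕ} {x : Fin 2 → ℝ} (u : ℕ → Fin 3 → ℤ) (hu : ∀ k, 0 < u k 2)
    (hle : ∀ k, u (k + 1) 2 ≤ 2 * ((k + 8192 : ℕ) : ℤ) ^ (2 * m + 2) * u k 2)
    (hx : ∀ k, dist x (-ratPt (u k)) ≤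
      2 * (1 / (((k + 8192 : ℕ) : ℝ) ^ (m + 2) * (u k 2 * √(u k 2 : ℝ))))) :
    unip x ∈ Dlift := by
  intro ε hε
  obtain ⟨K, hK⟩ := exists_nat_gt (max (1 / ε) (16 / ε ^ 2))
  have hb : ∀ k : ℕ, (k : ℝ) ≤ ((k + 8192 : ℕ) : ℝ) * u k 2 := fun k => by
    have : (1 : ℝ) ≤ u k 2 := by exact_mod_cast hu k
    push_cast
    nlinarith [k.cast_nonneg (α := ℝ)]
  refine ⟨((K + 8192 : ℕ) : ℝ) * u K 2, fun t ht => ?_⟩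
  have hE0 : ((K + 8192 : ℕ) : ℝ) * u K 2 ≤ Real.exp (2 * t) := by
    have h1 := Real.add_one_le_exp t
    have h2 : 0 ≤ ((K + 8192 : ℕ) : ℝ) * u K 2 := (K.cast_nonneg).trans (hb K)
    have h3 : Real.exp t ≤ Real.exp (2 * t) := Real.exp_le_exp.2 (by linarith)
    linarith
  obtain ⟨k, hKk, hk1, hk2⟩ := exists_between_consecutive _ hb K hE0
  set T : ℕ := k + 8192 with hTdef
  have hT1 : (K : ℝ) < T := by exact_mod_cast (by omega : K < k + 8192)
  have hT0 : (0 : ℝ) < T := by positivity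
  have hTε : 1 / ε < T := (le_max_left _ _).trans_lt (hK.trans hT1)
  have hTε2 : 16 / ε ^ 2 < T := (le_max_right _ _).trans_lt (hK.trans hT1)
  have hq : (0 : ℝ) < u k 2 := by exact_mod_cast hu k
  have hsq : 0 < √(u k 2 : ℝ) := Real.sqrt_pos.2 hq
  have hne : u k ≠ 0 := fun h => by
    have := hu k
    rw [h] at this
    exact lt_irrefl _ this
  set ε' := max (1 / (T : ℝ)) (4 / √T)
  have hε' : ε' < ε := by
    refine max_lt ?_ ?_
    · rwa [div_lt_comm₀ hT0 hε]
    · rw [div_lt_iff₀ (Real.sqrt_pos.2 hT0)]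
      refine lt_of_pow_lt_pow_left₀ 2 (by positivity) ?_
      rw [mul_pow, Real.sq_sqrt hT0.le]
      rw [div_lt_iff₀ (by positivity)] at hTε2
      linarith
  refine ((systole_le _ hne).trans (norm_flow_unip_le (hu k) (hx k) ?_ ?_)).trans_lt hε'
  · refine le_trans ?_ (le_max_right _ _)
    rw [show Real.exp t * (u k 2 * (2 * (1 / ((T : ℝ) ^ (m + 2) * (u k 2 * √(u k 2 : ℝ)))))) =
      2 * Real.exp t / ((T : ℝ) ^ (m + 2) * √(u k 2 : ℝ)) by field_simp]
    refine le_of_sq_le_sq ?_ (by positivity)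
    have hle' : (u (k + 1) 2 : ℝ) ≤ 2 * (T : ℝ) ^ (2 * m + 2) * u k 2 := by exact_mod_cast hle k
    have hT2 : ((k + 1 + 8192 : ℕ) : ℝ) ≤ 2 * T := by exact_mod_cast (by omega)
    rw [div_pow, div_pow, mul_pow, mul_pow, Real.sq_sqrt hT0.le, Real.sq_sqrt hq.le,
      div_le_div_iff₀ (by positivity) hT0, ← Real.exp_nat_mul]
    push_cast
    calc 2 ^ 2 * Real.exp (2 * t) * T
        ≤ 2 ^ 2 * (((k + 1 + 8192 : ℕ) : ℝ) * u (k + 1) 2) * T := by gcongr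
      _ ≤ 2 ^ 2 * ((2 * T) * (2 * (T : ℝ) ^ (2 * m + 2) * u k 2)) * T := by
        have : (0 : ℝ) ≤ u (k + 1) 2 := by exact_mod_cast (hu (k + 1)).le
        gcongr
      _ = 4 ^ 2 * (((T : ℝ) ^ (m + 2)) ^ 2 * u k 2) := by ring
  · refine le_trans ?_ (le_max_left _ _)
    rw [neg_mul, Real.exp_neg, inv_mul_le_iff₀ (Real.exp_pos _), mul_one_div, le_div_iff₀ hT0,
      mul_comm]
    exact hk1

/-! ### The tree of nodes -/

/-- The passage from T to T + 1 is paid for by the slack in the constants: 32768 < 40000 = 200²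
below, and T + 1 ≤ 2T above. -/
lemma IsChildren.isNode {m T : ℕ} {u : Fin 3 → ℤ} {c : ℕ → Fin 3 → ℤ} (hT : 8192 ≤ T)
    (hu : 0 < u 2) (h : IsChildren m T u c) {i : ℕ} (hi : i < childCard m T) :
    IsNode (T + 1) u (c i) := by
  have hT0 : (8192 : ℝ) ≤ T := by exact_mod_cast hT
  have hTz : (0 : ℤ) < T := by omega
  refine ⟨lt_of_lt_of_le (by positivity) (h.le_last i hi), h.basis i hi,
    le_trans ?_ (h.lower i hi), (h.upper i hi).trans ?_⟩
  · push_cast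
    exact one_div_le_one_div_of_le (by positivity) (by nlinarith)
  · push_cast
    rw [div_le_div_iff₀ (by positivity) (by positivity)]
    nlinarith

lemma IsChildren.congr {m T : ℕ} {u : Fin 3 → ℤ} {c c' : ℕ → Fin 3 → ℤ} (h : IsChildren m T u c)
    (heq : ∀ i < childCard m T, c' i = c i) : IsChildren m T u c' := by
  refine ⟨fun i hi => ?_, fun i hi => ?_, fun i hi => ?_, fun i hi => ?_, fun i hi => ?_,
    fun i hi => ?_, fun i hi j hj hij => ?_⟩
  · rw [heq i hi]; exact h.le_last i hi
  · rw [heq i hi]; exact h.last_le i hi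
  · rw [heq i hi]; exact h.basis i hi
  · rw [heq i hi]; exact h.lower i hi
  · rw [heq i hi]; exact h.upper i hi
  · rw [heq i hi]; exact h.dist_le i hi
  · rw [heq i hi, heq j hj]; exact h.separated i hi j hj hij

lemma exists_node {T : ℕ} (hT : 0 < T) : ∃ p : (Fin 3 → ℤ) × (Fin 3 → ℤ), IsNode T p.1 p.2 := by
  have hT' : (0 : ℝ) < T := by exact_mod_cast hT
  refine ⟨(![0, 0, 1], ![1, 0, (T : ℤ) ^ 2]), ⟨by simp; positivity, ⟨![0, -1, 0], by simp [det₃]⟩,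
    ?_, ?_⟩⟩
  all_goals
    have h : ‖shadow ![1, 0, (T : ℤ) ^ 2] ![0, 0, 1]‖ = 1 / (T : ℝ) ^ 2 := by
      apply le_antisymm
      · refine (pi_norm_le_iff_of_nonneg (by positivity)).2 fun i => ?_
        fin_cases i <;> simp [shadow]
      · refine le_trans ?_ (norm_le_pi_norm _ 0)
        simp [shadow]
    simp only [h]
    simp
    field_simp
    norm_num

/-- The scale of the tree at level `k`. -/
abbrev scale (k : ℕ) : ℕ := k + 8192

theorem exists_node_tree {m : ℕ} (hm : 2 ≤ m) :
    ∃ (u₀ : Fin 3 → ℤ) (u : ℕ → ℕ → Fin 3 → ℤ) (c : ℕ → ℕ → ℕ → Fin 3 → ℤ), (∀ n, u 0 n = u₀) ∧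
      (∀ k n, 0 < u k n 2) ∧
      (∀ k n, u (k + 1) n = c k (n / childCard m (scale k)) (n % childCard m (scale k))) ∧
      ∀ k n, IsChildren m (scale k) (u k n) (c k n) := by
  choose root hroot using fun k : ℕ => exists_node (T := scale k) (by unfold scale; omega)
  choose child hchild using fun (k : ℕ) (p : {p : (Fin 3 → ℤ) × (Fin 3 → ℤ) //
    IsNode (scale k) p.1 p.2}) => p.2.exists_children hm (by unfold scale; omega)
  -- Out-of-range indices receive an arbitrary node, so that the recursion is total; the properties
  -- of children concern only indices in range.
  let next (k : ℕ) (p : {p : (Fin 3 → ℤ) × (Fin 3 → ℤ) // IsNode (scale k) p.1 p.2}) (i : ℕ) :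
      {p : (Fin 3 → ℤ) × (Fin 3 → ℤ) // IsNode (scale (k + 1)) p.1 p.2} :=
    if h : i < childCard m (scale k) then
      ⟨(p.1.2, child k p i), by
        have := (hchild k p).isNode (by unfold scale; omega) p.2.pos h
        rwa [show scale k + 1 = scale (k + 1) by unfold scale; omega] at this⟩
    else ⟨root (k + 1), hroot (k + 1)⟩
  let node (k : ℕ) : ℕ → {p : (Fin 3 → ℤ) × (Fin 3 → ℤ) // IsNode (scale k) p.1 p.2} :=
    Nat.rec (fun _ => ⟨root 0, hroot 0⟩) (fun k f n =>
      next k (f (n / childCard m (scale k))) (n % childCard m (scale k))) k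
  refine ⟨(root 0).2, fun k n => (node k n).1.2, fun k n i => (next k (node k n) i).1.2,
    fun n => rfl, fun k n => (node k n).2.pos, fun k n => rfl, fun k n => ?_⟩
  have heq : ∀ i < childCard m (scale k), (next k (node k n) i).1.2 = child k (node k n) i :=
    fun i hi => by simp only [next, dif_pos hi]
  exact (hchild k (node k n)).congr heq

/-! ### Numbers of children, gaps and the exponent -/

lemma le_childCard {m T : ℕ} (hm : 2 ≤ m) (hT : 8192 ≤ T) :
    (T : ℝ) ^ (4 * m + 2) / 1024 ≤ childCard m T := by
  have h1 : 512 ≤ T ^ (2 * m) :=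
    calc 512 ≤ T := by omega
      _ ≤ T ^ (2 * m) := Nat.le_self_pow (by omega) T
  have h2 : (T : ℝ) ^ (2 * m) / 1024 ≤ ((T ^ (2 * m) / 512 : ℕ) : ℝ) := by
    have h3 : T ^ (2 * m) ≤ 1024 * (T ^ (2 * m) / 512) := by omega
    have h4 : (T : ℝ) ^ (2 * m) ≤ 1024 * ((T ^ (2 * m) / 512 : ℕ) : ℝ) := by exact_mod_cast h3
    linarith
  unfold childCard
  calc (T : ℝ) ^ (4 * m + 2) / 1024 = (T : ℝ) ^ (2 * m) / 1024 * (T : ℝ) ^ (2 * m + 2) := by ring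
    _ ≤ ((T ^ (2 * m) / 512 : ℕ) : ℝ) * (T : ℝ) ^ (2 * m + 2) := by gcongr
    _ = _ := by push_cast; ring

/-- A bound for the square root of the last coordinate of the nodes at level `k`. -/
def rad (m : ℕ) (r₀ : ℝ) (k : ℕ) : ℝ :=
  r₀ * ∏ i ∈ Finset.range k, 2 * (scale i : ℝ) ^ (m + 1)

lemma rad_succ (m : ℕ) (r₀ : ℝ) (k : ℕ) :
    rad m r₀ (k + 1) = rad m r₀ k * (2 * (scale k : ℝ) ^ (m + 1)) := by
  rw [rad, rad, Finset.prod_range_succ, mul_assoc]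

lemma two_pow_le_rad (m : ℕ) {r₀ : ℝ} (hr : 1 ≤ r₀) (k : ℕ) : 2 ^ k ≤ rad m r₀ k := by
  induction k with
  | zero => simpa [rad] using hr
  | succ k ih =>
    rw [rad_succ, pow_succ]
    have h1 : (1 : ℝ) ≤ (scale k : ℝ) ^ (m + 1) := one_le_pow₀ (by simp [scale]; linarith)
    exact mul_le_mul ih (by linarith) (by norm_num) (le_trans (by positivity) ih)

/-- The gap between the points at level `k + 1`. -/
noncomputable def gap (m : ℕ) (r₀ : ℝ) (k : ℕ) : ℝ :=
  1 / (1024 * (scale k : ℝ) ^ (3 * m + 4) * rad m r₀ k ^ 3)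

lemma gap_pos (m : ℕ) {r₀ : ℝ} (hr : 1 ≤ r₀) (k : ℕ) : 0 < gap m r₀ k := by
  have h1 : 0 < rad m r₀ k := lt_of_lt_of_le (by positivity) (two_pow_le_rad m hr k)
  have h2 : (0 : ℝ) < (scale k : ℝ) := by simp [scale]; positivity
  unfold gap
  positivity

/-- The cube of `rad` grows by 8 T^(3m+3) per level; the remaining factor is (T'/T)^(3m+4), at most
2^(3m+4). -/
lemma gap_le_mul_gap_succ (m : ℕ) {r₀ : ℝ} (hr : 1 ≤ r₀) (k : ℕ) :
    gap m r₀ k ≤ 2 ^ (3 * m + 7) * (scale k : ℝ) ^ (3 * m + 3) * gap m r₀ (k + 1) := by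
  have h1 : 0 < rad m r₀ k := lt_of_lt_of_le (by positivity) (two_pow_le_rad m hr k)
  have h2 : (0 : ℝ) < (scale k : ℝ) := by simp [scale]; positivity
  have h3 : (0 : ℝ) < (scale (k + 1) : ℝ) := by simp [scale]; positivity
  have h4 : (scale (k + 1) : ℝ) ≤ 2 * scale k := by exact_mod_cast (by unfold scale; omega)
  unfold gap
  rw [rad_succ, mul_one_div, div_le_div_iff₀ (by positivity) (by positivity), one_mul]
  calc 1024 * (scale (k + 1) : ℝ) ^ (3 * m + 4) * (rad m r₀ k * (2 * (scale k : ℝ) ^ (m + 1))) ^ 3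
      ≤ 1024 * (2 * (scale k : ℝ)) ^ (3 * m + 4) *
        (rad m r₀ k * (2 * (scale k : ℝ) ^ (m + 1))) ^ 3 := by gcongr
    _ = _ := by ring

lemma gap_le (m : ℕ) {r₀ : ℝ} (hr : 1 ≤ r₀) (k : ℕ) : gap m r₀ k ≤ (1 / 2) ^ k := by
  have h := two_pow_le_rad m hr k
  have h0 : (1 : ℝ) ≤ 2 ^ k := one_le_pow₀ (by norm_num)
  have h1 : 1 ≤ rad m r₀ k := h0.trans h
  have h2 : (1 : ℝ) ≤ (scale k : ℝ) ^ (3 * m + 4) := one_le_pow₀ (by simp [scale]; linarith)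
  have h3 : rad m r₀ k ≤ rad m r₀ k ^ 3 := le_self_pow₀ h1 (by norm_num)
  rw [one_div, inv_pow, gap, one_div]
  refine inv_anti₀ (by positivity) ?_
  calc (2 : ℝ) ^ k ≤ 1 * rad m r₀ k ^ 3 := by linarith
    _ ≤ _ := by gcongr; linarith

lemma gap_antitone (m : ℕ) {r₀ : ℝ} (hr : 1 ≤ r₀) : Antitone (gap m r₀) := by
  refine antitone_nat_of_succ_le fun k => ?_
  have h1 : 0 < rad m r₀ k := lt_of_lt_of_le (by positivity) (two_pow_le_rad m hr k)
  have h2 : (1 : ℝ) ≤ (scale k : ℝ) := by simp [scale]; linarith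
  have h3 : (scale k : ℝ) ≤ scale (k + 1) := by exact_mod_cast (by unfold scale; omega)
  have h4 : (1 : ℝ) ≤ (scale k : ℝ) ^ (m + 1) := one_le_pow₀ h2
  unfold gap
  rw [rad_succ]
  refine one_div_le_one_div_of_le (by positivity) ?_
  have h5 : rad m r₀ k ≤ rad m r₀ k * (2 * (scale k : ℝ) ^ (m + 1)) :=
    le_mul_of_one_le_right h1.le (by linarith)
  gcongr

lemma tendsto_atTop_of_le_mul (g : ℕ → ℝ) {c : ℝ} (hc : 0 < c) (h0 : ∀ k, 0 < g k)
    (h : ∀ k : ℕ, c * k * g k ≤ g (k + 1)) : Filter.Tendsto g Filter.atTop Filter.atTop := by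
  obtain ⟨K, hK⟩ := exists_nat_gt (2 / c)
  have h1 : ∀ n, g K * 2 ^ n ≤ g (K + n) := fun n => by
    induction n with
    | zero => simp
    | succ n ih =>
      have h2 : 2 ≤ c * ((K + n : ℕ) : ℝ) := by
        rw [div_lt_iff₀' hc] at hK
        push_cast
        nlinarith [n.cast_nonneg (α := ℝ)]
      calc g K * 2 ^ (n + 1) = 2 * (g K * 2 ^ n) := by ring
        _ ≤ c * ((K + n : ℕ) : ℝ) * g (K + n) :=
          mul_le_mul h2 ih (by have := h0 K; positivity) (by linarith)
        _ ≤ _ := h (K + n)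
  have h2 : Filter.Tendsto (fun n => g (K + n)) Filter.atTop Filter.atTop :=
    Filter.tendsto_atTop_mono h1
      ((tendsto_pow_atTop_atTop_of_one_lt one_lt_two).const_mul_atTop (h0 K))
  simpa [add_comm] using (Filter.tendsto_add_atTop_iff_nat K).1 (by simpa [add_comm] using h2)

/-- Per level the count gains T^(4m+2)/1024 while the power of the gap loses at most C T^(4m+1).
Taking 4m + 1 instead of 4m + 2 in the exponent leaves one power of T, which tends to infinity and
beats the constants. -/
lemma tendsto_levelCard_mul_gap {m : ℕ} (hm : 2 ≤ m) {r₀ : ℝ} (hr : 1 ≤ r₀) :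
    Filter.Tendsto (fun k => (levelCard (fun i => childCard m (scale i)) k : ℝ) *
      gap m r₀ k ^ ((4 * m + 1 : ℝ) / (3 * m + 3))) Filter.atTop Filter.atTop := by
  set s : ℝ := (4 * m + 1 : ℝ) / (3 * m + 3) with hs
  have hs0 : 0 < s := by positivity
  set C : ℝ := (2 ^ (3 * m + 7)) ^ s with hC
  have hC0 : 0 < C := by positivity
  have hcard : ∀ k, (scale k : ℝ) ^ (4 * m + 2) / 1024 ≤ childCard m (scale k) := fun k =>
    le_childCard hm (by unfold scale; omega)
  have hsc : ∀ k, (0 : ℝ) < (scale k : ℝ) := fun k => by simp [scale]; positivity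
  have hlev : ∀ k, 0 < (levelCard (fun i => childCard m (scale i)) k : ℝ) := fun k => by
    rw [levelCard]
    push_cast
    refine Finset.prod_pos fun i _ => lt_of_lt_of_le ?_ (hcard i)
    have := hsc i
    positivity
  refine tendsto_atTop_of_le_mul _ (c := 1 / (1024 * C)) (by positivity) (fun k => ?_) fun k => ?_
  · have h1 := hlev k
    have h2 := gap_pos m hr k
    positivity
  · have h1 := hlev k
    have h2 := gap_pos m hr k
    have h3 := gap_pos m hr (k + 1)
    have h4 := hsc k
    have h5 : gap m r₀ k ^ s ≤ C * (scale k : ℝ) ^ (4 * m + 1) * gap m r₀ (k + 1) ^ s := by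
      refine (Real.rpow_le_rpow h2.le (gap_le_mul_gap_succ m hr k) hs0.le).trans (le_of_eq ?_)
      rw [Real.mul_rpow (by positivity) h3.le, Real.mul_rpow (by positivity) (by positivity), ← hC]
      congr 2
      rw [← Real.rpow_natCast, ← Real.rpow_mul h4.le, ← Real.rpow_natCast]
      congr 1
      rw [hs]
      push_cast
      field_simp
    have hkT : (k : ℝ) ≤ scale k := by simp [scale]
    have h6 : (levelCard (fun i => childCard m (scale i)) (k + 1) : ℝ) =
        levelCard (fun i => childCard m (scale i)) k * childCard m (scale k) := by
      rw [levelCard, Finset.prod_range_succ, Nat.cast_mul, ← levelCard]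
    rw [h6]
    set L : ℝ := (levelCard (fun i => childCard m (scale i)) k : ℝ)
    set G' := gap m r₀ (k + 1) ^ s
    have hG' : 0 < G' := Real.rpow_pos_of_pos h3 _
    calc 1 / (1024 * C) * k * (L * gap m r₀ k ^ s)
        ≤ 1 / (1024 * C) * scale k * (L * (C * (scale k : ℝ) ^ (4 * m + 1) * G')) := by gcongr
      _ = L * ((scale k : ℝ) ^ (4 * m + 2) / 1024) * G' := by field_simp; ring
      _ ≤ L * childCard m (scale k) * G' := by gcongr; exact hcard k

/-- Compares the radius of a child with the spacing of its siblings: q√q gains T^(3m+3), leaving a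
spare factor T^(m+1) ≥ 4096. -/
lemma one_div_le_of_growth {m : ℕ} {T T' q q' : ℝ} (hm : 2 ≤ m) (hT : 8192 ≤ T) (hTT : T ≤ T')
    (hq : 0 < q) (hqq : T ^ (2 * m + 2) * q ≤ q') :
    1 / (T' ^ (m + 2) * (q' * √q')) ≤ 1 / (4096 * T ^ (3 * m + 4) * (q * √q)) := by
  have hT0 : 0 < T := by linarith
  have hT'0 : 0 < T' := hT0.trans_le hTT
  have hsq : 0 < √q := Real.sqrt_pos.2 hq
  have hq' : 0 < q' := lt_of_lt_of_le (by positivity) hqq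
  have h1 : T ^ (m + 1) * √q ≤ √q' := by
    rw [← Real.sqrt_sq (show 0 ≤ T ^ (m + 1) by positivity), ← Real.sqrt_mul (by positivity)]
    refine Real.sqrt_le_sqrt (le_trans (le_of_eq ?_) hqq)
    ring
  have h2 : (4096 : ℝ) ≤ T ^ (m + 1) :=
    calc (4096 : ℝ) ≤ T := by linarith
      _ ≤ T ^ (m + 1) := le_self_pow₀ (by linarith) (by omega)
  refine one_div_le_one_div_of_le (by positivity) ?_
  calc 4096 * T ^ (3 * m + 4) * (q * √q) ≤ T ^ (m + 1) * T ^ (3 * m + 4) * (q * √q) := by gcongr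
    _ = T ^ (m + 2) * ((T ^ (2 * m + 2) * q) * (T ^ (m + 1) * √q)) := by ring
    _ ≤ T' ^ (m + 2) * (q' * √q') := by gcongr

/-! ### The lower bound -/

/-- The negatives of the rational points of the node tree form a `PointTree`: `dist_le` gives the
radii, `separated` the gaps. Limits of branches are divergent, and the product with six free
parameters has dimension at least 6 + s. -/
theorem exists_divergent_points {m : ℕ} (hm : 2 ≤ m) {s : NNReal}
    (hs : (s : ℝ) = (4 * m + 1) / (3 * m + 3)) :
    ∃ f : ℝ → Fin 2 → ℝ, (∀ y, unip (f y) ∈ Dlift) ∧ ∀ U : Set (Fin 3 × Fin 2 → ℝ),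
      MeasurableSet U → MeasureTheory.volume U ≠ 0 →
        ((6 + s : NNReal) : ENNReal) ≤ dimH (U ×ˢ (f '' Set.Ico (0 : ℝ) 1)) := by
  obtain ⟨u₀, u, c, hu₀, hpos, hsucc, hc⟩ := exists_node_tree hm
  set M : ℕ → ℕ := fun i => childCard m (scale i) with hM
  have hsc : ∀ k, (8192 : ℝ) ≤ scale k := fun k => by simp [scale]
  have hMpos : ∀ k, 0 < M k := fun k => by
    have h1 := le_childCard hm (show 8192 ≤ scale k by unfold scale; omega)
    have h2 : (0 : ℝ) < (scale k : ℝ) ^ (4 * m + 2) / 1024 := by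
      have := hsc k
      positivity
    exact_mod_cast h2.trans_le h1
  have hmod : ∀ k n, n % M k < M k := fun k n => Nat.mod_lt _ (hMpos k)
  have hposr : ∀ k n, (0 : ℝ) < u k n 2 := fun k n => by exact_mod_cast hpos k n
  have hle : ∀ k n, u (k + 1) n 2 ≤ 2 * (scale k : ℤ) ^ (2 * m + 2) * u k (n / M k) 2 :=
    fun k n => by
      rw [hsucc]
      exact (hc k (n / M k)).last_le _ (hmod k n)
  have hge : ∀ k n, (scale k : ℝ) ^ (2 * m + 2) * u k (n / M k) 2 ≤ u (k + 1) n 2 :=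
    fun k n => by
      rw [hsucc]
      exact_mod_cast (hc k (n / M k)).le_last _ (hmod k n)
  have hr : (1 : ℝ) ≤ u₀ 2 := by
    rw [← hu₀ 0]
    exact_mod_cast hpos 0 0
  have hrad : ∀ k n, (u k n 2 : ℝ) ≤ rad m (u₀ 2) k ^ 2 := fun k => by
    induction k with
    | zero =>
      intro n
      rw [hu₀]
      simpa [rad] using le_self_pow₀ hr two_ne_zero
    | succ k ih =>
      intro n
      have h1 : (u (k + 1) n 2 : ℝ) ≤ 2 * (scale k : ℝ) ^ (2 * m + 2) * u k (n / M k) 2 := by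
        exact_mod_cast hle k n
      have h2 := hsc k
      rw [rad_succ]
      calc _ ≤ 2 * (scale k : ℝ) ^ (2 * m + 2) * u k (n / M k) 2 := h1
        _ ≤ 4 * (scale k : ℝ) ^ (2 * m + 2) * rad m (u₀ 2) k ^ 2 := by
          have := hposr k (n / M k)
          gcongr
          · norm_num
          · exact ih _
        _ = _ := by ring
  set δ : ℕ → ℕ → ℝ := fun k n =>
    1 / ((scale k : ℝ) ^ (m + 2) * (u k n 2 * √(u k n 2 : ℝ))) with hδ
  have hδ' : ∀ k n, δ (k + 1) n ≤ 1 / (4096 * (scale k : ℝ) ^ (3 * m + 4) *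
      (u k (n / M k) 2 * √(u k (n / M k) 2 : ℝ))) := fun k n =>
    one_div_le_of_growth hm (hsc k) (by exact_mod_cast (by unfold scale; omega))
      (hposr _ _) (hge k n)
  have hgap : ∀ k n, gap m (u₀ 2) k ≤
      1 / (1024 * (scale k : ℝ) ^ (3 * m + 4) * (u k n 2 * √(u k n 2 : ℝ))) := fun k n => by
    have h1 := hsc k
    have h2 := hposr k n
    have h3 : 0 < √(u k n 2 : ℝ) := Real.sqrt_pos.2 h2
    have h4 : 0 < rad m (u₀ 2) k := lt_of_lt_of_le (by positivity) (two_pow_le_rad m hr k)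
    have h5 : √(u k n 2 : ℝ) ≤ rad m (u₀ 2) k := Real.sqrt_le_iff.2 ⟨h4.le, hrad k n⟩
    refine one_div_le_one_div_of_le (by positivity) ?_
    rw [pow_succ (rad m (u₀ 2) k)]
    gcongr
    exact hrad k n
  have htree : PointTree M (fun k n => -ratPt (u k n)) δ (gap m (u₀ 2)) := by
    refine ⟨hMpos, fun k n => ?_, fun k n => ?_, fun k n n' hnn hne => ?_, gap_antitone m hr⟩
    · rw [dist_neg_neg, hsucc]
      exact (hc k (n / M k)).dist_le _ (hmod k n)
    · have h1 := hsc k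
      have h2 := hposr k (n / M k)
      have h3 : 0 < √(u k (n / M k) 2 : ℝ) := Real.sqrt_pos.2 h2
      refine (mul_le_mul_of_nonneg_left (hδ' k n) two_pos.le).trans ?_
      rw [mul_one_div, div_le_div_iff₀ (by positivity) (by positivity)]
      have h4 : (scale k : ℝ) ^ (m + 2) ≤ (scale k : ℝ) ^ (3 * m + 4) :=
        pow_le_pow_right₀ (by linarith) (by omega)
      calc _ = 2 * (scale k : ℝ) ^ (m + 2) * (u k (n / M k) 2 * √(u k (n / M k) 2 : ℝ)) := by ring
        _ ≤ 4096 * (scale k : ℝ) ^ (3 * m + 4) *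
            (u k (n / M k) 2 * √(u k (n / M k) 2 : ℝ)) := by gcongr; norm_num
        _ = _ := by ring
    · have h1 := hδ' k n
      have h2 := hδ' k n'
      have h3 := hgap k (n / M k)
      rw [← hnn] at h2
      have hmm : n % M k ≠ n' % M k := fun h => hne (by
        rw [← Nat.div_add_mod n (M k), ← Nat.div_add_mod n' (M k), hnn, h])
      have h4 := (hc k (n / M k)).separated _ (hmod k n) _ (hmod k n') hmm
      rw [dist_neg_neg, hsucc, hsucc k n', ← hnn]
      refine le_trans ?_ h4
      have e : ∀ C : ℝ, 1 / (C * (scale k : ℝ) ^ (3 * m + 4) *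
          (u k (n / M k) 2 * √(u k (n / M k) 2 : ℝ))) = 1 / C * (1 / ((scale k : ℝ) ^ (3 * m + 4) *
            (u k (n / M k) 2 * √(u k (n / M k) 2 : ℝ)))) := fun C => by
        rw [mul_assoc, one_div_mul_one_div]
      -- The sibling distance is shared out as 1/1024 + 2/4096 + 2/4096 = 1/512: the gap and the
      -- margins of the two children.
      rw [e] at h1 h2 h3 ⊢
      linarith
  choose f hf using htree.exists_limit
  refine ⟨f, fun y => ?_, fun U hU hU0 => ?_⟩
  · refine unip_mem_Dlift (m := m) (fun k => u k (nodeAt M k y)) (fun k => hpos _ _) (fun k => ?_)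
      (fun k => hf y k)
    have := hle k (nodeAt M (k + 1) y)
    rwa [nodeAt_succ_div hMpos] at this
  · have h := htree.le_dimH_prod f hf (gap_pos m hr)
      (squeeze_zero (fun k => (gap_pos m hr k).le) (gap_le m hr)
        (tendsto_pow_atTop_nhds_zero_of_lt_one (by norm_num) (by norm_num))) s
      (by rw [hs]; exact (tendsto_levelCard_mul_gap hm hr).eventually_ge_atTop _) U hU hU0
    simpa using h

/-- The factor p has the prescribed columns, and its last column is normalised to give determinant
1; left multiplication by p preserves divergence. -/
lemma exists_entries_eq_param {B : Fin 3 × Fin 2 → ℝ} (hB : minor B ≠ 0) {x : Fin 2 → ℝ}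
    (hx : unip x ∈ Dlift) : ∃ g ∈ Dlift, cols (entries g) = B ∧ unst (entries g) = x := by
  set p : G := ⟨!![B (0, 0), B (0, 1), 0; B (1, 0), B (1, 1), 0; B (2, 0), B (2, 1), (minor B)⁻¹],
    by
      rw [Matrix.det_fin_three]
      simp
      rw [← sub_mul]
      exact mul_inv_cancel₀ hB⟩ with hp
  have he : ∀ i, entries (p * unip x) i = ![p.1 i 0, p.1 i 1,
      p.1 i 0 * x 0 + p.1 i 1 * x 1 + p.1 i 2] := fun i => by
    funext j
    change (p * unip x : G).1 i j = _
    rw [Matrix.SpecialLinearGroup.coe_mul, Matrix.mul_apply, Fin.sum_univ_three]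
    fin_cases j <;> simp [unip]
  have hcols : cols (entries (p * unip x)) = B := by
    funext ⟨i, j⟩
    rw [cols, he]
    fin_cases i <;> fin_cases j <;> simp [hp]
  refine ⟨p * unip x, mul_mem_Dlift (by simp [hp]) (by simp [hp]) hx, hcols, ?_⟩
  have h0 : minor B = B (0, 0) * B (1, 1) - B (0, 1) * B (1, 0) := rfl
  unfold unst
  rw [hcols, he, he]
  funext i
  fin_cases i
  · simp [hp]
    rw [div_eq_iff hB, h0]
    ring
  · simp [hp]
    rw [div_eq_iff hB, h0]
    ring

lemma contDiffOn_cols_unst :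
    ContDiffOn ℝ 1 (fun e => (cols e, unst e)) {e | ∀ p, |cols e p - idCols p| < 1 / 4} := by
  have hc : ContDiff ℝ 1 cols := by unfold cols; fun_prop
  refine hc.contDiffOn.prodMk (contDiffOn_pi.2 fun i => ?_)
  have hm : ContDiff ℝ 1 fun e : Fin 3 → Fin 3 → ℝ => minor (cols e) := by
    unfold minor cols
    fun_prop
  have h0 : ∀ e ∈ {e : Fin 3 → Fin 3 → ℝ | ∀ p, |cols e p - idCols p| < 1 / 4},
      minor (cols e) ≠ 0 := fun e he => by
    have := minor_pos he
    linarith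
  fin_cases i
  · exact ContDiffOn.div (by fun_prop) hm.contDiffOn h0
  · exact ContDiffOn.div (by fun_prop) hm.contDiffOn h0

lemma convex_cols : Convex ℝ {e : Fin 3 → Fin 3 → ℝ | ∀ p, |cols e p - idCols p| < 1 / 4} := by
  have : {e : Fin 3 → Fin 3 → ℝ | ∀ p, |cols e p - idCols p| < 1 / 4} =
      ⋂ p, {e | cols e p ∈ Metric.ball (idCols p) (1 / 4)} := by
    ext z
    simp [Real.dist_eq]
  rw [this]
  exact convex_iInter fun p => (convex_ball (idCols p) (1 / 4)).is_linear_preimage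
    ⟨fun _ _ => rfl, fun _ _ => rfl⟩

/-- The coordinate map is C¹ near the identity and maps the part of `Dlift` there onto a set
containing a ball times the divergent x, so the dimension of that product is a lower bound. -/
lemma le_dimH_Dlift_of_le {m : ℕ} (hm : 2 ≤ m) {s : NNReal}
    (hs : (s : ℝ) = (4 * m + 1) / (3 * m + 3)) :
    ((6 + s : NNReal) : ENNReal) ≤ dimH (entries '' Dlift) := by
  obtain ⟨f, hf, hdim⟩ := exists_divergent_points hm hs
  have hball : MeasureTheory.volume (Metric.ball idCols (1 / 4)) ≠ 0 :=
    (Metric.measure_ball_pos _ _ (by norm_num)).ne'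
  refine (hdim _ Metric.isOpen_ball.measurableSet hball).trans ?_
  set V := {e : Fin 3 → Fin 3 → ℝ | ∀ p, |cols e p - idCols p| < 1 / 4}
  calc dimH (Metric.ball idCols (1 / 4) ×ˢ (f '' Set.Ico (0 : ℝ) 1))
      ≤ dimH ((fun e => (cols e, unst e)) '' (entries '' Dlift ∩ V)) := by
        refine dimH_mono ?_
        rintro ⟨B, x⟩ ⟨hB, y, -, hy⟩
        have hx : unip x ∈ Dlift := by
          rw [← show f y = x from hy]
          exact hf y
        have hB' : ∀ p, |B p - idCols p| < 1 / 4 := fun p =>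
          (dist_le_pi_dist B idCols p).trans_lt hB
        have hm0 := minor_pos hB'
        obtain ⟨g, hg, h1, h2⟩ := exists_entries_eq_param (by linarith) hx
        refine ⟨entries g, ⟨⟨g, hg, rfl⟩, ?_⟩, Prod.ext h1 h2⟩
        intro p
        rw [h1]
        exact hB' p
    _ ≤ dimH (entries '' Dlift ∩ V) :=
      contDiffOn_cols_unst.dimH_image_le convex_cols Set.inter_subset_right
    _ ≤ _ := dimH_mono Set.inter_subset_left

theorem le_dimH_Dlift : 22 / 3 ≤ dimH (entries '' Dlift) := by
  refine ENNReal.le_of_forall_pos_le_add fun ε hε _ => ?_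
  obtain ⟨n, hn⟩ := exists_nat_one_div_lt (show (0 : ℝ) < ε by exact_mod_cast hε)
  set m := n + 2
  set s : NNReal := (4 * m + 1) / (3 * m + 3) with hs
  have h1 := le_dimH_Dlift_of_le (m := m) (by omega) (s := s) (by rw [hs]; push_cast; rfl)
  have h2 : (22 / 3 : NNReal) ≤ 6 + s + ε := by
    rw [← NNReal.coe_le_coe]
    have h3 : (1 : ℝ) / (m + 1) ≤ ε := by
      refine le_trans ?_ hn.le
      refine one_div_le_one_div_of_le (by positivity) ?_
      simp [m]
    -- The exponent falls short of 4/3 by exactly 1/(m + 1).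
    have h4 : (22 / 3 : ℝ) = 6 + (4 * m + 1) / (3 * m + 3) + 1 / (m + 1) := by
      field_simp
      ring
    rw [hs]
    push_cast
    linarith
  calc (22 / 3 : ENNReal) = ((22 / 3 : NNReal) : ENNReal) := by
        rw [ENNReal.coe_div (by norm_num)]
        norm_num
    _ ≤ ((6 + s + ε : NNReal) : ENNReal) := by exact_mod_cast h2
    _ ≤ _ := by
      rw [ENNReal.coe_add]
      gcongr

end DivergentTrajectories

theorem mainTheorem3 :
    ∀ m : MetricSpace DivergentTrajectories.X, DivergentTrajectories.IsAdmissible m →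
      DivergentTrajectories.hausdorffDim m DivergentTrajectories.D = 7 + 1 / 3 := by
  intro m hm
  rw [DivergentTrajectories.hausdorffDim_D_eq hm,
    DivergentTrajectories.dimH_Dlift_le.antisymm DivergentTrajectories.le_dimH_Dlift,
    show (22 : ENNReal) = 7 * 3 + 1 by norm_num, ENNReal.add_div,
    ENNReal.mul_div_cancel_right (by norm_num) (by norm_num)]
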